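/- Let $N\ge 3$, $2^*=\frac{2N}{N-2}$, $2<p,q<2+\frac4N$, $\alpha,\beta>1$ with $\alpha+\beta=2^*$, $\mu_1,\mu_2>0$ and $a,b>0$. For $\nu>0$ and $u,v\in H^1(\mathbb R^N)$ put $$J(u,v)=\tfrac12\big(\|\nabla u\|_2^2+\|\nabla v\|_2^2\big)-\tfrac{\mu_1}{p}\|u\|_p^p-\tfrac{\mu_2}{q}\|v\|_q^q-\nu\int_{\mathbb R^N}|u|^\alpha|v|^\beta\,dx .$$ Let $T(a_1,b_1)=\{(u,v)\in H^1(\mathbb R^N)^2:\|u\|_2^2=a_1,\ \|v\|_2^2=b_1\}$, let $A_\rho^{a_1,b_1}$ (respectively $B_\rho^{a_1,b_1}$) be the set of $(u,v)\in T(a_1,b_1)$ with $\|\nabla u\|_2^2+\|\nabla v\|_2^2<\rho$ (respectively $\rho\le\|\nabla u\|_2^2+\|\nabla v\|_2^2\le2\rho$), and let $S$ be the sharp constant in $S\|u\|_{2^*}^2\le\|\nabla u\|_2^2$, $u\in D^{1,2}(\mathbb R^N)$. There exist $\nu_0,k_0,\rho_0>0$ such that for all $(a_1,b_1)\in[0,a]\times[0,b]\setminus\{(0,0)\}$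 and all $\nu\in(0,\nu_0)$ $$m_\nu(a_1,b_1):=\inf_{A_{\rho_0}^{a_1,b_1}}J<0<k_0\le\inf_{B_{\rho_0}^{a_1,b_1}}J. \qquad (*)$$ Let $\nu_0,k_0,\rho_0>0$ be any constants with $(*)$, let $\nu\in(0,\nu_0)$, $(a_1,b_1)\in(0,a]\times(0,b]$, and let $(u_0,v_0)\in A_{\rho_0}^{a_1,b_1}$ be a local minimizer, that is $J(u_0,v_0)=m_\nu(a_1,b_1)$, with $u_0,v_0$ everywhere positive, finite, radially symmetric and nonincreasing in $|x|$. For $n\in\mathbb N$ let $U_n(x)=\Theta_n(|x|)$ with $$\Theta_n(r)=[N(N-2)]^{\frac{N-2}{4}}\begin{cases}\left(\frac{n}{1+n^2r^2}\right)^{\frac{N-2}2},&0\le r<1,\\ \left(\frac{n}{1+n^2}\right)^{\frac{N-2}2}(2-r),&1\le r<2,\\ 0,&r\ge2,\end{cases}$$ and for $t\ge0$ let $$H_n(t)=J\left(\frac{\sqrt{a_1}\,(u_0+tU_n)}{\|u_0+tU_n\|_2},\ \frac{\sqrt{b_1}\,\big(v_0+\sqrt{\beta/\alpha}\,tU_n\big)}{\|v_0+\sqrt{\beta/\alpha}\,tU_n\|_2}\right).$$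 Then there are $T>0$ and $n_T\in\mathbb N$ with $H_n(T)<2m_\nu(a_1,b_1)$ for all $n\ge n_T$. For any such $T$ and $n_T$, for every $n\ge n_T$ the maximum of $H_n$ over $[0,T]$ is attained at some $t_n\in(0,T)$, and for all sufficiently large $n$ $$\max_{t\in[0,T]}H_n(t)<m_\nu(a_1,b_1)+\frac{2}{N-2}\,\nu^{-\frac{N-2}{2}}\alpha^{-\frac{(N-2)\alpha}{4}}\beta^{-\frac{(N-2)\beta}{4}}S^{\frac N2}.$$ -/

import Mathlib

open MeasureTheory Set Filter
open scoped ContDiff Gradient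

noncomputable section

namespace NLSSystem

/-- Euclidean space `ℝ^N`. -/
abbrev Eucl (N : ℕ) : Type := EuclideanSpace ℝ (Fin N)

/-- `G` is a weak (distributional) gradient of `u`, tested against `C_c^∞(ℝ^N)`. -/
def IsWeakGradient {N : ℕ} (u : Eucl N → ℝ) (G : Eucl N → Eucl N) : Prop :=
  ∀ φ : Eucl N → ℝ, ContDiff ℝ ∞ φ → HasCompactSupport φ →
    ∫ x, u x • ∇ φ x = - ∫ x, φ x • G x

/-- `u ∈ H^1(ℝ^N)`: `u` is in `L^2` and has a weak gradient in `L^2`. -/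
def MemH1 {N : ℕ} (u : Eucl N → ℝ) : Prop :=
  MemLp u 2 volume ∧ ∃ G : Eucl N → Eucl N, MemLp G 2 volume ∧ IsWeakGradient u G

open Classical in
/-- The weak gradient of a function of `H^1` (unique almost everywhere);
the zero field if there is no weak gradient in `L^2`. -/
def weakGradient {N : ℕ} (u : Eucl N → ℝ) : Eucl N → Eucl N :=
  if h : ∃ G : Eucl N → Eucl N, MemLp G 2 volume ∧ IsWeakGradient u G then h.choose else 0

/-- `‖∇u‖_2^2`. -/
def gradSq {N : ℕ} (u : Eucl N → ℝ) : ℝ := ∫ x, ‖weakGradient u x‖ ^ 2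

/-- `‖u‖_2^2`. -/
def mass {N : ℕ} (u : Eucl N → ℝ) : ℝ := ∫ x, |u x| ^ 2

/-- The critical exponent `2^* = 2N/(N-2)`. -/
def critExp (N : ℕ) : ℝ := 2 * (N : ℝ) / ((N : ℝ) - 2)

/-- The sharp constant `S` of the critical Sobolev embedding: the largest `s` with
`s ‖φ‖_{2^*}^2 ≤ ‖∇φ‖_2^2` for all `φ ∈ C_c^∞(ℝ^N)`.  As `D^{1,2}(ℝ^N)` is the completion of
`C_c^∞(ℝ^N)` for `‖∇ ·‖_2`, this is also the largest such `s` for `D^{1,2}(ℝ^N)`. -/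
def sobolevConst (N : ℕ) : ℝ :=
  sSup {s : ℝ | ∀ φ : Eucl N → ℝ, ContDiff ℝ ∞ φ → HasCompactSupport φ →
    s * (∫ x, |φ x| ^ critExp N) ^ (2 / critExp N) ≤ ∫ x, ‖∇ φ x‖ ^ 2}

/-- The energy functional
`J(u,v) = ½(‖∇u‖_2² + ‖∇v‖_2²) - (μ₁/p)‖u‖_p^p - (μ₂/q)‖v‖_q^q - ν ∫ |u|^α |v|^β`. -/
def energy {N : ℕ} (p q α β μ₁ μ₂ ν : ℝ) (u v : Eucl N → ℝ) : ℝ :=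
  (1 / 2) * (gradSq u + gradSq v)
    - μ₁ / p * (∫ x, |u x| ^ p) - μ₂ / q * (∫ x, |v x| ^ q)
    - ν * ∫ x, |u x| ^ α * |v x| ^ β

/-- The constraint `T(a,b)`. -/
def torus (N : ℕ) (a b : ℝ) : Set ((Eucl N → ℝ) × (Eucl N → ℝ)) :=
  {w | MemH1 w.1 ∧ MemH1 w.2 ∧ mass w.1 = a ∧ mass w.2 = b}

/-- `A_ρ^{a,b}`: the pairs in `T(a,b)` with `‖∇u‖_2² + ‖∇v‖_2² < ρ`. -/
def setA (N : ℕ) (a b ρ : ℝ) : Set ((Eucl N → ℝ) × (Eucl N → ℝ)) :=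
  {w | w ∈ torus N a b ∧ gradSq w.1 + gradSq w.2 < ρ}

/-- `B_ρ^{a,b}`: the pairs in `T(a,b)` with `ρ ≤ ‖∇u‖_2² + ‖∇v‖_2² ≤ 2ρ`. -/
def setB (N : ℕ) (a b ρ : ℝ) : Set ((Eucl N → ℝ) × (Eucl N → ℝ)) :=
  {w | w ∈ torus N a b ∧ ρ ≤ gradSq w.1 + gradSq w.2 ∧ gradSq w.1 + gradSq w.2 ≤ 2 * ρ}

/-- `m_ν(a₁,b₁)`: the infimum of `J` over `A_{ρ₀}^{a₁,b₁}`. -/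
def localInf (N : ℕ) (p q α β μ₁ μ₂ ν ρ₀ a₁ b₁ : ℝ) : ℝ :=
  sInf ((fun w : (Eucl N → ℝ) × (Eucl N → ℝ) => energy p q α β μ₁ μ₂ ν w.1 w.2) ''
    setA N a₁ b₁ ρ₀)

/-- The defining property of the constants `ν₀, k₀, ρ₀ > 0` attached to the masses `a, b`: for all
`(a₁,b₁) ∈ [0,a] × [0,b] \ {(0,0)}` and `ν ∈ (0,ν₀)`,
`m_ν(a₁,b₁) < 0 < k₀ ≤ J` on `B_{ρ₀}^{a₁,b₁}`. -/
def IsLocalMinConstants (N : ℕ) (p q α β μ₁ μ₂ a b ν₀ k₀ ρ₀ : ℝ) : Prop :=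
  0 < ν₀ ∧ 0 < k₀ ∧ 0 < ρ₀ ∧
  ∀ a₁ ∈ Icc 0 a, ∀ b₁ ∈ Icc 0 b, (a₁, b₁) ≠ (0, 0) → ∀ ν ∈ Ioo 0 ν₀,
    localInf N p q α β μ₁ μ₂ ν ρ₀ a₁ b₁ < 0 ∧
    ∀ w ∈ setB N a₁ b₁ ρ₀, k₀ ≤ energy p q α β μ₁ μ₂ ν w.1 w.2

/-- Radially symmetric and nonincreasing in `|x|`. -/
def IsRadialDecreasing {N : ℕ} (u : Eucl N → ℝ) : Prop :=
  ∀ x y : Eucl N, ‖x‖ ≤ ‖y‖ → u y ≤ u x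

/-- `(u₀,v₀)` is a local minimizer: it lies in `A_{ρ₀}^{a₁,b₁}`, attains `m_ν(a₁,b₁)`, and both
components are positive and Schwarz symmetric. -/
structure IsLocalMinimizer (N : ℕ) (p q α β μ₁ μ₂ ν ρ₀ a₁ b₁ : ℝ)
    (u₀ v₀ : Eucl N → ℝ) : Prop where
  mem : (u₀, v₀) ∈ setA N a₁ b₁ ρ₀
  attains : energy p q α β μ₁ μ₂ ν u₀ v₀ = localInf N p q α β μ₁ μ₂ ν ρ₀ a₁ b₁
  pos_fst : ∀ x, 0 < u₀ x
  pos_snd : ∀ x, 0 < v₀ x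
  symm_fst : IsRadialDecreasing u₀
  symm_snd : IsRadialDecreasing v₀

/-- The radial profile `Θ_n` of the truncated Aubin–Talenti bubble, on `r ≥ 0`. -/
def bubbleProfile (N n : ℕ) (r : ℝ) : ℝ :=
  ((N : ℝ) * ((N : ℝ) - 2)) ^ (((N : ℝ) - 2) / 4) *
    (if r < 1 then ((n : ℝ) / (1 + (n : ℝ) ^ 2 * r ^ 2)) ^ (((N : ℝ) - 2) / 2)
     else if r < 2 then ((n : ℝ) / (1 + (n : ℝ) ^ 2)) ^ (((N : ℝ) - 2) / 2) * (2 - r)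
     else 0)

/-- `U_n(x) = Θ_n(|x|)`. -/
def bubble (N n : ℕ) (x : Eucl N) : ℝ := bubbleProfile N n ‖x‖

/-- The multiple `(√a / ‖u‖_2) u` of `u`, of mass `a`. -/
def normalizeMass {N : ℕ} (a : ℝ) (u : Eucl N → ℝ) : Eucl N → ℝ :=
  fun x => Real.sqrt a / Real.sqrt (mass u) * u x

/-- `H_n(t) = J(Φ_{n,t}, Ψ_{n,t})`, where `Φ_{n,t}` and `Ψ_{n,t}` are `u₀ + t U_n` and
`v₀ + √(β/α) t U_n` normalized to the masses `a₁` and `b₁`. -/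
def pathEnergy (N : ℕ) (p q α β μ₁ μ₂ ν a₁ b₁ : ℝ) (u₀ v₀ : Eucl N → ℝ) (n : ℕ) (t : ℝ) : ℝ :=
  energy p q α β μ₁ μ₂ ν
    (normalizeMass a₁ fun x => u₀ x + t * bubble N n x)
    (normalizeMass b₁ fun x => v₀ x + Real.sqrt (β / α) * t * bubble N n x)

end NLSSystem

end

/-!
The quantity to beat is the energy level of one Aubin–Talenti bubble placed on top of the local
minimizer, so two things are needed: the value of the sharp Sobolev constant, and an expansion of
the energy of the normalized sum in which the errors are smaller than some genuine gain.

**The sharp Sobolev constant.** Only `‖U‖_{2^*}^{2^*} ≤ S^{N/2}` for the standard bubble `U` is used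
(`bubbleEnergy_le_sobolevConst_rpow`). This is the sharp Sobolev inequality for test functions,
which is obtained, following Bobkov and Ledoux, from the Borell–Brascamp–Lieb inequality (`bbl`, by
induction on the dimension from the Brunn–Minkowski inequality on the line). Its strengthened form
`bbl_improved` is differentiated at `t = 0` against the quadratic function `1 + |x|^2`
(`bbl_gradient`), and the substitution `g = f^{-2/(N-2)}` gives `sharp_sobolev`. Mollification
extends it to `H^1` (`sobolevBound_of_memH1`).

**The constants.** Hölder interpolation yields the Gagliardo–Nirenberg inequality; as
`p, q < 2 + 4/N`, the subcritical terms grow slower than `‖∇u‖_2^2 + ‖∇v‖_2^2`, so that the energy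
is positive on `B_ρ` for large `ρ` and then small `ν`, while spreading a test function out makes it
negative inside `A_ρ` (`exists_isLocalMinConstants`).

**The expansion.** Truncation costs little: `‖∇U_n‖_2^2` and `‖U_n‖_{2^*}^{2^*}` differ from the
energy `K` of the standard bubble by `O(n^{2η-2})`, and `‖U_n‖_2^2 = O(n^{2η-2})`, for every `η ≥ 0`
with `η > (4-N)/2` (`bubble_estimates`). In the energy of the normalized pair
`(u_0 + t U_n, v_0 + √(β/α) t U_n)`, the terms linear in `U_n` cancel against the change of the
normalizing factors, by the Euler–Lagrange equation of the minimizer. Only one inequality of that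
equation is needed. It comes from the variations `u_0 - ε U_n`, which stay nonnegative since `u_0`
is bounded below on the support of `U_n` (`euler_lagrange_le`). What remains is
`m_ν + K (c_1 z - c_2 z^{2^*/2})` with `z` comparable to `t^2`, up to `O(n^{2η-2})`, minus two
nonnegative terms: the `L^p`-norm of the bubble, and the part of the interaction that involves both
the minimizer and the bubble beyond first order (`exists_energy_normalized_le`,
`exists_pathEnergy_le`). The maximum over `z` of the leading part is the asserted level, with `K`
for `S^{N/2}` (`bubbleLevel_le`).

**Strictness.** For `t` away from `0`, one of the two nonnegative terms exceeds the error
(`exists_gain`): for `N = 3` the interaction, of order at least `n^{-1/2}`, and for `N ≥ 4` the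
`L^p`-norm, of order at least `n^{(N-2)p/2-N}`. For `t` near `0` the leading part itself is below
the level (`exists_pathEnergy_lt`).

**The maximum.** As `c_1 z - c_2 z^{2^*/2} → -∞`, the path ends below `2 m_ν` for large `T`
(`exists_pathEnergy_lt_level`). A path that ends there has left `A_{ρ_0}`, because `2 m_ν < m_ν`; so
it crosses `B_{ρ_0}`, where the energy is positive, whereas it is negative at both ends
(`exists_isMaxOn_pathEnergy`).
-/


noncomputable section

namespace NLSSystem

open scoped ENNReal Pointwise

/-! ### The Borell–Brascamp–Lieb inequality -/

/-- The one-dimensional Brunn–Minkowski inequality. -/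
lemma volume_add_le_of_add_mem {A B C : Set ℝ} (hA : MeasurableSet A) (hB : MeasurableSet B)
    (hA0 : A.Nonempty) (hB0 : B.Nonempty)
    (h : ∀ x ∈ A, ∀ y ∈ B, x + y ∈ C) : volume A + volume B ≤ volume C := by
  have key : ∀ K L : Set ℝ, IsCompact K → IsCompact L → K ⊆ A → L ⊆ B → K.Nonempty → L.Nonempty →
      volume K + volume L ≤ volume C := by
    intro K L hK hL hKA hLB hK0 hL0
    -- `K + min L` and `max K + L` lie in `C` and meet only in `max K + min L`.
    obtain ⟨a, haK, ha⟩ := hK.exists_isGreatest hK0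
    obtain ⟨b, hbL, hb⟩ := hL.exists_isLeast hL0
    have h1 : volume K = volume ((fun x => x + b) '' K) := by simp
    have h2 : volume L = volume (((fun x => a + x) '' L) \ {a + b}) := by
      rw [measure_sdiff_null (by simp)]; simp
    rw [h1, h2, ← measure_union]
    · apply measure_mono
      rintro z (⟨x, hx, rfl⟩ | ⟨⟨y, hy, rfl⟩, -⟩)
      · exact h x (hKA hx) b (hLB hbL)
      · exact h a (hKA haK) y (hLB hy)
    · rw [Set.disjoint_left]
      rintro z ⟨x, hx, rfl⟩ ⟨⟨y, hy, hxy⟩, hne⟩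
      have h3 := ha hx
      have h4 := hb hy
      apply hne
      simp only [mem_singleton_iff]
      simp only at hxy
      linarith
    · exact ((hL.image (by fun_prop)).measurableSet).diff (measurableSet_singleton _)
  obtain ⟨x0, hx0⟩ := hA0
  obtain ⟨y0, hy0⟩ := hB0
  rw [hA.measure_eq_iSup_isCompact volume, hB.measure_eq_iSup_isCompact volume]
  simp only [iSup_and']
  refine ENNReal.biSup_add_biSup_le' ⟨∅, by simp⟩ ⟨∅, by simp⟩ ?_
  rintro K ⟨hKA, hK⟩ L ⟨hLB, hL⟩
  calc volume K + volume L ≤ volume (insert x0 K) + volume (insert y0 L) := by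
        gcongr <;> exact subset_insert _ _
    _ ≤ _ := key _ _ (hK.insert _) (hL.insert _) (insert_subset hx0 hKA) (insert_subset hy0 hLB)
        (insert_nonempty _ _) (insert_nonempty _ _)

lemma volume_combo_le {A B C : Set ℝ} (hA : MeasurableSet A) (hB : MeasurableSet B)
    (hA0 : A.Nonempty) (hB0 : B.Nonempty) {t : ℝ} (ht : t ∈ Ioo (0 : ℝ) 1)
    (h : ∀ x ∈ A, ∀ y ∈ B, (1 - t) * x + t * y ∈ C) :
    ENNReal.ofReal (1 - t) * volume A + ENNReal.ofReal t * volume B ≤ volume C := by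
  obtain ⟨ht0, ht1⟩ := ht
  have e1 : ENNReal.ofReal (1 - t) * volume A = volume ((1 - t) • A) := by
    rw [Measure.addHaar_smul]
    simp [abs_of_pos (show 0 < 1 - t by linarith)]
  have e2 : ENNReal.ofReal t * volume B = volume (t • B) := by
    rw [Measure.addHaar_smul]
    simp [abs_of_pos ht0]
  rw [e1, e2]
  refine volume_add_le_of_add_mem (hA.const_smul_of_ne_zero (by linarith))
    (hB.const_smul_of_ne_zero (by linarith)) (hA0.smul_set) (hB0.smul_set) ?_
  rintro _ ⟨x, hx, rfl⟩ _ ⟨y, hy, rfl⟩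
  exact h x hx y hy

/-- If `w` dominates the minimum of `u` and `v` along convex combinations and `u`, `v` have the
same supremum, the integral of `w` is at least the convex combination of those of `u` and `v`:
apply the Brunn–Minkowski inequality to superlevel sets. -/
lemma lintegral_combo_le_of_sup_eq {u v w : ℝ → ℝ} (hu : Measurable u) (hv : Measurable v)
    (hw : Measurable w) (hu0 : ∀ x, 0 ≤ u x) (hv0 : ∀ x, 0 ≤ v x) (hw0 : ∀ x, 0 ≤ w x) {M : ℝ}
    (huM : ∀ x, u x ≤ M) (hvM : ∀ x, v x ≤ M) (huM' : ∀ l, 0 < l → l < M → ∃ x, l < u x)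
    (hvM' : ∀ l, 0 < l → l < M → ∃ x, l < v x) {t : ℝ} (ht : t ∈ Ioo (0 : ℝ) 1)
    (h : ∀ x y l, 0 < l → l < u x → l < v y → l < w ((1 - t) * x + t * y)) :
    ENNReal.ofReal (1 - t) * (∫⁻ x, ENNReal.ofReal (u x)) +
      ENNReal.ofReal t * (∫⁻ x, ENNReal.ofReal (v x)) ≤ ∫⁻ x, ENNReal.ofReal (w x) := by
  have hanti : Antitone fun a => volume {x | a < u x} :=
    fun a b hab => measure_mono fun x hx => lt_of_le_of_lt hab hx
  rw [lintegral_eq_lintegral_meas_lt volume (Eventually.of_forall hu0) hu.aemeasurable,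
    lintegral_eq_lintegral_meas_lt volume (Eventually.of_forall hv0) hv.aemeasurable,
    lintegral_eq_lintegral_meas_lt volume (Eventually.of_forall hw0) hw.aemeasurable,
    ← lintegral_const_mul' _ _ ENNReal.ofReal_ne_top,
    ← lintegral_const_mul' _ _ ENNReal.ofReal_ne_top,
    ← lintegral_add_left (Measurable.const_mul (Antitone.measurable hanti) _)]
  refine setLIntegral_mono' measurableSet_Ioi fun l hl => ?_
  rcases lt_or_ge l M with hlM | hlM
  · exact volume_combo_le (measurableSet_lt measurable_const hu)
      (measurableSet_lt measurable_const hv)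
      (huM' l hl hlM) (hvM' l hl hlM) ht fun x hx y hy => h x y l hl hx hy
  · have h1 : {a | l < u a} = ∅ := by
      ext x; simpa using (huM x).trans hlM
    have h2 : {a | l < v a} = ∅ := by
      ext x; simpa using (hvM x).trans hlM
    simp [h1, h2]

/-- The one-dimensional Borell–Brascamp–Lieb inequality, for functions bounded away from zero. -/
lemma bbl_real_of_pos {e : ℝ} (he : 0 ≤ e) {t : ℝ} (ht : t ∈ Ioo (0 : ℝ) 1)
    {g W h : ℝ → ℝ≥0∞} (hg : Measurable g) (hW : Measurable W) (hh : Measurable h)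
    (H : ∀ x y, h ((1 - t) * x + t * y) ≤ ENNReal.ofReal (1 - t) * g x + ENNReal.ofReal t * W y)
    {d : ℝ≥0∞} (hd : d ≠ 0) (hgd : ∀ x, d ≤ g x) (hWd : ∀ x, d ≤ W x) {L : ℝ≥0∞}
    (hgL : L ≤ ∫⁻ x, g x ^ (-(1 + e))) (hWL : L ≤ ∫⁻ x, W x ^ (-(1 + e))) :
    L ≤ ∫⁻ x, h x ^ (-(1 + e)) := by
  have he1 : 0 < 1 + e := by linarith
  set a := ⨅ x, g x with ha
  set b := ⨅ x, W x with hb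
  have ha0 : a ≠ 0 := (lt_of_lt_of_le (pos_iff_ne_zero.2 hd) (le_iInf hgd)).ne'
  have hb0 : b ≠ 0 := (lt_of_lt_of_le (pos_iff_ne_zero.2 hd) (le_iInf hWd)).ne'
  by_cases hat : a = ⊤
  · have : ∀ x, g x = ⊤ := fun x => top_le_iff.1 (hat ▸ iInf_le g x)
    simp only [this, ENNReal.top_rpow_of_neg (show -(1 + e) < 0 by linarith), lintegral_zero] at hgL
    exact hgL.trans zero_le
  by_cases hbt : b = ⊤
  · have : ∀ x, W x = ⊤ := fun x => top_le_iff.1 (hbt ▸ iInf_le W x)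
    simp only [this, ENNReal.top_rpow_of_neg (show -(1 + e) < 0 by linarith), lintegral_zero] at hWL
    exact hWL.trans zero_le
  obtain ⟨ht0, ht1⟩ := id ht
  set c := ENNReal.ofReal (1 - t) * a + ENNReal.ofReal t * b with hc
  have hc0 : c ≠ 0 := by
    have : ENNReal.ofReal t * b ≠ 0 := mul_ne_zero (by simpa using ht0) hb0
    simp [hc, hb0, ht0]
  have hct : c ≠ ⊤ := by
    simp [hc, ENNReal.mul_eq_top, hat, hbt]
  -- the functions normalized to have supremum one
  set u : ℝ → ℝ := fun x => ((g x / a) ^ (-(1 + e))).toReal with hu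
  set v : ℝ → ℝ := fun x => ((W x / b) ^ (-(1 + e))).toReal with hv
  set w : ℝ → ℝ := fun x => (min 1 ((h x / c) ^ (-(1 + e)))).toReal with hw
  have mono : ∀ {x y : ℝ≥0∞}, x ≤ y → y ^ (-(1 + e)) ≤ x ^ (-(1 + e)) := fun {x y} hxy => by
    rw [ENNReal.rpow_neg, ENNReal.rpow_neg, ENNReal.inv_le_inv]
    exact ENNReal.rpow_le_rpow hxy he1.le
  have le_one : ∀ {f : ℝ → ℝ≥0∞} {m : ℝ≥0∞}, m ≠ 0 → m ≠ ⊤ → m = ⨅ x, f x →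
      ∀ x, (f x / m) ^ (-(1 + e)) ≤ 1 := fun {f m} hm0 hm hmf x => by
    have : (1 : ℝ≥0∞) ≤ f x / m := by
      rw [ENNReal.le_div_iff_mul_le (Or.inl hm0) (Or.inl hm), one_mul, hmf]
      exact iInf_le f x
    calc _ ≤ (1 : ℝ≥0∞) ^ (-(1 + e)) := mono this
      _ = 1 := by simp
  have hsup : ∀ {f : ℝ → ℝ≥0∞} {m : ℝ≥0∞}, m ≠ 0 → m ≠ ⊤ → m = ⨅ x, f x → ∀ l : ℝ, 0 < l →
      l < 1 → ∃ x, l < ((f x / m) ^ (-(1 + e))).toReal := by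
    intro f m hm0 hm hmf l hl hl1
    have h1 : m < m * ENNReal.ofReal (l ^ (-(1 + e)⁻¹)) := by
      conv_lhs => rw [← mul_one m]
      refine ENNReal.mul_lt_mul_right hm0 hm ?_
      rw [← ENNReal.ofReal_one]
      refine (ENNReal.ofReal_lt_ofReal_iff (by positivity)).2 ?_
      exact Real.one_lt_rpow_of_pos_of_lt_one_of_neg hl hl1 (by
        have := inv_pos.2 he1
        linarith)
    conv_lhs at h1 => rw [hmf]
    obtain ⟨x, hx⟩ := iInf_lt_iff.1 h1
    refine ⟨x, ?_⟩
    have h2 : f x / m < ENNReal.ofReal (l ^ (-(1 + e)⁻¹)) := by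
      rw [ENNReal.div_lt_iff (Or.inl hm0) (Or.inl hm), mul_comm]
      exact hx
    have h3 : ENNReal.ofReal l < (f x / m) ^ (-(1 + e)) := by
      rw [ENNReal.rpow_neg, ENNReal.lt_inv_iff_lt_inv]
      calc (f x / m) ^ (1 + e) < (ENNReal.ofReal (l ^ (-(1 + e)⁻¹))) ^ (1 + e) :=
            ENNReal.rpow_lt_rpow h2 he1
        _ = (ENNReal.ofReal l)⁻¹ := by
            rw [ENNReal.ofReal_rpow_of_nonneg (by positivity) he1.le, ← Real.rpow_mul hl.le,
              ← ENNReal.ofReal_inv_of_pos hl, neg_mul, inv_mul_cancel₀ he1.ne', Real.rpow_neg_one]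
    rw [← ENNReal.ofReal_lt_iff_lt_toReal hl.le
      (ne_top_of_le_ne_top ENNReal.one_ne_top (le_one hm0 hm hmf x))]
    exact h3
  have hone : ∀ (f : ℝ → ℝ≥0∞) (m : ℝ≥0∞), m ≠ 0 → m ≠ ⊤ → m = ⨅ x, f x →
      ∀ x, ((f x / m) ^ (-(1 + e))).toReal ≤ 1 := fun f m h1 h2 h3 x => by
    simpa using ENNReal.toReal_mono ENNReal.one_ne_top (le_one h1 h2 h3 x)
  have key := lintegral_combo_le_of_sup_eq (u := u) (v := v) (w := w) (M := 1)
    (((hg.div_const a).pow_const _).ennreal_toReal) (((hW.div_const b).pow_const _).ennreal_toReal)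
    ((measurable_const.min ((hh.div_const c).pow_const _)).ennreal_toReal)
    (fun _ => ENNReal.toReal_nonneg) (fun _ => ENNReal.toReal_nonneg)
    (fun _ => ENNReal.toReal_nonneg) (hone g a ha0 hat ha) (hone W b hb0 hbt hb)
    (hsup ha0 hat ha) (hsup hb0 hbt hb) ht ?_
  · have scale : ∀ {f : ℝ → ℝ≥0∞} {m : ℝ≥0∞}, Measurable f → m ≠ 0 → m ≠ ⊤ →
        ∫⁻ x, (f x / m) ^ (-(1 + e)) = m ^ (1 + e) * ∫⁻ x, f x ^ (-(1 + e)) := by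
      intro f m hf hm0 hm
      rw [← lintegral_const_mul _ (hf.pow_const _)]
      congr with x
      rw [ENNReal.rpow_neg, ENNReal.div_rpow_of_nonneg _ _ he1.le, ENNReal.inv_div
        (Or.inl (by simp [hm, he1.le])) (Or.inl (by simp [hm0, hm])), div_eq_mul_inv,
        ENNReal.rpow_neg]
    have eu : ∫⁻ x, ENNReal.ofReal (u x) = a ^ (1 + e) * ∫⁻ x, g x ^ (-(1 + e)) := by
      rw [← scale hg ha0 hat]
      congr with x
      exact ENNReal.ofReal_toReal (ne_top_of_le_ne_top ENNReal.one_ne_top (le_one ha0 hat ha x))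
    have ev : ∫⁻ x, ENNReal.ofReal (v x) = b ^ (1 + e) * ∫⁻ x, W x ^ (-(1 + e)) := by
      rw [← scale hW hb0 hbt]
      congr with x
      exact ENNReal.ofReal_toReal (ne_top_of_le_ne_top ENNReal.one_ne_top (le_one hb0 hbt hb x))
    have ew : ∫⁻ x, ENNReal.ofReal (w x) ≤ c ^ (1 + e) * ∫⁻ x, h x ^ (-(1 + e)) := by
      rw [← scale hh hc0 hct]
      exact lintegral_mono fun x => ENNReal.ofReal_toReal_le.trans (min_le_right _ _)
    rw [eu, ev] at key
    have hconv : c ^ (1 + e) ≤ ENNReal.ofReal (1 - t) * a ^ (1 + e) +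
        ENNReal.ofReal t * b ^ (1 + e) :=
      ENNReal.rpow_arith_mean_le_arith_mean2_rpow _ _ _ _
        (by rw [← ENNReal.ofReal_add (by linarith) ht0.le]; simp) (by linarith)
    have hfin : c ^ (1 + e) * L ≤ c ^ (1 + e) * ∫⁻ x, h x ^ (-(1 + e)) := by
      refine le_trans ?_ (key.trans ew)
      calc c ^ (1 + e) * L ≤ (ENNReal.ofReal (1 - t) * a ^ (1 + e) +
            ENNReal.ofReal t * b ^ (1 + e)) * L := by gcongr
        _ = ENNReal.ofReal (1 - t) * (a ^ (1 + e) * L) +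
            ENNReal.ofReal t * (b ^ (1 + e) * L) := by ring
        _ ≤ _ := by gcongr
    exact (ENNReal.mul_le_mul_iff_right (by simp [hc0, hct]) (by simp [hc0, hct])).1 hfin
  · intro x y l hl hlu hlv
    have h1 : h ((1 - t) * x + t * y) / c ≤ max (g x / a) (W y / b) := by
      refine ENNReal.div_le_of_le_mul ((H x y).trans ?_)
      calc ENNReal.ofReal (1 - t) * g x + ENNReal.ofReal t * W y
          = ENNReal.ofReal (1 - t) * (g x / a * a) + ENNReal.ofReal t * (W y / b * b) := by
            rw [ENNReal.div_mul_cancel ha0 hat, ENNReal.div_mul_cancel hb0 hbt]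
        _ ≤ ENNReal.ofReal (1 - t) * (max (g x / a) (W y / b) * a) +
            ENNReal.ofReal t * (max (g x / a) (W y / b) * b) := by
            gcongr
            · exact le_max_left _ _
            · exact le_max_right _ _
        _ = _ := by rw [hc]; ring
    have h2 : min ((g x / a) ^ (-(1 + e))) ((W y / b) ^ (-(1 + e))) ≤
        (h ((1 - t) * x + t * y) / c) ^ (-(1 + e)) := by
      rcases le_total (g x / a) (W y / b) with h3 | h3
      · rw [max_eq_right h3] at h1
        exact (min_le_right _ _).trans (mono h1)
      · rw [max_eq_left h3] at h1
        exact (min_le_left _ _).trans (mono h1)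
    have h4 : min 1 ((h ((1 - t) * x + t * y) / c) ^ (-(1 + e))) ≠ ⊤ :=
      ne_top_of_le_ne_top ENNReal.one_ne_top (min_le_left _ _)
    rw [hw, ← ENNReal.ofReal_lt_iff_lt_toReal hl.le h4]
    have h5 := (ENNReal.ofReal_lt_iff_lt_toReal hl.le
      (ne_top_of_le_ne_top ENNReal.one_ne_top (le_one ha0 hat ha x))).2 hlu
    have h6 := (ENNReal.ofReal_lt_iff_lt_toReal hl.le
      (ne_top_of_le_ne_top ENNReal.one_ne_top (le_one hb0 hbt hb y))).2 hlv
    exact lt_min (h5.trans_le (le_one ha0 hat ha x)) ((lt_min h5 h6).trans_le h2)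

lemma ennreal_rpow_neg_anti {r : ℝ} (hr : 0 ≤ r) {x y : ℝ≥0∞} (hxy : x ≤ y) :
    y ^ (-r) ≤ x ^ (-r) := by
  rw [ENNReal.rpow_neg, ENNReal.rpow_neg, ENNReal.inv_le_inv]
  exact ENNReal.rpow_le_rpow hxy hr

/-- The one-dimensional Borell–Brascamp–Lieb inequality. -/
lemma bbl_real {e : ℝ} (he : 0 ≤ e) {t : ℝ} (ht : t ∈ Ioo (0 : ℝ) 1)
    {g W h : ℝ → ℝ≥0∞} (hg : Measurable g) (hW : Measurable W) (hh : Measurable h)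
    (H : ∀ x y, h ((1 - t) * x + t * y) ≤ ENNReal.ofReal (1 - t) * g x + ENNReal.ofReal t * W y)
    {L : ℝ≥0∞} (hgL : L ≤ ∫⁻ x, g x ^ (-(1 + e))) (hWL : L ≤ ∫⁻ x, W x ^ (-(1 + e))) :
    L ≤ ∫⁻ x, h x ^ (-(1 + e)) := by
  have he1 : 0 < 1 + e := by linarith
  -- truncate `g` and `W` from below at level `1 / k`
  have trunc : ∀ f : ℝ → ℝ≥0∞, Measurable f →
      Monotone (fun k : ℕ => fun x => (max (f x) (k : ℝ≥0∞)⁻¹) ^ (-(1 + e))) ∧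
      ⨆ k : ℕ, ∫⁻ x, (max (f x) (k : ℝ≥0∞)⁻¹) ^ (-(1 + e)) = ∫⁻ x, f x ^ (-(1 + e)) := by
    intro f hf
    have hmono : Monotone (fun k : ℕ => fun x => (max (f x) (k : ℝ≥0∞)⁻¹) ^ (-(1 + e))) := by
      intro k l hkl x
      exact ennreal_rpow_neg_anti he1.le (max_le_max le_rfl (ENNReal.inv_le_inv.2 (by gcongr)))
    refine ⟨hmono, ?_⟩
    rw [← lintegral_iSup (fun k => (hf.max measurable_const).pow_const _) hmono]
    congr with x
    have hlim : Tendsto (fun k : ℕ => (max (f x) (k : ℝ≥0∞)⁻¹) ^ (-(1 + e))) atTop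
        (nhds (f x ^ (-(1 + e)))) := by
      have : Tendsto (fun k : ℕ => max (f x) (k : ℝ≥0∞)⁻¹) atTop (nhds (max (f x) 0)) :=
        tendsto_const_nhds.max ENNReal.tendsto_inv_nat_nhds_zero
      rw [max_eq_left (zero_le)] at this
      exact (ENNReal.continuous_rpow_const.tendsto _).comp this
    exact tendsto_nhds_unique (tendsto_atTop_iSup fun k l hkl => hmono hkl x) hlim
  refine le_of_forall_lt fun l hl => ?_
  obtain ⟨l', hll', hl'L⟩ := exists_between hl
  obtain ⟨i, hi⟩ := lt_iSup_iff.1 ((hl'L.trans_le hgL).trans_eq (trunc g hg).2.symm)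
  obtain ⟨j, hj⟩ := lt_iSup_iff.1 ((hl'L.trans_le hWL).trans_eq (trunc W hW).2.symm)
  set k := max i j
  refine hll'.trans_le (bbl_real_of_pos he ht (hg.max measurable_const) (hW.max measurable_const) hh
    (g := fun x => max (g x) (k : ℝ≥0∞)⁻¹) (W := fun x => max (W x) (k : ℝ≥0∞)⁻¹)
    (d := (k : ℝ≥0∞)⁻¹) (fun x y => (H x y).trans ?_) (by simp) (fun x => le_max_right _ _)
    (fun x => le_max_right _ _) (hi.le.trans ?_) (hj.le.trans ?_))
  · gcongr <;> exact le_max_left _ _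
  · exact lintegral_mono ((trunc g hg).1 (le_max_left i j))
  · exact lintegral_mono ((trunc W hW).1 (le_max_right i j))

lemma lintegral_comp_smul_pi {n : ℕ} {A : ℝ} (hA : 0 < A) (f : (Fin n → ℝ) → ℝ≥0∞)
    (hf : Measurable f) :
    ∫⁻ x, f (A • x) = ENNReal.ofReal (A ^ n)⁻¹ * ∫⁻ x, f x := by
  have h1 := Measure.map_addHaar_smul (volume : Measure (Fin n → ℝ)) hA.ne'
  have h2 : ∫⁻ x, f (A • x) = ∫⁻ x, f x ∂(Measure.map (fun x => A • x) volume) := by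
    rw [lintegral_map hf (measurable_const_smul A)]
  rw [h2, h1, lintegral_smul_measure]
  simp [abs_of_pos hA]

/-- The statement of the Borell–Brascamp–Lieb inequality in dimension `n`. -/
def BBL (n : ℕ) : Prop :=
  ∀ e : ℝ, 0 ≤ e → ∀ t ∈ Ioo (0 : ℝ) 1, ∀ g W h : (Fin n → ℝ) → ℝ≥0∞,
    Measurable g → Measurable W → Measurable h →
    (∀ x y, h ((1 - t) • x + t • y) ≤ ENNReal.ofReal (1 - t) * g x + ENNReal.ofReal t * W y) →
    ∀ L : ℝ≥0∞, L ≤ ∫⁻ x, g x ^ (-(n + e)) → L ≤ ∫⁻ x, W x ^ (-(n + e)) →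
    L ≤ ∫⁻ x, h x ^ (-(n + e))

/-- The inequality scales: from equal integrals one passes to different ones by dilating `g`
and `W` by different factors, which changes the parameter `t`. -/
lemma BBL.scaled {n : ℕ} (hn : BBL n) {e : ℝ} (he : 0 < e) {t : ℝ} (ht : t ∈ Ioo (0 : ℝ) 1)
    {g W h : (Fin n → ℝ) → ℝ≥0∞} (hg : Measurable g) (hW : Measurable W) (hh : Measurable h)
    (H : ∀ x y, h ((1 - t) • x + t • y) ≤ ENNReal.ofReal (1 - t) * g x + ENNReal.ofReal t * W y)
    {A B : ℝ} (hA : 0 < A) (hB : 0 < B)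
    (hgA : ENNReal.ofReal A ^ (-e) ≤ ∫⁻ x, g x ^ (-(n + e)))
    (hWB : ENNReal.ofReal B ^ (-e) ≤ ∫⁻ x, W x ^ (-(n + e))) :
    ENNReal.ofReal ((1 - t) * A + t * B) ^ (-e) ≤ ∫⁻ x, h x ^ (-(n + e)) := by
  obtain ⟨ht0, ht1⟩ := id ht
  have hne : 0 < (n : ℝ) + e := by positivity
  set C := (1 - t) * A + t * B with hC
  have hC0 : 0 < C := by
    have := mul_pos (sub_pos.2 ht1) hA
    positivity
  -- the integral of the dilated function `x ↦ f (c x) / c`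
  have scale : ∀ (f : (Fin n → ℝ) → ℝ≥0∞) (c : ℝ), Measurable f → 0 < c →
      ∫⁻ x, ((ENNReal.ofReal c)⁻¹ * f (c • x)) ^ (-(n + e)) =
        ENNReal.ofReal c ^ e * ∫⁻ x, f x ^ (-(n + e)) := by
    intro f c hf hc
    have hcne : ENNReal.ofReal c ≠ 0 := by simpa using hc
    have h1 : ∀ x, ((ENNReal.ofReal c)⁻¹ * f (c • x)) ^ (-(n + e)) =
        ENNReal.ofReal c ^ ((n : ℝ) + e) * f (c • x) ^ (-(n + e)) := by
      intro x
      rw [ENNReal.rpow_neg, ENNReal.mul_rpow_of_nonneg _ _ hne.le, ENNReal.mul_inv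
        (Or.inl (by simp [hc])) (Or.inl (by simp [hc])), ENNReal.inv_rpow, inv_inv,
        ENNReal.rpow_neg]
    simp only [h1]
    rw [lintegral_const_mul' _ _ (by simp [hne.le]),
      lintegral_comp_smul_pi hc (fun x => f x ^ (-(n + e))) (hf.pow_const _), ← mul_assoc,
      ENNReal.rpow_add _ _ hcne ENNReal.ofReal_ne_top, ENNReal.ofReal_inv_of_pos (by positivity),
      ENNReal.ofReal_pow hc.le, ENNReal.rpow_natCast, mul_right_comm (_ ^ n),
      ENNReal.mul_inv_cancel (by simp [hc]) (by simp), one_mul]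
  have back : ∀ (c : ℝ) (I : ℝ≥0∞), 0 < c →
      (1 ≤ ENNReal.ofReal c ^ e * I ↔ ENNReal.ofReal c ^ (-e) ≤ I) := by
    intro c I hc
    rw [ENNReal.rpow_neg, ENNReal.inv_le_iff_le_mul (by simp [hc]) (by simp [hc])]
  have key := hn e he.le (t * B / C) ⟨by positivity, (div_lt_one hC0).2 (by
    have := mul_pos (sub_pos.2 ht1) hA; linarith)⟩
    (fun x => (ENNReal.ofReal A)⁻¹ * g (A • x)) (fun x => (ENNReal.ofReal B)⁻¹ * W (B • x))
    (fun x => (ENNReal.ofReal C)⁻¹ * h (C • x)) (by fun_prop) (by fun_prop) (by fun_prop) ?_ 1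
    (by rw [scale g A hg hA]; exact (back _ _ hA).2 hgA)
    (by rw [scale W B hW hB]; exact (back _ _ hB).2 hWB)
  · rw [scale h C hh hC0] at key
    exact (back _ _ hC0).1 key
  · intro x y
    have e1 : 1 - t * B / C = (1 - t) * A / C := by
      rw [eq_div_iff hC0.ne', sub_mul, div_mul_cancel₀ _ hC0.ne', hC]; ring
    have e2 : C • ((1 - t * B / C) • x + (t * B / C) • y) = (1 - t) • (A • x) + t • (B • y) := by
      rw [e1, smul_add, smul_smul, smul_smul, mul_div_cancel₀ _ hC0.ne', mul_div_cancel₀ _ hC0.ne',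
        smul_smul, smul_smul]
    rw [e2]
    calc (ENNReal.ofReal C)⁻¹ * h ((1 - t) • (A • x) + t • (B • y))
        ≤ (ENNReal.ofReal C)⁻¹ * (ENNReal.ofReal (1 - t) * g (A • x) +
          ENNReal.ofReal t * W (B • y)) := by gcongr; exact H _ _
      _ = _ := by
        have hA' : ENNReal.ofReal A ≠ 0 := by simpa using hA
        have hB' : ENNReal.ofReal B ≠ 0 := by simpa using hB
        rw [e1, ENNReal.ofReal_div_of_pos hC0, ENNReal.ofReal_div_of_pos hC0,
          ENNReal.ofReal_mul (by linarith), ENNReal.ofReal_mul ht0.le, mul_add]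
        congr 1
        · calc _ = (ENNReal.ofReal C)⁻¹ * (ENNReal.ofReal (1 - t)) * g (A • x) := by ring
            _ = (ENNReal.ofReal C)⁻¹ * (ENNReal.ofReal (1 - t)) *
                (ENNReal.ofReal A * (ENNReal.ofReal A)⁻¹) * g (A • x) := by
              rw [ENNReal.mul_inv_cancel hA' ENNReal.ofReal_ne_top, mul_one]
            _ = _ := by rw [div_eq_mul_inv]; ring
        · calc _ = (ENNReal.ofReal C)⁻¹ * (ENNReal.ofReal t) * W (B • y) := by ring
            _ = (ENNReal.ofReal C)⁻¹ * (ENNReal.ofReal t) *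
                (ENNReal.ofReal B * (ENNReal.ofReal B)⁻¹) * W (B • y) := by
              rw [ENNReal.mul_inv_cancel hB' ENNReal.ofReal_ne_top, mul_one]
            _ = _ := by rw [div_eq_mul_inv]; ring

lemma BBL.zero : BBL 0 := by
  intro e he t ht g W h hg hW hh H L hgL hWL
  rw [lintegral_unique] at hgL hWL ⊢
  simp only [Nat.cast_zero, zero_add, volume_pi, Measure.pi_univ, Finset.univ_eq_empty,
    Finset.prod_empty, mul_one] at hgL hWL ⊢
  have h1 : ∀ z, h z ≤ max (g z) (W z) := by
    intro z
    have := H z z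
    rw [← add_smul, sub_add_cancel, one_smul] at this
    calc h z ≤ _ := this
      _ ≤ ENNReal.ofReal (1 - t) * max (g z) (W z) + ENNReal.ofReal t * max (g z) (W z) := by
            gcongr
            · exact le_max_left _ _
            · exact le_max_right _ _
      _ = _ := by
        rw [← add_mul, ← ENNReal.ofReal_add (by linarith [ht.2]) ht.1.le]; simp
  refine le_trans ?_ (ennreal_rpow_neg_anti he (h1 _))
  rcases le_total (g Unique.instInhabited.default) (W Unique.instInhabited.default) with h2 | h2
  · rwa [max_eq_right h2]
  · rwa [max_eq_left h2]

lemma BBL.succ {n : ℕ} (hn : BBL n) : BBL (n + 1) := by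
  intro e he t ht g W h hg hW hh H L hgL hWL
  obtain ⟨ht0, ht1⟩ := id ht
  have he1 : 0 < 1 + e := by linarith
  have hmp := volume_preserving_piFinSuccAbove (fun _ : Fin (n + 1) => ℝ) 0
  set Φ := (MeasurableEquiv.piFinSuccAbove (fun _ : Fin (n + 1) => ℝ) 0).symm with hΦ
  have hexp : -(((n + 1 : ℕ) : ℝ) + e) = -((n : ℝ) + (1 + e)) := by push_cast; ring
  rw [hexp] at hgL hWL ⊢
  -- integrating out the last `n` variables
  set m : ((Fin (n + 1) → ℝ) → ℝ≥0∞) → ℝ → ℝ≥0∞ := fun f s =>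
    ∫⁻ x : Fin n → ℝ, f (Φ (s, x)) ^ (-((n : ℝ) + (1 + e))) with hm
  have hmeas : ∀ f, Measurable f → Measurable (m f) := fun f hf =>
    Measurable.lintegral_prod_right' (f := fun p : ℝ × (Fin n → ℝ) =>
      f (Φ p) ^ (-((n : ℝ) + (1 + e)))) ((hf.comp Φ.measurable).pow_const _)
  have fubini : ∀ f, Measurable f → ∫⁻ x, f x ^ (-((n : ℝ) + (1 + e))) =
      ∫⁻ s, (m f s ^ (-(1 + e)⁻¹)) ^ (-(1 + e)) := by
    intro f hf
    have h1 : ∀ s, (m f s ^ (-(1 + e)⁻¹)) ^ (-(1 + e)) = m f s := fun s => by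
      rw [← ENNReal.rpow_mul, neg_mul_neg, inv_mul_cancel₀ he1.ne', ENNReal.rpow_one]
    simp only [h1]
    have h2 : MeasurePreserving Φ (volume.prod volume) volume := MeasurePreserving.symm _ hmp
    rw [← h2.lintegral_comp (hf.pow_const _)]
    exact lintegral_prod (fun p => f (Φ p) ^ (-((n : ℝ) + (1 + e))))
      ((hf.comp h2.measurable).pow_const _).aemeasurable
  rw [fubini g hg] at hgL
  rw [fubini W hW] at hWL
  rw [fubini h hh]
  refine bbl_real he ht ((hmeas g hg).pow_const _) ((hmeas W hW).pow_const _)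
    ((hmeas h hh).pow_const _) ?_ hgL hWL
  intro x y
  have slice : ∀ f : (Fin (n + 1) → ℝ) → ℝ≥0∞, Measurable f → ∀ s,
      Measurable fun z => f (Φ (s, z)) := fun f hf s =>
    hf.comp (Φ.measurable.comp measurable_prodMk_left)
  have hΦlin : ∀ a b, Φ ((1 - t) * x + t * y, (1 - t) • a + t • b) =
      (1 - t) • Φ (x, a) + t • Φ (y, b) := by
    intro a b
    ext i
    refine Fin.cases ?_ (fun j => ?_) i <;>
      simp [hΦ, MeasurableEquiv.piFinSuccAbove, Fin.insertNthEquiv]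
  -- bounds above the two terms by arbitrary larger reals
  have bound : ∀ A B : ℝ, 0 < A → 0 < B → m g x ^ (-(1 + e)⁻¹) ≤ ENNReal.ofReal A →
      m W y ^ (-(1 + e)⁻¹) ≤ ENNReal.ofReal B →
      m h ((1 - t) * x + t * y) ^ (-(1 + e)⁻¹) ≤
        ENNReal.ofReal (1 - t) * ENNReal.ofReal A + ENNReal.ofReal t * ENNReal.ofReal B := by
    intro A B hA hB h1 h2
    have conv : ∀ (I : ℝ≥0∞) (c : ℝ), I ^ (-(1 + e)⁻¹) ≤ ENNReal.ofReal c ↔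
        ENNReal.ofReal c ^ (-(1 + e)) ≤ I := by
      intro I c
      rw [ENNReal.rpow_neg, ENNReal.rpow_neg, ENNReal.inv_le_iff_inv_le, ENNReal.le_rpow_inv_iff he1,
        ENNReal.inv_rpow]
    have := hn.scaled he1 ht (slice g hg x) (slice W hW y) (slice h hh ((1 - t) * x + t * y))
      (fun a b => by rw [hΦlin]; exact H _ _) hA hB ((conv _ _).1 h1) ((conv _ _).1 h2)
    rw [← ENNReal.ofReal_mul (by linarith), ← ENNReal.ofReal_mul ht0.le, ← ENNReal.ofReal_add
      (mul_nonneg (by linarith) hA.le) (by positivity)]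
    exact (conv _ _).2 this
  by_cases hgt : m g x ^ (-(1 + e)⁻¹) = ⊤
  · rw [hgt, ENNReal.mul_top (by simpa using ht1)]; simp
  by_cases hWt : m W y ^ (-(1 + e)⁻¹) = ⊤
  · rw [hWt, ENNReal.mul_top (by simpa using ht0)]; simp
  have lim : Tendsto (fun d : ℝ => ENNReal.ofReal (1 - t) *
      ENNReal.ofReal ((m g x ^ (-(1 + e)⁻¹)).toReal + d) + ENNReal.ofReal t *
      ENNReal.ofReal ((m W y ^ (-(1 + e)⁻¹)).toReal + d)) (nhdsWithin 0 (Ioi 0))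
      (nhds (ENNReal.ofReal (1 - t) * ENNReal.ofReal ((m g x ^ (-(1 + e)⁻¹)).toReal + 0) +
        ENNReal.ofReal t * ENNReal.ofReal ((m W y ^ (-(1 + e)⁻¹)).toReal + 0))) := by
    apply tendsto_nhdsWithin_of_tendsto_nhds
    refine Tendsto.add (ENNReal.Tendsto.const_mul ?_ (Or.inr ENNReal.ofReal_ne_top))
      (ENNReal.Tendsto.const_mul ?_ (Or.inr ENNReal.ofReal_ne_top)) <;>
    exact ENNReal.tendsto_ofReal (tendsto_const_nhds.add tendsto_id)
  rw [add_zero, add_zero, ENNReal.ofReal_toReal hgt, ENNReal.ofReal_toReal hWt] at lim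
  refine ge_of_tendsto lim ?_
  filter_upwards [self_mem_nhdsWithin] with d hd
  have hd' : 0 < d := hd
  refine bound _ _ (add_pos_of_nonneg_of_pos ENNReal.toReal_nonneg hd')
    (add_pos_of_nonneg_of_pos ENNReal.toReal_nonneg hd') ?_ ?_
  · rw [← ENNReal.ofReal_toReal hgt]; exact ENNReal.ofReal_le_ofReal (by simpa using hd'.le)
  · rw [← ENNReal.ofReal_toReal hWt]; exact ENNReal.ofReal_le_ofReal (by simpa using hd'.le)

/-- The Borell–Brascamp–Lieb inequality holds in every dimension: integrate out one variable at a
time. -/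
theorem bbl (n : ℕ) : BBL n := by
  induction n with
  | zero => exact BBL.zero
  | succ n ih => exact ih.succ

lemma lintegral_Ioi_add_rpow {c r : ℝ} (hc : 0 < c) (hr : 1 < r) :
    ∫⁻ s in Ioi (0 : ℝ), ENNReal.ofReal ((c + s) ^ (-r)) =
      ENNReal.ofReal (c ^ (1 - r) / (r - 1)) := by
  have hmp := measurePreserving_add_left (volume : Measure ℝ) c
  have h1 : ∫⁻ s in Ioi (0 : ℝ), ENNReal.ofReal ((c + s) ^ (-r)) =
      ∫⁻ s in Ioi c, ENNReal.ofReal (s ^ (-r)) := by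
    simpa using hmp.setLIntegral_comp_preimage_emb (measurableEmbedding_addLeft c)
      (fun s => ENNReal.ofReal (s ^ (-r))) (Ioi c)
  rw [h1, ← ofReal_integral_eq_lintegral_ofReal (integrableOn_Ioi_rpow_of_lt (by linarith) hc),
    integral_Ioi_rpow_of_lt (by linarith) hc]
  · congr 1
    rw [show -r + 1 = -(r - 1) by ring, neg_div_neg_eq, show 1 - r = -(r - 1) by ring]
  · filter_upwards [ae_restrict_mem measurableSet_Ioi] with s hs
    exact Real.rpow_nonneg (hc.le.trans (le_of_lt hs)) _

/-- The Borell–Brascamp–Lieb inequality for positive functions on `ℝ^n`. -/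
lemma bbl_eucl {n : ℕ} {t : ℝ} (ht : t ∈ Ioo (0 : ℝ) 1) {g W h : Eucl n → ℝ}
    (hg : Measurable g) (hW : Measurable W) (hh : Measurable h) (hg0 : ∀ x, 0 < g x)
    (hW0 : ∀ x, 0 < W x) (hh0 : ∀ x, 0 < h x)
    (H : ∀ x y, h ((1 - t) • x + t • y) ≤ (1 - t) * g x + t * W y) {L : ℝ≥0∞}
    (hgL : L ≤ ∫⁻ x, ENNReal.ofReal (g x ^ (-(n : ℝ))))
    (hWL : L ≤ ∫⁻ x, ENNReal.ofReal (W x ^ (-(n : ℝ)))) :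
    L ≤ ∫⁻ x, ENNReal.ofReal (h x ^ (-(n : ℝ))) := by
  have hmp := PiLp.volume_preserving_toLp (Fin n)
  have conv : ∀ f : Eucl n → ℝ, Measurable f → (∀ x, 0 < f x) →
      ∫⁻ x, ENNReal.ofReal (f x ^ (-(n : ℝ))) =
      ∫⁻ x : Fin n → ℝ, ENNReal.ofReal (f (WithLp.toLp 2 x)) ^ (-((n : ℝ) + 0)) := by
    intro f hf hf0
    rw [← hmp.lintegral_comp ((hf.pow_const _).ennreal_ofReal)]
    simp only [add_zero, ENNReal.ofReal_rpow_of_pos (hf0 _)]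
  rw [conv g hg hg0] at hgL
  rw [conv W hW hW0] at hWL
  rw [conv h hh hh0]
  refine bbl n 0 le_rfl t ht _ _ _ (hg.comp hmp.measurable).ennreal_ofReal
    (hW.comp hmp.measurable).ennreal_ofReal (hh.comp hmp.measurable).ennreal_ofReal ?_ L hgL hWL
  intro x y
  simp only [Function.comp_apply]
  rw [← ENNReal.ofReal_mul (by linarith [ht.2]), ← ENNReal.ofReal_mul ht.1.le,
    ← ENNReal.ofReal_add (mul_nonneg (by linarith [ht.2]) (hg0 _).le)
      (mul_nonneg ht.1.le (hW0 _).le)]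
  exact ENNReal.ofReal_le_ofReal (H _ _)

/-- A strengthened Borell–Brascamp–Lieb inequality. The usual inequality for the functions
`g + s` on the hyperplanes of the half-space `s > 0` bounds the marginals in `s`; as the
marginals of `g` and `W` have the same supremum, attained at `s = 0`, the one-dimensional
inequality in `s` applies. -/
lemma bbl_improved {n : ℕ} (hn : 2 ≤ n) {t : ℝ} (ht : t ∈ Ioo (0 : ℝ) 1) {g W h : Eucl n → ℝ}
    (hg : Measurable g) (hW : Measurable W) (hh : Measurable h) (hg0 : ∀ x, 0 < g x)
    (hW0 : ∀ x, 0 < W x) (hh0 : ∀ x, 0 < h x)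
    (H : ∀ x y, h ((1 - t) • x + t • y) ≤ (1 - t) * g x + t * W y) {M : ℝ≥0∞} (hM : M ≠ ⊤)
    (hgM : ∫⁻ x, ENNReal.ofReal (g x ^ (-(n : ℝ))) = M)
    (hWM : ∫⁻ x, ENNReal.ofReal (W x ^ (-(n : ℝ))) = M) :
    ENNReal.ofReal (1 - t) * (∫⁻ x, ENNReal.ofReal (g x ^ (1 - (n : ℝ)))) +
      ENNReal.ofReal t * (∫⁻ x, ENNReal.ofReal (W x ^ (1 - (n : ℝ)))) ≤
      ∫⁻ x, ENNReal.ofReal (h x ^ (1 - (n : ℝ))) := by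
  obtain ⟨ht0, ht1⟩ := id ht
  have hn1 : (1 : ℝ) < n := by exact_mod_cast hn
  set I : (Eucl n → ℝ) → ℝ → ℝ≥0∞ := fun f s =>
    ∫⁻ x, ENNReal.ofReal ((f x + s) ^ (-(n : ℝ))) with hI
  have hImeas : ∀ f, Measurable f → Measurable (I f) := fun f hf =>
    Measurable.lintegral_prod_right' (f := fun p : ℝ × Eucl n =>
      ENNReal.ofReal ((f p.2 + p.1) ^ (-(n : ℝ)))) (by fun_prop)
  have hanti : ∀ f : Eucl n → ℝ, (∀ x, 0 < f x) → ∀ s r, 0 ≤ s → s ≤ r → I f r ≤ I f s := by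
    intro f hf0 s r hs hsr
    refine lintegral_mono fun x => ENNReal.ofReal_le_ofReal ?_
    exact Real.rpow_le_rpow_of_nonpos (add_pos_of_pos_of_nonneg (hf0 x) hs) (by linarith)
      (by linarith)
  have hzero : ∀ f : Eucl n → ℝ, I f 0 = ∫⁻ x, ENNReal.ofReal (f x ^ (-(n : ℝ))) := by
    intro f; simp [hI]
  -- the marginal, extended by zero to `s ≤ 0`
  set m : (Eucl n → ℝ) → ℝ → ℝ := fun f s => (Ioi (0 : ℝ)).indicator
    (fun s => (min M (I f s)).toReal) s with hm
  have hm_of : ∀ f s, 0 < s → m f s = (min M (I f s)).toReal := fun f s hs =>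
    indicator_of_mem (by exact hs) _
  have hmtop : ∀ f s, min M (I f s) ≠ ⊤ := fun f s => ne_top_of_le_ne_top hM (min_le_left _ _)
  have hmmeas : ∀ f, Measurable f → Measurable (m f) := fun f hf =>
    (measurable_const.min (hImeas f hf)).ennreal_toReal.indicator measurableSet_Ioi
  have hm0 : ∀ f s, 0 ≤ m f s := fun f s => indicator_nonneg (fun _ _ => ENNReal.toReal_nonneg) s
  have hmM : ∀ f s, m f s ≤ M.toReal := fun f s =>
    indicator_le' (fun s _ => ENNReal.toReal_mono hM (min_le_left _ _))
      (fun _ _ => ENNReal.toReal_nonneg) s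
  have hsup : ∀ f : Eucl n → ℝ, Measurable f → (∀ x, 0 < f x) →
      ∫⁻ x, ENNReal.ofReal (f x ^ (-(n : ℝ))) = M → ∀ l, 0 < l → l < M.toReal →
      ∃ s, l < m f s := by
    intro f hf hf0 hfM l hl hlM
    have hlim : Tendsto (fun k : ℕ => I f (1 / ((k : ℝ) + 1))) atTop (nhds M) := by
      rw [← hfM]
      refine lintegral_tendsto_of_tendsto_of_monotone (fun k => by fun_prop)
        (Eventually.of_forall fun x k j hkj => ?_) (Eventually.of_forall fun x => ?_)
      · refine ENNReal.ofReal_le_ofReal (Real.rpow_le_rpow_of_nonpos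
          (add_pos (hf0 x) (by positivity)) ?_ (by linarith))
        gcongr
      · refine ENNReal.tendsto_ofReal ?_
        have h1 : Tendsto (fun k : ℕ => f x + 1 / ((k : ℝ) + 1)) atTop (nhds (f x + 0)) :=
          tendsto_const_nhds.add tendsto_one_div_add_atTop_nhds_zero_nat
        rw [add_zero] at h1
        exact h1.rpow_const (Or.inl (hf0 x).ne')
    have h2 : ENNReal.ofReal l < M := (ENNReal.ofReal_lt_iff_lt_toReal hl.le hM).2 hlM
    obtain ⟨k, hk⟩ := (hlim.eventually (lt_mem_nhds h2)).exists
    refine ⟨1 / ((k : ℝ) + 1), ?_⟩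
    rw [hm_of _ _ (by positivity), ← ENNReal.ofReal_lt_iff_lt_toReal hl.le (hmtop _ _)]
    exact lt_min h2 hk
  have key := lintegral_combo_le_of_sup_eq (hmmeas g hg) (hmmeas W hW) (hmmeas h hh) (hm0 g) (hm0 W)
    (hm0 h) (hmM g) (hmM W) (hsup g hg hg0 hgM) (hsup W hW hW0 hWM) ht ?_
  · -- Fubini computes the integrals of the marginals
    have fub : ∀ f : Eucl n → ℝ, Measurable f → (∀ x, 0 < f x) → ∫⁻ s in Ioi (0 : ℝ), I f s =
        ENNReal.ofReal ((n : ℝ) - 1)⁻¹ * ∫⁻ x, ENNReal.ofReal (f x ^ (1 - (n : ℝ))) := by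
      intro f hf hf0
      rw [lintegral_lintegral_swap (by fun_prop), ← lintegral_const_mul _ (by fun_prop)]
      congr with x
      rw [lintegral_Ioi_add_rpow (hf0 x) hn1, div_eq_inv_mul,
        ENNReal.ofReal_mul (inv_nonneg.2 (by linarith))]
    have eqm : ∀ f : Eucl n → ℝ, Measurable f → (∀ x, 0 < f x) →
        ∫⁻ x, ENNReal.ofReal (f x ^ (-(n : ℝ))) = M → ∫⁻ s, ENNReal.ofReal (m f s) =
        ENNReal.ofReal ((n : ℝ) - 1)⁻¹ * ∫⁻ x, ENNReal.ofReal (f x ^ (1 - (n : ℝ))) := by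
      intro f hf hf0 hfM
      rw [← fub f hf hf0, ← lintegral_indicator measurableSet_Ioi]
      congr with s
      by_cases hs : 0 < s
      · rw [hm_of f s hs, ENNReal.ofReal_toReal (hmtop f s), indicator_of_mem (by exact hs),
          min_eq_right]
        rw [← hfM, ← hzero f]
        exact hanti f hf0 0 s le_rfl hs.le
      · simp [hm, hs]
    have lem : ∫⁻ s, ENNReal.ofReal (m h s) ≤
        ENNReal.ofReal ((n : ℝ) - 1)⁻¹ * ∫⁻ x, ENNReal.ofReal (h x ^ (1 - (n : ℝ))) := by
      rw [← fub h hh hh0, ← lintegral_indicator measurableSet_Ioi]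
      refine lintegral_mono fun s => ?_
      by_cases hs : 0 < s
      · simp only
        rw [hm_of h s hs, ENNReal.ofReal_toReal (hmtop h s), indicator_of_mem (by exact hs)]
        exact min_le_right _ _
      · simp [hm, hs]
    rw [eqm g hg hg0 hgM, eqm W hW hW0 hWM] at key
    have hc : ENNReal.ofReal ((n : ℝ) - 1)⁻¹ ≠ 0 := by simpa using hn1
    refine (ENNReal.mul_le_mul_iff_right hc ENNReal.ofReal_ne_top).1 (le_trans (le_of_eq ?_)
      (key.trans lem))
    ring
  · intro x y l hl hlx hly
    have pos_of : ∀ f s, l < m f s → 0 < s := by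
      intro f s h1
      by_contra h2
      simp only [hm, indicator, mem_Ioi, h2, if_false] at h1
      linarith
    have hx := pos_of g x hlx
    have hy := pos_of W y hly
    have hz : 0 < (1 - t) * x + t * y := by
      have := mul_pos (sub_pos.2 ht1) hx
      positivity
    rw [hm_of _ _ hx, ← ENNReal.ofReal_lt_iff_lt_toReal hl.le (hmtop _ _)] at hlx
    rw [hm_of _ _ hy, ← ENNReal.ofReal_lt_iff_lt_toReal hl.le (hmtop _ _)] at hly
    rw [hm_of _ _ hz, ← ENNReal.ofReal_lt_iff_lt_toReal hl.le (hmtop _ _)]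
    obtain ⟨h1, h2⟩ := lt_min_iff.1 hlx
    obtain ⟨-, h3⟩ := lt_min_iff.1 hly
    refine lt_min h1 ((lt_min h2 h3).trans_le (bbl_eucl ht (g := fun z => g z + x)
      (W := fun z => W z + y) (h := fun z => h z + ((1 - t) * x + t * y)) (by fun_prop)
      (by fun_prop) (by fun_prop) (fun z => add_pos (hg0 z) hx) (fun z => add_pos (hW0 z) hy)
      (fun z => add_pos (hh0 z) hz) (fun a b => ?_) (min_le_left _ _) (min_le_right _ _)))
    have := H a b
    linarith

/-! ### The sharp Sobolev inequality -/

lemma integrable_bracket_rpow {n : ℕ} {r : ℝ} (hr : (n : ℝ) < 2 * r) :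
    Integrable (fun x : Eucl n => (1 + ‖x‖ ^ 2) ^ (-r)) := by
  have := integrable_rpow_neg_one_add_norm_sq (E := Eucl n) (μ := volume) (r := 2 * r) (by simpa)
  rwa [show -(2 * r) / 2 = -r by ring] at this

lemma hasGradientAt_norm_sq {n : ℕ} (x : Eucl n) :
    HasGradientAt (fun y : Eucl n => ‖y‖ ^ 2) ((2 : ℝ) • x) x := by
  rw [hasGradientAt_iff_hasFDerivAt]
  refine (hasStrictFDerivAt_norm_sq x).hasFDerivAt.congr_fderiv ?_
  ext y
  simp

/-- A function of compact support with continuous second derivatives lies above its tangents up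
to a quadratic error. -/
lemma exists_taylor_lower_bound {n : ℕ} {ψ : Eucl n → ℝ} (hψ : ContDiff ℝ ∞ ψ)
    (hc : HasCompactSupport ψ) :
    ∃ L : ℝ, 0 < L ∧ ∀ z v, ψ z + inner ℝ (∇ ψ z) v - L * ‖v‖ ^ 2 ≤ ψ (z + v) := by
  obtain ⟨L, hL⟩ := ContDiff.lipschitzWith_of_hasCompactSupport (𝕂 := ℝ) (n := ∞) (hc.fderiv ℝ)
    (hψ.fderiv_right (by simp)) (by simp)
  refine ⟨L + 1, by positivity, fun z v => ?_⟩
  have h1 : ‖ψ (z + v) - ψ z - fderiv ℝ ψ z (z + v - z)‖ ≤ (L * ‖v‖) * ‖z + v - z‖ := by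
    refine Convex.norm_image_sub_le_of_norm_fderiv_le' (s := Metric.closedBall z ‖v‖)
      (fun y _ => (hψ.differentiable (by simp)) y) (fun y hy => ?_) (convex_closedBall z _)
      (by simp) (by simp)
    have := hL.dist_le_mul y z
    rw [dist_eq_norm] at this
    refine this.trans ?_
    gcongr
    simpa using hy
  have h2 : inner ℝ (∇ ψ z) v = fderiv ℝ ψ z v := by
    simp [gradient]
  rw [h2]
  simp only [add_sub_cancel_left, Real.norm_eq_abs] at h1
  have h3 := (abs_le.1 h1).1
  nlinarith [sq_nonneg ‖v‖]

lemma exists_norm_gradient_le {n : ℕ} {ψ : Eucl n → ℝ} (hψ : ContDiff ℝ ∞ ψ)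
    (hc : HasCompactSupport ψ) : ∃ C : ℝ, 0 < C ∧ ∀ z, ‖∇ ψ z‖ ≤ C := by
  obtain ⟨C, hC⟩ := ContDiff.lipschitzWith_of_hasCompactSupport (𝕂 := ℝ) (n := ∞) hc hψ (by simp)
  refine ⟨C + 1, by positivity, fun z => ?_⟩
  have : ‖∇ ψ z‖ = ‖fderiv ℝ ψ z‖ := by simp [gradient]
  rw [this]
  have := norm_fderiv_le_of_lipschitz ℝ hC (x₀ := z)
  linarith

lemma continuous_gradient {n : ℕ} {ψ : Eucl n → ℝ} (hψ : ContDiff ℝ ∞ ψ) : Continuous (∇ ψ) := by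
  unfold gradient
  exact (LinearIsometryEquiv.continuous _).comp (hψ.continuous_fderiv (by simp))

lemma one_add_rpow_neg_le {m : ℕ} {s : ℝ} (hs : -(1 / 2) ≤ m * s) (hs1 : -(1 / 2) ≤ s) :
    (1 + s) ^ (-(m : ℝ)) ≤ 1 - m * s + 2 * (m * s) ^ 2 := by
  have h1 : 1 + m * s ≤ (1 + s) ^ m := one_add_mul_le_pow (by linarith) m
  have h2 : 0 < 1 + m * s := by linarith
  rw [Real.rpow_neg (by linarith), Real.rpow_natCast]
  calc ((1 + s) ^ m)⁻¹ ≤ (1 + m * s)⁻¹ := inv_anti₀ h2 h1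
    _ ≤ _ := by
      rw [inv_eq_one_div, div_le_iff₀ h2]
      nlinarith [sq_nonneg (m * s)]

set_option maxHeartbeats 1000000 in
/-- The gradient inequality obtained by differentiating the strengthened Borell–Brascamp–Lieb
inequality at `t = 0`, for `g` equal to a multiple of `1 + |x|^2` near infinity. -/
lemma bbl_gradient {n : ℕ} (hn : 3 ≤ n) {c₀ κ : ℝ} (hc₀ : 0 < c₀) (hκ : 0 < κ) {ψ : Eucl n → ℝ}
    (hψ : ContDiff ℝ ∞ ψ) (hc : HasCompactSupport ψ) {g : Eucl n → ℝ}
    (hgdef : ∀ x, g x = κ * (1 + ‖x‖ ^ 2) + ψ x) (hg0 : ∀ x, 0 < g x)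
    (hM : ∫ x, g x ^ (-(n : ℝ)) = ∫ x : Eucl n, (c₀ * (1 + ‖x‖ ^ 2)) ^ (-(n : ℝ))) :
    (∫ x : Eucl n, (c₀ * (1 + ‖x‖ ^ 2)) ^ (1 - (n : ℝ))) +
      (n - 1) * c₀ * (∫ x : Eucl n, (c₀ * (1 + ‖x‖ ^ 2)) ^ (-(n : ℝ))) ≤
      (n - 1) / (4 * c₀) * ∫ x, g x ^ (-(n : ℝ)) * ‖∇ g x‖ ^ 2 := by
  have hn3 : (3 : ℝ) ≤ n := by exact_mod_cast hn
  set p : Eucl n → Eucl n := fun x => (2 * κ) • x + ∇ ψ x with hp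
  have hgrad : ∀ x, ∇ g x = p x := by
    intro x
    have h1 : HasGradientAt ψ (∇ ψ x) x := ((hψ.differentiable (by simp)) x).hasGradientAt
    have h2 := hasGradientAt_norm_sq x
    rw [hasGradientAt_iff_hasFDerivAt] at h1 h2
    have h3 : HasGradientAt g (p x) x := by
      rw [hasGradientAt_iff_hasFDerivAt, show g = fun x => κ * (1 + ‖x‖ ^ 2) + ψ x from funext hgdef]
      refine (((h2.const_add 1).const_mul κ).add h1).congr_fderiv ?_
      simp only [hp, map_add, map_smul, smul_smul, mul_comm κ]
    exact h3.gradient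
  have hgcont : Continuous g := by
    rw [show g = fun x => κ * (1 + ‖x‖ ^ 2) + ψ x from funext hgdef]
    have := hψ.continuous
    fun_prop
  have hpcont : Continuous p := by
    have := continuous_gradient hψ
    fun_prop
  have hbr : ∀ x : Eucl n, 0 < 1 + ‖x‖ ^ 2 := fun x => by positivity
  -- `g` is comparable to `1 + |x|^2`
  obtain ⟨c, hc0, hcg⟩ : ∃ c : ℝ, 0 < c ∧ ∀ x, c * (1 + ‖x‖ ^ 2) ≤ g x := by
    have hq : Continuous fun x => g x / (1 + ‖x‖ ^ 2) :=
      hgcont.div (by fun_prop) fun x => (hbr x).ne'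
    rcases (tsupport ψ).eq_empty_or_nonempty with h0 | h0
    · refine ⟨κ, hκ, fun x => ?_⟩
      rw [hgdef, show ψ x = 0 from image_eq_zero_of_notMem_tsupport (by simp [h0])]
      simp
    · obtain ⟨x0, -, hx0⟩ := IsCompact.exists_isMinOn (s := tsupport ψ) hc h0 hq.continuousOn
      refine ⟨min κ (g x0 / (1 + ‖x0‖ ^ 2)), lt_min hκ (div_pos (hg0 _) (hbr _)), fun x => ?_⟩
      by_cases hx : x ∈ tsupport ψ
      · rw [← le_div_iff₀ (hbr x)]
        exact (min_le_right _ _).trans (hx0 hx)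
      · rw [hgdef x, image_eq_zero_of_notMem_tsupport hx, add_zero]
        exact mul_le_mul_of_nonneg_right (min_le_left _ _) (hbr x).le
  obtain ⟨C₂, hC₂, hpg⟩ : ∃ C₂ : ℝ, 0 < C₂ ∧ ∀ x, ‖p x‖ ^ 2 ≤ C₂ * g x := by
    obtain ⟨C, hC, hCψ⟩ := exists_norm_gradient_le hψ hc
    refine ⟨(8 * κ ^ 2 + 2 * C ^ 2) / c, by positivity, fun x => ?_⟩
    have h1 : ‖p x‖ ≤ 2 * κ * ‖x‖ + C := by
      refine (norm_add_le _ _).trans (add_le_add ?_ (hCψ x))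
      rw [norm_smul, Real.norm_of_nonneg (by positivity)]
    have h2 : ‖p x‖ ^ 2 ≤ (8 * κ ^ 2 + 2 * C ^ 2) * (1 + ‖x‖ ^ 2) := by
      have : ‖p x‖ ^ 2 ≤ (2 * κ * ‖x‖ + C) ^ 2 := by gcongr
      nlinarith [sq_nonneg (2 * κ * ‖x‖ - C), sq_nonneg (C * ‖x‖), sq_nonneg κ]
    calc _ ≤ _ := h2
      _ = (8 * κ ^ 2 + 2 * C ^ 2) / c * (c * (1 + ‖x‖ ^ 2)) := by field_simp
      _ ≤ _ := by gcongr; exact hcg x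
  obtain ⟨L, hL, htay⟩ : ∃ L : ℝ, 0 < L ∧ ∀ z v, g z + inner ℝ (p z) v - L * ‖v‖ ^ 2 ≤ g (z + v) := by
    obtain ⟨L, hL, h⟩ := exists_taylor_lower_bound hψ hc
    refine ⟨L, hL, fun z v => ?_⟩
    have h1 := h z v
    rw [hgdef, hgdef, norm_add_sq_real, hp]
    simp only [inner_add_left, real_inner_smul_left]
    have : 0 ≤ κ * ‖v‖ ^ 2 := by positivity
    nlinarith
  -- integrability
  have hint : ∀ r : ℝ, (n : ℝ) < 2 * r → Integrable fun x => g x ^ (-r) := by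
    intro r hr
    refine ((integrable_bracket_rpow hr).const_mul (c ^ (-r))).mono'
      (hgcont.measurable.pow_const _).aestronglyMeasurable (Eventually.of_forall fun x => ?_)
    rw [Real.norm_of_nonneg (Real.rpow_nonneg (hg0 x).le _), ← Real.mul_rpow hc0.le (hbr x).le]
    refine Real.rpow_le_rpow_of_nonpos (mul_pos hc0 (hbr x)) (hcg x) ?_
    have : (0 : ℝ) ≤ n := by positivity
    linarith
  have hintW : ∀ r : ℝ, (n : ℝ) < 2 * r →
      Integrable fun x : Eucl n => (c₀ * (1 + ‖x‖ ^ 2)) ^ (-r) := by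
    intro r hr
    simp_rw [fun x : Eucl n => Real.mul_rpow (z := -r) hc₀.le (hbr x).le]
    exact (integrable_bracket_rpow hr).const_mul _
  have hI := hint (n - 1) (by linarith)
  have hJ := hintW (n - 1) (by linarith)
  have hN := hint n (by linarith)
  have hNW := hintW n (by linarith)
  rw [neg_sub] at hI hJ
  have hpint : Integrable fun x => g x ^ (-(n : ℝ)) * ‖p x‖ ^ 2 := by
    refine (hI.const_mul C₂).mono' ((hgcont.measurable.pow_const _).mul
      (hpcont.norm.pow 2).measurable).aestronglyMeasurable (Eventually.of_forall fun x => ?_)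
    rw [Real.norm_of_nonneg (mul_nonneg (Real.rpow_nonneg (hg0 x).le _) (sq_nonneg _)),
      show 1 - (n : ℝ) = -n + 1 by ring, Real.rpow_add (hg0 x), Real.rpow_one]
    have := mul_le_mul_of_nonneg_left (hpg x) (Real.rpow_nonneg (hg0 x).le (-(n : ℝ)))
    linarith
  set k : Eucl n → ℝ := fun x => c₀ - ‖p x‖ ^ 2 / (4 * c₀) with hk
  have hkcont : Continuous k := by fun_prop
  set C := L * C₂ / (2 * c₀ ^ 2) with hC
  have hC0 : 0 < C := by positivity
  set C₃ := c₀ / c + C₂ / (4 * c₀) with hC₃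
  have hC₃0 : 0 < C₃ := by positivity
  have hkg : ∀ x, |k x| ≤ C₃ * g x := by
    intro x
    have h1 : c₀ ≤ c₀ / c * g x := by
      rw [div_mul_eq_mul_div, le_div_iff₀ hc0]
      have h2 := hcg x
      have : c ≤ c * (1 + ‖x‖ ^ 2) := by nlinarith [sq_nonneg ‖x‖]
      nlinarith
    have h2 : ‖p x‖ ^ 2 / (4 * c₀) ≤ C₂ / (4 * c₀) * g x := by
      rw [div_mul_eq_mul_div]
      gcongr
      exact hpg x
    have h3 : 0 ≤ ‖p x‖ ^ 2 / (4 * c₀) := by positivity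
    rw [abs_le, hk, hC₃]
    constructor <;> nlinarith [hg0 x]
  have hkint : ∫ x, k x * g x ^ (-(n : ℝ)) =
      c₀ * (∫ x, g x ^ (-(n : ℝ))) - 1 / (4 * c₀) * ∫ x, g x ^ (-(n : ℝ)) * ‖p x‖ ^ 2 := by
    rw [← integral_const_mul, ← integral_const_mul, ← integral_sub (hN.const_mul _)
      (hpint.const_mul _)]
    congr with x
    simp only [hk]
    ring
  have hkI : Integrable fun x => k x * g x ^ (-(n : ℝ)) := by
    refine ((hN.const_mul c₀).sub (hpint.const_mul (1 / (4 * c₀)))).congr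
      (Eventually.of_forall fun x => ?_)
    simp only [hk, Pi.sub_apply]
    ring
  obtain ⟨m, hm⟩ : ∃ m : ℕ, n = m + 1 := ⟨n - 1, by omega⟩
  have hmn : (n : ℝ) - 1 = m := by rw [hm]; push_cast; ring
  have hm0 : (2 : ℝ) ≤ m := by linarith
  set C₅ := m * C + 2 * (m * (C₃ + C)) ^ 2 with hC₅
  -- the inequality for `q = g + s k - s^2 C g`
  have main : ∀ s : ℝ, 0 < s → s ≤ 1 → L * s ≤ c₀ / 2 → m * (s * (C₃ + C)) ≤ 1 / 2 →
      (∫ x : Eucl n, (c₀ * (1 + ‖x‖ ^ 2)) ^ (1 - (n : ℝ))) ≤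
        -(m * ∫ x, k x * g x ^ (-(n : ℝ))) + s * (C₅ * ∫ x, g x ^ (1 - (n : ℝ))) := by
    intro s hs hs1 hLs hms
    set t := s / (1 + s) with ht
    have ht0 : 0 < t := by positivity
    have ht1 : t < 1 := by rw [ht, div_lt_one (by positivity)]; linarith
    have h1t : 1 - t = 1 / (1 + s) := by rw [ht]; field_simp; ring
    have hts : t = (1 - t) * s := by rw [h1t, ht]; ring
    set q : Eucl n → ℝ := fun x => g x + s * k x - s ^ 2 * C * g x with hq
    have hqcont : Continuous q := by fun_prop
    set a : Eucl n → ℝ := fun x => s * (k x / g x) - s ^ 2 * C with ha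
    have hqa : ∀ x, q x = g x * (1 + a x) := fun x => by
      have := (hg0 x).ne'
      simp only [hq, ha]; field_simp
      ring
    have haabs : ∀ x, |a x| ≤ s * (C₃ + C) := by
      intro x
      have h1 : |k x / g x| ≤ C₃ := by
        rw [abs_div, abs_of_pos (hg0 x), div_le_iff₀ (hg0 x)]
        exact hkg x
      have h2 : s ^ 2 * C ≤ s * C := by
        gcongr
        nlinarith
      have h3 : 0 ≤ s ^ 2 * C := by positivity
      have h4 := abs_le.1 h1
      have h5 := mul_le_mul_of_nonneg_left h4.1 hs.le
      have h6 := mul_le_mul_of_nonneg_left h4.2 hs.le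
      rw [abs_le]
      simp only [ha]
      constructor <;> linarith
    have hma : ∀ x, |(m : ℝ) * a x| ≤ 1 / 2 := by
      intro x
      rw [abs_mul, Nat.abs_cast]
      have := mul_le_mul_of_nonneg_left (haabs x) (show (0 : ℝ) ≤ m by linarith)
      linarith
    have ha2 : ∀ x, -(1 / 2) ≤ a x := by
      intro x
      have h1 := haabs x
      have h2 := (abs_le.1 h1).1
      nlinarith [mul_nonneg hs.le (add_pos hC₃0 hC0).le]
    have hq0 : ∀ x, 0 < q x := fun x => by
      rw [hqa]
      exact mul_pos (hg0 x) (by linarith [ha2 x])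
    have hqpt : ∀ x, q x ^ (1 - (n : ℝ)) ≤ g x ^ (1 - (n : ℝ)) - s * (m * (k x * g x ^ (-(n : ℝ)))) +
        s ^ 2 * (C₅ * g x ^ (1 - (n : ℝ))) := by
      intro x
      have h1 : 1 - (n : ℝ) = -(m : ℝ) := by linarith
      have h2 := one_add_rpow_neg_le (abs_le.1 (hma x)).1 (ha2 x)
      have h3 : (m * a x) ^ 2 ≤ s ^ 2 * (m * (C₃ + C)) ^ 2 := by
        rw [← mul_pow, ← sq_abs]
        gcongr
        rw [abs_mul, Nat.abs_cast]
        have := mul_le_mul_of_nonneg_left (haabs x) (show (0 : ℝ) ≤ m by linarith)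
        linarith
      have h4 : g x ^ (-(n : ℝ)) = g x ^ (-(m : ℝ)) / g x := by
        rw [show -(n : ℝ) = -m - 1 by linarith, Real.rpow_sub (hg0 x), Real.rpow_one]
      rw [h1, hqa, Real.mul_rpow (hg0 x).le (by linarith [ha2 x]), h4]
      have h5 : (1 + a x) ^ (-(m : ℝ)) ≤ 1 - s * (m * (k x / g x)) + s ^ 2 * C₅ := by
        refine h2.trans ?_
        rw [hC₅]
        simp only [ha] at h3 ⊢
        linarith
      calc _ ≤ g x ^ (-(m : ℝ)) * (1 - s * (m * (k x / g x)) + s ^ 2 * C₅) :=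
            mul_le_mul_of_nonneg_left h5 (Real.rpow_nonneg (hg0 x).le _)
        _ = _ := by ring
    have hRint : Integrable fun x => g x ^ (1 - (n : ℝ)) - s * (m * (k x * g x ^ (-(n : ℝ)))) +
        s ^ 2 * (C₅ * g x ^ (1 - (n : ℝ))) :=
      (hI.sub ((hkI.const_mul _).const_mul _)).add ((hI.const_mul _).const_mul _)
    have hqint : Integrable fun x => q x ^ (1 - (n : ℝ)) :=
      hRint.mono' (hqcont.measurable.pow_const _).aestronglyMeasurable
        (Eventually.of_forall fun x => by
          rw [Real.norm_of_nonneg (Real.rpow_nonneg (hq0 x).le _)]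
          exact hqpt x)
    -- the strengthened Borell–Brascamp–Lieb inequality, rescaled by `1 - t`
    set h : Eucl n → ℝ := fun z => (1 - t) * q ((1 + s) • z) with hh
    have h1t0 : 0 < 1 - t := by linarith
    have key := bbl_improved (n := n) (by omega) ⟨ht0, ht1⟩ hgcont.measurable
      (W := fun x => c₀ * (1 + ‖x‖ ^ 2)) (h := h) (by fun_prop) (by fun_prop) hg0
      (fun x => mul_pos hc₀ (hbr x)) (fun x => mul_pos h1t0 (hq0 _)) ?_
      (M := ENNReal.ofReal (∫ x, g x ^ (-(n : ℝ)))) ENNReal.ofReal_ne_top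
      (ofReal_integral_eq_lintegral_ofReal hN
        (Eventually.of_forall fun x => Real.rpow_nonneg (hg0 x).le _)).symm
      (by rw [hM]; exact (ofReal_integral_eq_lintegral_ofReal hNW
        (Eventually.of_forall fun x => Real.rpow_nonneg (mul_pos hc₀ (hbr x)).le _)).symm)
    · have hscale : ∫ x, h x ^ (1 - (n : ℝ)) = (1 - t) * ∫ x, q x ^ (1 - (n : ℝ)) := by
        simp only [hh]
        simp_rw [fun z => Real.mul_rpow (z := 1 - (n : ℝ)) h1t0.le (hq0 ((1 + s) • z)).le]
        rw [integral_const_mul, Measure.integral_comp_smul volume (fun x => q x ^ (1 - (n : ℝ)))]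
        simp only [finrank_euclideanSpace, Fintype.card_fin, smul_eq_mul]
        rw [abs_of_pos (by positivity), ← mul_assoc, Real.rpow_sub h1t0, Real.rpow_one,
          Real.rpow_natCast, h1t]
        congr 1
        rw [div_pow, one_pow]
        field_simp
      have hhint : Integrable fun x => h x ^ (1 - (n : ℝ)) := by
        simp only [hh]
        simp_rw [fun z => Real.mul_rpow (z := 1 - (n : ℝ)) h1t0.le (hq0 ((1 + s) • z)).le]
        exact (hqint.comp_smul (by positivity)).const_mul _
      rw [← ofReal_integral_eq_lintegral_ofReal hI
          (Eventually.of_forall fun x => Real.rpow_nonneg (hg0 x).le _),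
        ← ofReal_integral_eq_lintegral_ofReal hJ
          (Eventually.of_forall fun x => Real.rpow_nonneg (mul_pos hc₀ (hbr x)).le _),
        ← ofReal_integral_eq_lintegral_ofReal hhint
          (Eventually.of_forall fun x => Real.rpow_nonneg (mul_pos h1t0 (hq0 _)).le _),
        ← ENNReal.ofReal_mul h1t0.le, ← ENNReal.ofReal_mul ht0.le, ← ENNReal.ofReal_add,
        hscale, ENNReal.ofReal_le_ofReal_iff] at key
      · have h2 : (∫ x, g x ^ (1 - (n : ℝ))) +
            s * (∫ x : Eucl n, (c₀ * (1 + ‖x‖ ^ 2)) ^ (1 - (n : ℝ))) ≤ ∫ x, q x ^ (1 - (n : ℝ)) := by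
          refine le_of_mul_le_mul_left ?_ h1t0
          rw [mul_add, ← mul_assoc, ← hts]
          exact key
        have h3 := integral_mono hqint hRint hqpt
        have h4 : Integrable fun x => g x ^ (1 - (n : ℝ)) - s * (m * (k x * g x ^ (-(n : ℝ)))) :=
          hI.sub ((hkI.const_mul _).const_mul _)
        rw [integral_add h4 ((hI.const_mul _).const_mul _), integral_sub hI ((hkI.const_mul _).const_mul _), integral_const_mul, integral_const_mul,
          integral_const_mul, integral_const_mul] at h3
        refine le_of_mul_le_mul_left ?_ hs
        nlinarith
      · exact mul_nonneg h1t0.le (integral_nonneg fun x => Real.rpow_nonneg (hq0 x).le _)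
      · exact mul_nonneg h1t0.le (integral_nonneg fun x => Real.rpow_nonneg (hg0 x).le _)
      · exact mul_nonneg ht0.le
          (integral_nonneg fun x => Real.rpow_nonneg (mul_pos hc₀ (hbr x)).le _)
    · intro x y
      have e1 : (1 + s) • ((1 - t) • x + t • y) = x + s • y := by
        rw [smul_add, smul_smul, smul_smul, h1t, ht]
        congr 1
        · rw [mul_one_div_cancel (by positivity), one_smul]
        · congr 1; field_simp
      simp only [hh]
      rw [e1]
      set z := x + s • y with hz
      have hx : x = z + (-(s • y)) := by rw [hz]; abel
      have h1 := htay z (-(s • y))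
      rw [← hx, inner_neg_right, real_inner_smul_right, norm_neg, norm_smul, mul_pow,
        Real.norm_eq_abs, sq_abs] at h1
      have h2 : q z ≤ g x + s * (c₀ * (1 + ‖y‖ ^ 2)) := by
        refine le_trans ?_ (add_le_add_left h1 _)
        have h3 : inner ℝ (p z) y ≤ ‖p z‖ * ‖y‖ := real_inner_le_norm _ _
        have h4 : s * C * g z ≥ s * (L * ‖p z‖ ^ 2 / (2 * c₀ ^ 2)) := by
          rw [hC]
          calc s * (L * ‖p z‖ ^ 2 / (2 * c₀ ^ 2)) ≤ s * (L * (C₂ * g z) / (2 * c₀ ^ 2)) := by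
                gcongr; exact hpg z
            _ = _ := by ring
        -- completing the square in `y`
        have h5 : ‖p z‖ * ‖y‖ ≤ (c₀ - L * s) * ‖y‖ ^ 2 + ‖p z‖ ^ 2 / (4 * c₀) +
            s * (L * ‖p z‖ ^ 2 / (2 * c₀ ^ 2)) := by
          have hd : 0 < c₀ - L * s := by linarith
          have h6 : ‖p z‖ * ‖y‖ ≤ (c₀ - L * s) * ‖y‖ ^ 2 + ‖p z‖ ^ 2 / (4 * (c₀ - L * s)) := by
            have h8 : (c₀ - L * s) * ‖y‖ ^ 2 + ‖p z‖ ^ 2 / (4 * (c₀ - L * s)) - ‖p z‖ * ‖y‖ =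
              ((2 * (c₀ - L * s) * ‖y‖ - ‖p z‖) ^ 2) / (4 * (c₀ - L * s)) := by
              field_simp; ring
            have h9 : 0 ≤ ((2 * (c₀ - L * s) * ‖y‖ - ‖p z‖) ^ 2) / (4 * (c₀ - L * s)) := by
              positivity
            linarith
          have h7 : 1 / (4 * (c₀ - L * s)) ≤ 1 / (4 * c₀) + s * (L / (2 * c₀ ^ 2)) := by
            rw [div_le_iff₀ (by positivity)]
            have : (1 / (4 * c₀) + s * (L / (2 * c₀ ^ 2))) * (4 * (c₀ - L * s)) =
              1 + (L * s) * (c₀ - 2 * (L * s)) / c₀ ^ 2 := by field_simp; ring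
            rw [this]
            have : 0 ≤ (L * s) * (c₀ - 2 * (L * s)) / c₀ ^ 2 :=
              div_nonneg (mul_nonneg (by positivity) (by linarith)) (by positivity)
            linarith
          have h8 := mul_le_mul_of_nonneg_right h7 (sq_nonneg ‖p z‖)
          have e2 : 1 / (4 * (c₀ - L * s)) * ‖p z‖ ^ 2 = ‖p z‖ ^ 2 / (4 * (c₀ - L * s)) := by ring
          have e3 : (1 / (4 * c₀) + s * (L / (2 * c₀ ^ 2))) * ‖p z‖ ^ 2 =
            ‖p z‖ ^ 2 / (4 * c₀) + s * (L * ‖p z‖ ^ 2 / (2 * c₀ ^ 2)) := by ring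
          linarith
        have h6 : 0 ≤ s * ((c₀ - L * s) * ‖y‖ ^ 2 + ‖p z‖ ^ 2 / (4 * c₀) + s * C * g z -
          inner ℝ (p z) y) := mul_nonneg hs.le (by linarith)
        simp only [hq, hk]
        nlinarith
      have h3 := mul_le_mul_of_nonneg_left h2 h1t0.le
      rw [mul_add, ← mul_assoc, ← hts] at h3
      exact h3
  -- let `s` tend to zero
  have hlim : Tendsto (fun s : ℝ => -(m * ∫ x, k x * g x ^ (-(n : ℝ))) +
      s * (C₅ * ∫ x, g x ^ (1 - (n : ℝ)))) (nhdsWithin 0 (Ioi 0))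
      (nhds (-(m * ∫ x, k x * g x ^ (-(n : ℝ))) + 0 * (C₅ * ∫ x, g x ^ (1 - (n : ℝ))))) :=
    tendsto_nhdsWithin_of_tendsto_nhds (tendsto_const_nhds.add (tendsto_id.mul_const _))
  have hfinal := ge_of_tendsto hlim (b := ∫ x : Eucl n, (c₀ * (1 + ‖x‖ ^ 2)) ^ (1 - (n : ℝ))) (by
    have e1 : ∀ᶠ s : ℝ in nhdsWithin 0 (Ioi 0), s < min 1 (min (c₀ / 2 / L) (1 / 2 / (m * (C₃ + C)))) :=
      nhdsWithin_le_nhds (gt_mem_nhds (by positivity))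
    filter_upwards [self_mem_nhdsWithin, e1] with s hs hs1
    obtain ⟨h1, h2⟩ := lt_min_iff.1 hs1
    obtain ⟨h2, h3⟩ := lt_min_iff.1 h2
    refine main s hs h1.le ?_ ?_
    · rw [lt_div_iff₀ hL] at h2; linarith
    · rw [lt_div_iff₀ (by positivity)] at h3; linarith)
  rw [hkint, hM] at hfinal
  simp_rw [hgrad, hmn]
  have e4 : (m : ℝ) / (4 * c₀) = m * (1 / (4 * c₀)) := by ring
  rw [e4]
  linarith

/-- The energy `K = ‖U‖_{2^*}^{2^*} = ‖∇U‖_2^2` of the Aubin–Talenti bubble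
`U(x) = [n(n-2)]^{(n-2)/4} (1 + |x|^2)^{-(n-2)/2}`, written with `U^{-2/(n-2)}`. -/
def bubbleEnergy (n : ℕ) : ℝ :=
  ∫ x : Eucl n, (((n : ℝ) * (n - 2)) ^ (-(1 / 2) : ℝ) * (1 + ‖x‖ ^ 2)) ^ (-(n : ℝ))

lemma integral_bracket_pos {n : ℕ} {r : ℝ} (hr : (n : ℝ) < 2 * r) :
    0 < ∫ x : Eucl n, (1 + ‖x‖ ^ 2) ^ (-r) := by
  rw [integral_pos_iff_support_of_nonneg (fun x => by positivity) (integrable_bracket_rpow hr)]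
  rw [show Function.support (fun x : Eucl n => (1 + ‖x‖ ^ 2) ^ (-r)) = univ from ?_]
  · exact Measure.measure_univ_pos.2 (NeZero.ne _)
  · ext x
    have : 0 < (1 + ‖x‖ ^ 2) ^ (-r) := by positivity
    simpa using this.ne'

/-- Integrate `(1 + s + |x|^2)^{-n}` over `s > 0` and `x` in both orders. -/
lemma integral_bracket_succ {n : ℕ} (hn : 3 ≤ n) :
    (∫ x : Eucl n, (1 + ‖x‖ ^ 2) ^ (1 - (n : ℝ))) =
      2 * ((n : ℝ) - 1) / ((n : ℝ) - 2) * ∫ x : Eucl n, (1 + ‖x‖ ^ 2) ^ (-(n : ℝ)) := by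
  have hn3 : (3 : ℝ) ≤ n := by exact_mod_cast hn
  have hbr : ∀ x : Eucl n, 0 < 1 + ‖x‖ ^ 2 := fun x => by positivity
  have hN : Integrable fun x : Eucl n => (1 + ‖x‖ ^ 2) ^ (-(n : ℝ)) :=
    integrable_bracket_rpow (by linarith)
  have hI : Integrable fun x : Eucl n => (1 + ‖x‖ ^ 2) ^ (1 - (n : ℝ)) := by
    have := integrable_bracket_rpow (n := n) (r := n - 1) (by linarith)
    rwa [neg_sub] at this
  set I := ∫ x : Eucl n, (1 + ‖x‖ ^ 2) ^ (-(n : ℝ)) with hIdef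
  have h1 : ∫⁻ x : Eucl n, ∫⁻ s in Ioi (0 : ℝ), ENNReal.ofReal ((1 + ‖x‖ ^ 2 + s) ^ (-(n : ℝ))) =
      ENNReal.ofReal ((∫ x : Eucl n, (1 + ‖x‖ ^ 2) ^ (1 - (n : ℝ))) / (n - 1)) := by
    rw [← integral_div, ofReal_integral_eq_lintegral_ofReal (hI.div_const _)]
    · congr with x
      rw [lintegral_Ioi_add_rpow (hbr x) (by linarith)]
    · exact Eventually.of_forall fun x => div_nonneg (Real.rpow_nonneg (hbr x).le _) (by linarith)
  have h2 : ∫⁻ s in Ioi (0 : ℝ), ∫⁻ x : Eucl n, ENNReal.ofReal ((1 + ‖x‖ ^ 2 + s) ^ (-(n : ℝ))) =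
      ENNReal.ofReal (I / (n / 2 - 1)) := by
    have h3 : ∀ s ∈ Ioi (0 : ℝ), ∫⁻ x : Eucl n, ENNReal.ofReal ((1 + ‖x‖ ^ 2 + s) ^ (-(n : ℝ))) =
        ENNReal.ofReal I * ENNReal.ofReal ((1 + s) ^ (-((n : ℝ) / 2))) := by
      intro s hs
      have hs0 : 0 < 1 + s := by have : (0 : ℝ) < s := hs; linarith
      set a := Real.sqrt (1 + s) with ha
      have ha0 : 0 < a := Real.sqrt_pos.2 hs0
      have ha2 : a ^ 2 = 1 + s := Real.sq_sqrt hs0.le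
      have e1 : ∀ x : Eucl n, (1 + ‖x‖ ^ 2 + s) ^ (-(n : ℝ)) =
          (1 + s) ^ (-(n : ℝ)) * (1 + ‖a⁻¹ • x‖ ^ 2) ^ (-(n : ℝ)) := by
        intro x
        rw [← Real.mul_rpow hs0.le (by positivity), norm_smul, mul_pow, norm_inv,
          Real.norm_of_nonneg ha0.le, inv_pow, ha2]
        congr 1
        field_simp
        ring
      have e2 : Integrable fun x : Eucl n => (1 + ‖x‖ ^ 2 + s) ^ (-(n : ℝ)) := by
        simp_rw [e1]
        exact (hN.comp_smul (inv_ne_zero ha0.ne')).const_mul _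
      rw [← ofReal_integral_eq_lintegral_ofReal e2
        (Eventually.of_forall fun x => Real.rpow_nonneg (by
          have : (0 : ℝ) < s := hs
          positivity) _)]
      simp_rw [e1]
      rw [integral_const_mul,
        Measure.integral_comp_smul volume (fun x : Eucl n => (1 + ‖x‖ ^ 2) ^ (-(n : ℝ))),
        ← hIdef, mul_comm (ENNReal.ofReal I), ← ENNReal.ofReal_mul (Real.rpow_nonneg hs0.le _)]
      congr 1
      simp only [finrank_euclideanSpace, Fintype.card_fin, smul_eq_mul]
      rw [inv_pow, inv_inv, abs_of_pos (by positivity), ← mul_assoc]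
      congr 1
      rw [← Real.rpow_natCast, ha, Real.sqrt_eq_rpow, ← Real.rpow_mul hs0.le,
        ← Real.rpow_add hs0]
      congr 1
      ring
    rw [setLIntegral_congr_fun measurableSet_Ioi h3, lintegral_const_mul _ (by fun_prop),
      lintegral_Ioi_add_rpow one_pos (by linarith), Real.one_rpow, ← ENNReal.ofReal_mul]
    · congr 1
      ring
    · exact integral_nonneg fun x => Real.rpow_nonneg (hbr x).le _
  rw [← lintegral_lintegral_swap (by fun_prop), h1, ENNReal.ofReal_eq_ofReal_iff] at h2
  · rw [div_eq_div_iff (by linarith) (by linarith)] at h2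
    rw [div_mul_eq_mul_div, eq_div_iff (by linarith)]
    linarith
  · exact div_nonneg (integral_nonneg fun x => Real.rpow_nonneg (hbr x).le _) (by linarith)
  · exact div_nonneg (integral_nonneg fun x => Real.rpow_nonneg (hbr x).le _) (by linarith)

lemma bubbleEnergy_eq {n : ℕ} (hn : 3 ≤ n) : bubbleEnergy n =
    ((n : ℝ) * (n - 2)) ^ ((n : ℝ) / 2) * ∫ x : Eucl n, (1 + ‖x‖ ^ 2) ^ (-(n : ℝ)) := by
  have hn3 : (3 : ℝ) ≤ n := by exact_mod_cast hn
  have h0 : 0 < (n : ℝ) * (n - 2) := mul_pos (by linarith) (by linarith)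
  rw [bubbleEnergy, ← integral_const_mul]
  congr with x
  rw [Real.mul_rpow (by positivity) (by positivity), ← Real.rpow_mul h0.le]
  congr 2
  ring

lemma bubbleEnergy_pos {n : ℕ} (hn : 3 ≤ n) : 0 < bubbleEnergy n := by
  have hn3 : (3 : ℝ) ≤ n := by exact_mod_cast hn
  have h0 : 0 < (n : ℝ) * (n - 2) := mul_pos (by linarith) (by linarith)
  rw [bubbleEnergy_eq hn]
  exact mul_pos (Real.rpow_pos_of_pos h0 _) (integral_bracket_pos (by linarith))

set_option maxHeartbeats 1000000 in
/-- The gradient inequality for `g = λ F^{-1/(n-2)}`, where `F = f^2` and `f` is a positive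
function equal to a multiple of `(1 + |x|^2)^{-(n-2)/2}` near infinity. Here `f` is the
regularization `(φ^2 + δ (1 + |x|^2)^{-(n-2)})^{1/2}` of a test function `φ`, with an
explicit bound of `‖∇f‖_2^2`. -/
lemma sharp_sobolev_regularized {n : ℕ} (hn : 3 ≤ n) {φ : Eucl n → ℝ} (hφ : ContDiff ℝ ∞ φ)
    (hc : HasCompactSupport φ) {δ : ℝ} (hδ : 0 < δ) :
    bubbleEnergy n ^ (2 / (n : ℝ)) * (∫ x, |φ x| ^ critExp n) ^ (((n : ℝ) - 2) / n) ≤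
      (∫ x, ‖∇ φ x‖ ^ 2) +
        δ * ∫ x : Eucl n, ((n : ℝ) - 2) ^ 2 * (1 + ‖x‖ ^ 2) ^ (1 - (n : ℝ)) := by
  have hn3 : (3 : ℝ) ≤ n := by exact_mod_cast hn
  have hn0 : (0 : ℝ) < n := by linarith
  have hn2 : (0 : ℝ) < (n : ℝ) - 2 := by linarith
  have hbr : ∀ x : Eucl n, 0 < 1 + ‖x‖ ^ 2 := fun x => by positivity
  set B : Eucl n → ℝ := fun x => (1 + ‖x‖ ^ 2) ^ (-((n : ℝ) - 2)) with hB
  set D : Eucl n → ℝ := fun x => ((n : ℝ) - 2) ^ 2 * (1 + ‖x‖ ^ 2) ^ (1 - (n : ℝ)) with hD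
  have hB0 : ∀ x, 0 < B x := fun x => Real.rpow_pos_of_pos (hbr x) _
  have hD0 : ∀ x, 0 ≤ D x := fun x => by simp only [hD]; positivity
  have hDint : Integrable D := by
    have := integrable_bracket_rpow (n := n) (r := n - 1) (by linarith)
    rw [neg_sub] at this
    exact this.const_mul _
  set F : Eucl n → ℝ := fun x => φ x ^ 2 + δ * B x with hF
  have hF0 : ∀ x, 0 < F x := fun x =>
    add_pos_of_nonneg_of_pos (sq_nonneg _) (mul_pos hδ (hB0 x))
  have hbrsm : ContDiff ℝ ∞ fun x : Eucl n => 1 + ‖x‖ ^ 2 := contDiff_const.add (contDiff_norm_sq ℝ)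
  have hBsm : ContDiff ℝ ∞ B := hbrsm.rpow_const_of_ne fun x => (hbr x).ne'
  have hFsm : ContDiff ℝ ∞ F := (hφ.pow 2).add (contDiff_const.mul hBsm)
  have hout : ∀ x ∉ tsupport φ, F x = δ * B x := fun x hx => by
    simp [hF, image_eq_zero_of_notMem_tsupport hx]
  -- the total mass of `F^{n/(n-2)}`
  have hq0 : 0 < (n : ℝ) / (n - 2) := by positivity
  have hFint : Integrable fun x => F x ^ ((n : ℝ) / (n - 2)) := by
    have h1 : Integrable fun x => (δ * B x) ^ ((n : ℝ) / (n - 2)) := by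
      have e : ∀ x, (δ * B x) ^ ((n : ℝ) / (n - 2)) =
          δ ^ ((n : ℝ) / (n - 2)) * (1 + ‖x‖ ^ 2) ^ (-(n : ℝ)) := fun x => by
        rw [Real.mul_rpow hδ.le (hB0 x).le, hB, ← Real.rpow_mul (hbr x).le]
        congr 2
        field_simp
      simp_rw [e]
      exact (integrable_bracket_rpow (by linarith)).const_mul _
    have h2 : Integrable fun x => F x ^ ((n : ℝ) / (n - 2)) - (δ * B x) ^ ((n : ℝ) / (n - 2)) := by
      refine Continuous.integrable_of_hasCompactSupport ?_ ?_
      · exact (hFsm.continuous.rpow_const fun x => Or.inr hq0.le).sub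
          ((continuous_const.mul hBsm.continuous).rpow_const fun x => Or.inr hq0.le)
      · exact HasCompactSupport.intro (K := tsupport φ) hc fun x hx => by rw [hout x hx, sub_self]
    refine (h2.add h1).congr (Eventually.of_forall fun x => ?_)
    simp
  set m := ∫ x, F x ^ ((n : ℝ) / (n - 2)) with hm
  have hm0 : 0 < m := by
    rw [hm, integral_pos_iff_support_of_nonneg (fun x => Real.rpow_nonneg (hF0 x).le _) hFint]
    rw [show Function.support (fun x => F x ^ ((n : ℝ) / (n - 2))) = univ from ?_]
    · exact Measure.measure_univ_pos.2 (NeZero.ne _)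
    · ext x
      simpa using (Real.rpow_pos_of_pos (hF0 x) _).ne'
  have hφm : ∫ x, |φ x| ^ critExp n ≤ m := by
    refine integral_mono_of_nonneg (Eventually.of_forall fun x => by positivity) hFint
      (Eventually.of_forall fun x => ?_)
    have e : |φ x| ^ critExp n = (φ x ^ 2) ^ ((n : ℝ) / (n - 2)) := by
      rw [← sq_abs, ← Real.rpow_natCast, ← Real.rpow_mul (abs_nonneg _), critExp]
      congr 1
      push_cast
      ring
    simp only [e]
    refine Real.rpow_le_rpow (sq_nonneg _) ?_ hq0.le
    simpa [hF] using (mul_pos hδ (hB0 x)).le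
  set K := bubbleEnergy n with hK
  have hK0 : 0 < K := bubbleEnergy_pos hn
  set lam := (m / K) ^ (1 / (n : ℝ)) with hlam
  have hlam0 : 0 < lam := by positivity
  set c₀ := ((n : ℝ) * (n - 2)) ^ (-(1 / 2) : ℝ) with hc₀
  have hnn : 0 < (n : ℝ) * (n - 2) := by positivity
  have hc₀0 : 0 < c₀ := Real.rpow_pos_of_pos hnn _
  have hc₀sq : c₀ ^ 2 * (n * (n - 2)) = 1 := by
    rw [hc₀, ← Real.rpow_natCast, ← Real.rpow_mul hnn.le]
    norm_num
    rw [Real.rpow_neg_one]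
    exact inv_mul_cancel₀ hnn.ne'
  set g : Eucl n → ℝ := fun x => lam * F x ^ (-(1 / ((n : ℝ) - 2))) with hg
  have hgsm : ContDiff ℝ ∞ g := contDiff_const.mul (hFsm.rpow_const_of_ne fun x => (hF0 x).ne')
  set κ := lam * δ ^ (-(1 / ((n : ℝ) - 2))) with hκ
  have hκ0 : 0 < κ := by positivity
  have hg0 : ∀ x, 0 < g x := fun x => mul_pos hlam0 (Real.rpow_pos_of_pos (hF0 x) _)
  have hgpow : ∀ x, g x ^ (-(n : ℝ)) = K / m * F x ^ ((n : ℝ) / (n - 2)) := fun x => by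
    simp only [hg]
    rw [Real.mul_rpow hlam0.le (Real.rpow_nonneg (hF0 x).le _), hlam,
      ← Real.rpow_mul (by positivity), ← Real.rpow_mul (hF0 x).le]
    congr 1
    · rw [show 1 / (n : ℝ) * -n = -1 by field_simp, Real.rpow_neg_one, inv_div]
    · congr 1
      field_simp
  have key := bbl_gradient hn hc₀0 hκ0 (ψ := fun x => g x - κ * (1 + ‖x‖ ^ 2))
    (hgsm.sub (contDiff_const.mul hbrsm))
    (HasCompactSupport.intro (K := tsupport φ) hc fun x hx => by
      simp only [hg, hout x hx, hB, hκ]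
      rw [Real.mul_rpow hδ.le (by positivity), ← Real.rpow_mul (hbr x).le,
        show -((n : ℝ) - 2) * -(1 / ((n : ℝ) - 2)) = 1 by field_simp, Real.rpow_one]
      ring)
    (g := g) (fun x => by ring) hg0 (by
      simp_rw [hgpow]
      rw [integral_const_mul, ← hm, div_mul_cancel₀ _ hm0.ne', hK]
      rfl)
  change _ + (n - 1) * c₀ * K ≤ _ at key
  -- the left side is a multiple of `K`
  have hJ : (∫ x : Eucl n, (c₀ * (1 + ‖x‖ ^ 2)) ^ (1 - (n : ℝ))) =
      2 * (n - 1) / (n - 2) * (c₀ * K) := by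
    have e1 : ∀ x : Eucl n, (c₀ * (1 + ‖x‖ ^ 2)) ^ (1 - (n : ℝ)) =
        c₀ * c₀ ^ (-(n : ℝ)) * (1 + ‖x‖ ^ 2) ^ (1 - (n : ℝ)) := fun x => by
      rw [Real.mul_rpow hc₀0.le (hbr x).le, sub_eq_add_neg, Real.rpow_add hc₀0, Real.rpow_one]
    have e2 : K = c₀ ^ (-(n : ℝ)) * ∫ x : Eucl n, (1 + ‖x‖ ^ 2) ^ (-(n : ℝ)) := by
      rw [hK, bubbleEnergy, ← integral_const_mul]
      congr with x
      rw [Real.mul_rpow hc₀0.le (hbr x).le]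
    simp_rw [e1]
    rw [integral_const_mul, integral_bracket_succ hn, e2]
    ring
  -- pointwise bound of the right side
  have hFd : ∀ x, HasGradientAt F ((2 * φ x) • ∇ φ x +
      (-(2 * δ * (n - 2)) * (1 + ‖x‖ ^ 2) ^ (1 - (n : ℝ))) • x) x := by
    intro x
    have h1 : HasGradientAt φ (∇ φ x) x := ((hφ.differentiable (by simp)) x).hasGradientAt
    have h2 := hasGradientAt_norm_sq x
    rw [hasGradientAt_iff_hasFDerivAt] at h1 h2 ⊢
    refine ((h1.pow 2).add (((h2.const_add 1).rpow_const (p := -((n : ℝ) - 2))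
      (Or.inl (hbr x).ne')).const_mul δ)).congr_fderiv ?_
    simp only [map_add, map_smul, smul_smul]
    rw [show -((n : ℝ) - 2) - 1 = 1 - n by ring]
    congr 2
    · simp
    · ring
  have hgd : ∀ x, ∇ g x = (lam * (-(1 / ((n : ℝ) - 2)) * F x ^ (-(1 / ((n : ℝ) - 2)) - 1))) •
      ∇ F x := by
    intro x
    have h1 := hFd x
    have h2 : ∇ F x = _ := h1.gradient
    rw [h2]
    refine HasGradientAt.gradient ?_
    rw [hasGradientAt_iff_hasFDerivAt] at h1 ⊢
    refine ((h1.rpow_const (p := -(1 / ((n : ℝ) - 2))) (Or.inl (hF0 x).ne')).const_mul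
      lam).congr_fderiv ?_
    rw [map_smul, smul_smul]
  have hFbd : ∀ x, ‖∇ F x‖ ^ 2 ≤ 4 * F x * (‖∇ φ x‖ ^ 2 + δ * D x) := by
    intro x
    rw [(hFd x).gradient]
    set b := 2 * (n - 2) * (1 + ‖x‖ ^ 2) ^ (1 - (n : ℝ)) * ‖x‖ with hb
    have hb0 : 0 ≤ b := by positivity
    have hb2 : b ^ 2 ≤ 4 * (B x * D x) := by
      have e1 : B x = (1 + ‖x‖ ^ 2) ^ (1 - (n : ℝ)) * (1 + ‖x‖ ^ 2) := by
        rw [hB]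
        simp only
        nth_rewrite 3 [← Real.rpow_one (1 + ‖x‖ ^ 2)]
        rw [← Real.rpow_add (hbr x)]
        congr 1; ring
      rw [e1, hb]
      simp only [hD]
      have : 0 ≤ ((1 + ‖x‖ ^ 2) ^ (1 - (n : ℝ)) * (n - 2)) ^ 2 := sq_nonneg _
      nlinarith
    have h1 : ‖(2 * φ x) • ∇ φ x + (-(2 * δ * (n - 2)) * (1 + ‖x‖ ^ 2) ^ (1 - (n : ℝ))) • x‖ ≤
        2 * |φ x| * ‖∇ φ x‖ + δ * b := by
      refine (norm_add_le _ _).trans (le_of_eq ?_)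
      rw [norm_smul, norm_smul, norm_mul, norm_mul, Real.norm_eq_abs, Real.norm_eq_abs, abs_two,
        norm_neg, Real.norm_of_nonneg (by positivity), Real.norm_of_nonneg (by positivity), hb]
      ring
    set a := ‖∇ φ x‖ with ha
    have ha0 : 0 ≤ a := norm_nonneg _
    have h2 : |φ x| * a * b ≤ φ x ^ 2 * D x + B x * a ^ 2 := by
      refine abs_le_of_sq_le_sq' ?_ ?_ |>.2
      · have h3 : (|φ x| * a * b) ^ 2 ≤ φ x ^ 2 * a ^ 2 * (4 * (B x * D x)) := by
          rw [mul_pow, mul_pow, sq_abs]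
          gcongr
        nlinarith [sq_nonneg (φ x ^ 2 * D x - B x * a ^ 2)]
      · have := hD0 x
        have := hB0 x
        positivity
    calc _ ≤ (2 * |φ x| * a + δ * b) ^ 2 := by gcongr
      _ = 4 * φ x ^ 2 * a ^ 2 + 4 * δ * (|φ x| * a * b) + δ ^ 2 * b ^ 2 := by
          rw [← sq_abs (φ x)]; ring
      _ ≤ 4 * φ x ^ 2 * a ^ 2 + 4 * δ * (φ x ^ 2 * D x + B x * a ^ 2) +
          δ ^ 2 * (4 * (B x * D x)) := by gcongr
      _ = _ := by simp only [hF]; ring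
  have hpt : ∀ x, g x ^ (-(n : ℝ)) * ‖∇ g x‖ ^ 2 ≤
      4 * lam ^ (2 - (n : ℝ)) / (n - 2) ^ 2 * (‖∇ φ x‖ ^ 2 + δ * D x) := by
    intro x
    have e1 : g x ^ (-(n : ℝ)) * ‖∇ g x‖ ^ 2 =
        lam ^ (2 - (n : ℝ)) / (n - 2) ^ 2 * ((F x)⁻¹ * ‖∇ F x‖ ^ 2) := by
      rw [hgd, norm_smul, mul_pow, Real.norm_eq_abs, sq_abs]
      simp only [hg]
      rw [Real.mul_rpow hlam0.le (Real.rpow_nonneg (hF0 x).le _), ← Real.rpow_mul (hF0 x).le]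
      have e2 : (F x ^ (-(1 / ((n : ℝ) - 2)) - 1)) ^ 2 = F x ^ (2 * (-(1 / ((n : ℝ) - 2)) - 1)) := by
        rw [← Real.rpow_natCast, ← Real.rpow_mul (hF0 x).le]
        congr 1; push_cast; ring
      have e3 : F x ^ (-(1 / ((n : ℝ) - 2)) * -(n : ℝ)) * F x ^ (2 * (-(1 / ((n : ℝ) - 2)) - 1)) =
          (F x)⁻¹ := by
        rw [← Real.rpow_add (hF0 x), ← Real.rpow_neg_one]
        congr 1; field_simp; ring
      have e4 : lam ^ (2 - (n : ℝ)) = lam ^ (-(n : ℝ)) * lam ^ 2 := by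
        rw [← Real.rpow_natCast, ← Real.rpow_add hlam0]
        congr 1; push_cast; ring
      calc _ = lam ^ (-(n : ℝ)) * lam ^ 2 * (1 / ((n : ℝ) - 2)) ^ 2 *
            (F x ^ (-(1 / ((n : ℝ) - 2)) * -(n : ℝ)) * (F x ^ (-(1 / ((n : ℝ) - 2)) - 1)) ^ 2) *
            ‖∇ F x‖ ^ 2 := by ring
        _ = _ := by rw [e2, e3, e4, one_div, inv_pow]; ring
    rw [e1]
    calc _ ≤ lam ^ (2 - (n : ℝ)) / (n - 2) ^ 2 *
          ((F x)⁻¹ * (4 * F x * (‖∇ φ x‖ ^ 2 + δ * D x))) := by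
            have := (hF0 x).le
            gcongr
            exact hFbd x
      _ = _ := by have := (hF0 x).ne'; field_simp
  have hGint : Integrable fun x => ‖∇ φ x‖ ^ 2 := by
    refine Continuous.integrable_of_hasCompactSupport ((continuous_gradient hφ).norm.pow 2) ?_
    refine HasCompactSupport.intro (K := tsupport φ) hc fun x hx => ?_
    have : fderiv ℝ φ x = 0 := by
      by_contra h
      exact hx (support_fderiv_subset ℝ h)
    simp [gradient, this]
  have hint : ∫ x, g x ^ (-(n : ℝ)) * ‖∇ g x‖ ^ 2 ≤
      4 * lam ^ (2 - (n : ℝ)) / (n - 2) ^ 2 * ((∫ x, ‖∇ φ x‖ ^ 2) + δ * ∫ x, D x) := by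
    rw [← integral_const_mul, ← integral_add hGint (hDint.const_mul _), ← integral_const_mul]
    refine integral_mono_of_nonneg (Eventually.of_forall fun x => mul_nonneg
      (Real.rpow_nonneg (hg0 x).le _) (sq_nonneg _)) ((hGint.add (hDint.const_mul _)).const_mul _)
      (Eventually.of_forall hpt)
  set R := (∫ x, ‖∇ φ x‖ ^ 2) + δ * ∫ x, D x with hR
  have hmain : K * lam ^ ((n : ℝ) - 2) ≤ R := by
    have h1 : 2 * ((n : ℝ) - 1) / (n - 2) * (c₀ * K) + (n - 1) * c₀ * K ≤
        (n - 1) / (4 * c₀) * (4 * lam ^ (2 - (n : ℝ)) / (n - 2) ^ 2 * R) := by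
      rw [← hJ]
      refine key.trans ?_
      exact mul_le_mul_of_nonneg_left hint (div_nonneg (by linarith) (by linarith))
    have e1 : lam ^ (2 - (n : ℝ)) = (lam ^ ((n : ℝ) - 2))⁻¹ := by
      rw [← Real.rpow_neg hlam0.le]; congr 1; ring
    rw [e1] at h1
    have hl : 0 < lam ^ ((n : ℝ) - 2) := Real.rpow_pos_of_pos hlam0 _
    have h2 : 2 * ((n : ℝ) - 1) / (n - 2) * (c₀ * K) + (n - 1) * c₀ * K =
        (n - 1) / (c₀ * (n - 2) ^ 2) * ((c₀ ^ 2 * (n * (n - 2))) * K) := by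
      field_simp; ring
    have h3 : (n - 1) / (4 * c₀) * (4 * (lam ^ ((n : ℝ) - 2))⁻¹ / (n - 2) ^ 2 * R) =
        (n - 1) / (c₀ * (n - 2) ^ 2) * ((lam ^ ((n : ℝ) - 2))⁻¹ * R) := by
      field_simp
    rw [h2, h3, hc₀sq, one_mul] at h1
    have h4 : 0 < ((n : ℝ) - 1) / (c₀ * (n - 2) ^ 2) :=
      div_pos (by linarith) (by positivity)
    have h5 := le_of_mul_le_mul_left h1 h4
    rw [inv_mul_eq_div, le_div_iff₀ hl] at h5
    exact h5
  calc K ^ (2 / (n : ℝ)) * (∫ x, |φ x| ^ critExp n) ^ (((n : ℝ) - 2) / n)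
      ≤ K ^ (2 / (n : ℝ)) * m ^ (((n : ℝ) - 2) / n) := by
        gcongr
    _ = K * lam ^ ((n : ℝ) - 2) := by
        rw [hlam, ← Real.rpow_mul (by positivity), Real.div_rpow hm0.le hK0.le,
          show 1 / (n : ℝ) * (n - 2) = (n - 2) / n by ring]
        have : K = K ^ (2 / (n : ℝ)) * K ^ (((n : ℝ) - 2) / n) := by
          rw [← Real.rpow_add hK0, ← add_div, add_sub_cancel, div_self hn0.ne', Real.rpow_one]
        have h2 : K ^ (((n : ℝ) - 2) / n) ≠ 0 := (Real.rpow_pos_of_pos hK0 _).ne'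
        nth_rewrite 2 [this]
        field_simp
    _ ≤ R := hmain

/-- The sharp Sobolev inequality for test functions. -/
theorem sharp_sobolev {n : ℕ} (hn : 3 ≤ n) {φ : Eucl n → ℝ} (hφ : ContDiff ℝ ∞ φ)
    (hc : HasCompactSupport φ) :
    bubbleEnergy n ^ (2 / (n : ℝ)) * (∫ x, |φ x| ^ critExp n) ^ (2 / critExp n) ≤
      ∫ x, ‖∇ φ x‖ ^ 2 := by
  have e : 2 / critExp n = ((n : ℝ) - 2) / n := by
    rw [critExp, div_div_eq_mul_div, mul_div_mul_left _ _ two_ne_zero]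
  rw [e]
  have hlim : Tendsto (fun δ : ℝ => (∫ x, ‖∇ φ x‖ ^ 2) +
      δ * ∫ x : Eucl n, ((n : ℝ) - 2) ^ 2 * (1 + ‖x‖ ^ 2) ^ (1 - (n : ℝ))) (nhdsWithin 0 (Ioi 0))
      (nhds ((∫ x, ‖∇ φ x‖ ^ 2) +
        0 * ∫ x : Eucl n, ((n : ℝ) - 2) ^ 2 * (1 + ‖x‖ ^ 2) ^ (1 - (n : ℝ)))) :=
    tendsto_nhdsWithin_of_tendsto_nhds (tendsto_const_nhds.add (tendsto_id.mul_const _))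
  rw [zero_mul, add_zero] at hlim
  refine ge_of_tendsto hlim ?_
  filter_upwards [self_mem_nhdsWithin] with δ hδ
  exact sharp_sobolev_regularized hn hφ hc hδ

/-- The sharp constant of the Sobolev inequality is at least the one of the Aubin–Talenti
bubble. -/
theorem bubbleEnergy_le_sobolevConst_rpow {n : ℕ} (hn : 3 ≤ n) :
    bubbleEnergy n ≤ sobolevConst n ^ ((n : ℝ) / 2) := by
  have hn3 : (3 : ℝ) ≤ n := by exact_mod_cast hn
  have hK := bubbleEnergy_pos hn
  have h1 : bubbleEnergy n ^ (2 / (n : ℝ)) ≤ sobolevConst n := by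
    refine le_csSup ?_ fun φ hφ hc => sharp_sobolev hn hφ hc
    -- any nonzero test function bounds the admissible constants
    let f : ContDiffBump (0 : Eucl n) := ⟨1, 2, one_pos, one_lt_two⟩
    have hp : 0 < ∫ x, |f x| ^ critExp n := by
      have hce : 0 < critExp n := div_pos (by linarith) (by linarith)
      refine Continuous.integral_pos_of_hasCompactSupport_nonneg_nonzero (x := 0)
        (f.continuous.abs.rpow_const fun _ => Or.inr hce.le) ?_ (fun x => by positivity) ?_
      · exact f.hasCompactSupport.comp_left (g := fun r => |r| ^ critExp n)
          (by simp [Real.zero_rpow hce.ne'])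
      · have : f (0 : Eucl n) = 1 := f.one_of_mem_closedBall (by simp [f])
        simp [this]
    refine ⟨(∫ x, ‖∇ (fun y => f y) x‖ ^ 2) / (∫ x, |f x| ^ critExp n) ^ (2 / critExp n),
      fun s hs => ?_⟩
    rw [le_div_iff₀ (Real.rpow_pos_of_pos hp _)]
    exact hs f f.contDiff f.hasCompactSupport
  calc bubbleEnergy n = (bubbleEnergy n ^ (2 / (n : ℝ))) ^ ((n : ℝ) / 2) := by
        rw [← Real.rpow_mul hK.le, div_mul_div_cancel₀ (by linarith), div_self two_ne_zero,
          Real.rpow_one]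
    _ ≤ _ := by gcongr

/-! ### Weak gradients -/

lemma hasCompactSupport_gradient {n : ℕ} {φ : Eucl n → ℝ} (hc : HasCompactSupport φ) :
    HasCompactSupport (∇ φ) := by
  refine HasCompactSupport.intro (K := tsupport φ) hc fun x hx => ?_
  have : fderiv ℝ φ x = 0 := by
    by_contra h
    exact hx (support_fderiv_subset ℝ h)
  simp [gradient, this]

lemma integrable_smul_gradient {n : ℕ} {u φ : Eucl n → ℝ} (hu : MemLp u 2 volume)
    (hφ : ContDiff ℝ ∞ φ) (hc : HasCompactSupport φ) : Integrable fun x => u x • ∇ φ x :=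
  (hu.locallyIntegrable (by norm_num)).integrable_smul_right_of_hasCompactSupport
    (continuous_gradient hφ) (hasCompactSupport_gradient hc)

lemma integrable_smul_field {n : ℕ} {φ : Eucl n → ℝ} {G : Eucl n → Eucl n} (hG : MemLp G 2 volume)
    (hφ : ContDiff ℝ ∞ φ) (hc : HasCompactSupport φ) : Integrable fun x => φ x • G x :=
  (hG.locallyIntegrable (by norm_num)).integrable_smul_left_of_hasCompactSupport hφ.continuous hc

lemma IsWeakGradient.ae_eq {n : ℕ} {u : Eucl n → ℝ} {G G' : Eucl n → Eucl n}
    (hG : MemLp G 2 volume) (hG' : MemLp G' 2 volume) (h : IsWeakGradient u G)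
    (h' : IsWeakGradient u G') : G =ᵐ[volume] G' := by
  have h0 : ∀ᵐ x, G x - G' x = 0 := by
    refine ae_eq_zero_of_integral_contDiff_smul_eq_zero
      ((hG.sub hG').locallyIntegrable (by norm_num)) fun φ hφ hc => ?_
    simp_rw [smul_sub]
    rw [integral_sub (integrable_smul_field hG hφ hc) (integrable_smul_field hG' hφ hc)]
    have h1 := h φ hφ hc
    rw [h' φ hφ hc, neg_inj] at h1
    rw [h1, sub_self]
  filter_upwards [h0] with x hx
  exact sub_eq_zero.1 hx

lemma MemH1.weakGradient_spec {n : ℕ} {u : Eucl n → ℝ} (hu : MemH1 u) :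
    MemLp (weakGradient u) 2 volume ∧ IsWeakGradient u (weakGradient u) := by
  have h := hu.2
  simp only [weakGradient, dif_pos h]
  exact h.choose_spec

lemma weakGradient_ae_eq {n : ℕ} {u : Eucl n → ℝ} {G : Eucl n → Eucl n}
    (hG : MemLp G 2 volume) (h : IsWeakGradient u G) : weakGradient u =ᵐ[volume] G := by
  have h0 : ∃ G : Eucl n → Eucl n, MemLp G 2 volume ∧ IsWeakGradient u G := ⟨G, hG, h⟩
  simp only [weakGradient, dif_pos h0]
  exact IsWeakGradient.ae_eq h0.choose_spec.1 hG h0.choose_spec.2 h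

lemma gradSq_eq {n : ℕ} {u : Eucl n → ℝ} {G : Eucl n → Eucl n}
    (hG : MemLp G 2 volume) (h : IsWeakGradient u G) : gradSq u = ∫ x, ‖G x‖ ^ 2 := by
  refine integral_congr_ae ?_
  filter_upwards [weakGradient_ae_eq hG h] with x hx
  rw [hx]

lemma gradSq_nonneg {n : ℕ} (u : Eucl n → ℝ) : 0 ≤ gradSq u :=
  integral_nonneg fun _ => sq_nonneg _

lemma mass_nonneg {n : ℕ} (u : Eucl n → ℝ) : 0 ≤ mass u :=
  integral_nonneg fun _ => sq_nonneg _

lemma IsWeakGradient.add {n : ℕ} {u v : Eucl n → ℝ} {G H : Eucl n → Eucl n}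
    (hu : MemLp u 2 volume) (hv : MemLp v 2 volume) (hG : MemLp G 2 volume) (hH : MemLp H 2 volume)
    (h : IsWeakGradient u G) (h' : IsWeakGradient v H) :
    IsWeakGradient (fun x => u x + v x) (fun x => G x + H x) := by
  intro φ hφ hc
  simp_rw [add_smul, smul_add]
  rw [integral_add (integrable_smul_gradient hu hφ hc) (integrable_smul_gradient hv hφ hc),
    integral_add (integrable_smul_field hG hφ hc) (integrable_smul_field hH hφ hc),
    h φ hφ hc, h' φ hφ hc]
  abel

lemma IsWeakGradient.const_mul {n : ℕ} {u : Eucl n → ℝ} {G : Eucl n → Eucl n} (c : ℝ)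
    (h : IsWeakGradient u G) : IsWeakGradient (fun x => c * u x) (fun x => c • G x) := by
  intro φ hφ hc
  simp_rw [mul_smul, smul_comm _ c]
  rw [integral_smul, integral_smul, h φ hφ hc, smul_neg]

lemma MemH1.add {n : ℕ} {u v : Eucl n → ℝ} (hu : MemH1 u) (hv : MemH1 v) :
    MemH1 fun x => u x + v x :=
  ⟨hu.1.add hv.1, _, hu.weakGradient_spec.1.add hv.weakGradient_spec.1,
    IsWeakGradient.add hu.1 hv.1 hu.weakGradient_spec.1 hv.weakGradient_spec.1
      hu.weakGradient_spec.2 hv.weakGradient_spec.2⟩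

lemma MemH1.const_mul {n : ℕ} {u : Eucl n → ℝ} (hu : MemH1 u) (c : ℝ) :
    MemH1 fun x => c * u x :=
  ⟨hu.1.const_mul c, _, hu.weakGradient_spec.1.const_smul c, hu.weakGradient_spec.2.const_mul c⟩

lemma gradSq_const_mul {n : ℕ} {u : Eucl n → ℝ} (hu : MemH1 u) (c : ℝ) :
    gradSq (fun x => c * u x) = c ^ 2 * gradSq u := by
  rw [gradSq_eq (hu.weakGradient_spec.1.const_smul c) (hu.weakGradient_spec.2.const_mul c), gradSq,
    ← integral_const_mul]
  congr with x
  rw [Pi.smul_apply, norm_smul, mul_pow, Real.norm_eq_abs, sq_abs]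

lemma mass_const_mul {n : ℕ} (u : Eucl n → ℝ) (c : ℝ) :
    mass (fun x => c * u x) = c ^ 2 * mass u := by
  rw [mass, mass, ← integral_const_mul]
  congr with x
  rw [abs_mul, mul_pow, sq_abs c]

lemma integrable_inner_of_memLp {n : ℕ} {G H : Eucl n → Eucl n}
    (hG : MemLp G 2 volume) (hH : MemLp H 2 volume) : Integrable fun x => inner ℝ (G x) (H x) := by
  refine (((memLp_two_iff_integrable_sq_norm hG.1).1 hG).add
    ((memLp_two_iff_integrable_sq_norm hH.1).1 hH)).mono' (hG.1.inner hH.1)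
    (Eventually.of_forall fun x => ?_)
  have := abs_real_inner_le_norm (G x) (H x)
  rw [Real.norm_eq_abs, Pi.add_apply]
  nlinarith [sq_nonneg (‖G x‖ - ‖H x‖), sq_nonneg (‖G x‖), sq_nonneg (‖H x‖)]

lemma integral_quadratic {n : ℕ} {f g h : Eucl n → ℝ} (hf : Integrable f) (hg : Integrable g)
    (hh : Integrable h) (t : ℝ) : ∫ x, (f x + 2 * t * g x + t ^ 2 * h x) =
      (∫ x, f x) + 2 * t * (∫ x, g x) + t ^ 2 * ∫ x, h x := by
  have i1 : Integrable fun x => f x + 2 * t * g x := hf.add (hg.const_mul _)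
  rw [integral_add i1 (hh.const_mul _), integral_add hf (hg.const_mul _), integral_const_mul,
    integral_const_mul]

/-- The inner product `∫ ∇u · ∇v`. -/
def gradInner {n : ℕ} (u v : Eucl n → ℝ) : ℝ :=
  ∫ x, inner ℝ (weakGradient u x) (weakGradient v x)

lemma gradSq_add_mul {n : ℕ} {u v : Eucl n → ℝ} (hu : MemH1 u) (hv : MemH1 v) (t : ℝ) :
    gradSq (fun x => u x + t * v x) = gradSq u + 2 * t * gradInner u v + t ^ 2 * gradSq v := by
  have hG := hu.weakGradient_spec
  have hH := hv.weakGradient_spec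
  rw [gradSq_eq (hG.1.add (hH.1.const_smul t)) (IsWeakGradient.add hu.1 (hv.1.const_mul t) hG.1
    (hH.1.const_smul t) hG.2 (hH.2.const_mul t))]
  have i1 := (memLp_two_iff_integrable_sq_norm hG.1.1).1 hG.1
  have i2 := (memLp_two_iff_integrable_sq_norm hH.1.1).1 hH.1
  have i3 := integrable_inner_of_memLp hG.1 hH.1
  rw [gradSq, gradSq, gradInner, ← integral_quadratic i1 i3 i2]
  congr with x
  simp only [Pi.add_apply, Pi.smul_apply]
  rw [norm_add_sq_real, norm_smul, real_inner_smul_right, mul_pow, Real.norm_eq_abs, sq_abs]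
  ring

lemma integrable_sq_of_memLp {n : ℕ} {u : Eucl n → ℝ} (hu : MemLp u 2 volume) :
    Integrable fun x => |u x| ^ 2 := by
  have := (memLp_two_iff_integrable_sq_norm hu.1).1 hu
  simpa using this

lemma integrable_mul_of_memLp {n : ℕ} {u v : Eucl n → ℝ} (hu : MemLp u 2 volume)
    (hv : MemLp v 2 volume) : Integrable fun x => u x * v x :=
  MemLp.integrable_mul hu hv

lemma mass_add_mul {n : ℕ} {u v : Eucl n → ℝ} (hu : MemLp u 2 volume) (hv : MemLp v 2 volume)
    (t : ℝ) : mass (fun x => u x + t * v x) =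
      mass u + 2 * t * (∫ x, u x * v x) + t ^ 2 * mass v := by
  have i1 := integrable_sq_of_memLp hu
  have i2 := integrable_sq_of_memLp hv
  have i3 := integrable_mul_of_memLp hu hv
  rw [mass, mass, mass, ← integral_quadratic i1 i3 i2]
  congr with x
  simp only [sq_abs]
  ring

lemma memLp_of_bounded_compactSupport {n : ℕ} {E : Type*} [NormedAddCommGroup E]
    {f : Eucl n → E} (hf : AEStronglyMeasurable f volume) {s : Set (Eucl n)} (hs : IsCompact s)
    {C : ℝ} (hC : ∀ x, ‖f x‖ ≤ C) (h0 : ∀ x ∉ s, f x = 0) (p : ℝ≥0∞) : MemLp f p volume := by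
  refine (memLp_indicator_const p hs.measurableSet C (Or.inr hs.measure_lt_top.ne)).mono hf
    (Eventually.of_forall fun x => ?_)
  by_cases hx : x ∈ s
  · rw [indicator_of_mem hx]
    exact (hC x).trans (Real.le_norm_self C)
  · rw [h0 x hx]
    simp

/-- A Lipschitz function of compact support lies in `H^1`; its pointwise gradient, which exists
almost everywhere, is its weak gradient. -/
lemma isWeakGradient_of_lipschitz {n : ℕ} {u : Eucl n → ℝ} {C : NNReal} (hu : LipschitzWith C u)
    (hc : HasCompactSupport u) :
    MemLp u 2 volume ∧ MemLp (∇ u) 2 volume ∧ IsWeakGradient u (∇ u) := by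
  have hbd : ∀ x, ‖∇ u x‖ ≤ C := fun x => by
    have : ‖∇ u x‖ = ‖fderiv ℝ u x‖ := by simp [gradient]
    rw [this]
    exact norm_fderiv_le_of_lipschitz ℝ hu
  have hmeas : Measurable (∇ u) :=
    (LinearIsometryEquiv.continuous _).measurable.comp (measurable_fderiv ℝ u)
  have hL2 : MemLp u 2 volume := hu.continuous.memLp_of_hasCompactSupport hc
  have hG : MemLp (∇ u) 2 volume :=
    memLp_of_bounded_compactSupport hmeas.aestronglyMeasurable (s := tsupport u) hc hbd
      (fun x hx => by
        have : fderiv ℝ u x = 0 := by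
          by_contra h
          exact hx (support_fderiv_subset ℝ h)
        simp [gradient, this]) 2
  refine ⟨hL2, hG, fun φ hφ hφc => ?_⟩
  refine ext_inner_left ℝ fun v => ?_
  rw [inner_neg_right, ← integral_inner (integrable_smul_gradient hL2 hφ hφc),
    ← integral_inner (integrable_smul_field hG hφ hφc)]
  obtain ⟨D, hD⟩ := ContDiff.lipschitzWith_of_hasCompactSupport (𝕂 := ℝ) (n := ∞) hφc hφ (by simp)
  have key := LipschitzWith.integral_lineDeriv_mul_eq (μ := volume) hu hD hφc v
  have e1 : ∫ x, inner ℝ v (φ x • ∇ u x) = ∫ x, lineDeriv ℝ u x v * φ x := by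
    refine integral_congr_ae ?_
    filter_upwards [hu.ae_differentiableAt] with x hx
    rw [hx.lineDeriv_eq_fderiv, inner_smul_right, real_inner_comm]
    simp [gradient, mul_comm]
  have e2 : ∫ x, inner ℝ v (u x • ∇ φ x) = -∫ x, lineDeriv ℝ φ x (-v) * u x := by
    rw [← integral_neg]
    congr with x
    rw [((hφ.differentiable (by simp)) x).lineDeriv_eq_fderiv, inner_smul_right, real_inner_comm]
    simp [gradient, mul_comm]
  rw [e1, e2, key]

lemma memH1_of_lipschitz {n : ℕ} {u : Eucl n → ℝ} {C : NNReal} (hu : LipschitzWith C u)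
    (hc : HasCompactSupport u) : MemH1 u :=
  ⟨(isWeakGradient_of_lipschitz hu hc).1, _, (isWeakGradient_of_lipschitz hu hc).2⟩

lemma gradSq_of_lipschitz {n : ℕ} {u : Eucl n → ℝ} {C : NNReal} (hu : LipschitzWith C u)
    (hc : HasCompactSupport u) : gradSq u = ∫ x, ‖∇ u x‖ ^ 2 :=
  gradSq_eq (isWeakGradient_of_lipschitz hu hc).2.1 (isWeakGradient_of_lipschitz hu hc).2.2

/-! ### The Sobolev inequality in `H^1` -/

lemma norm_gradient_eq_norm_fderiv {n : ℕ} (u : Eucl n → ℝ) (x : Eucl n) :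
    ‖∇ u x‖ = ‖fderiv ℝ u x‖ := by simp [gradient]

lemma critExp_pos {n : ℕ} (hn : 3 ≤ n) : 0 < critExp n := by
  have hn3 : (3 : ℝ) ≤ n := by exact_mod_cast hn
  exact div_pos (by linarith) (by linarith)

lemma two_lt_critExp {n : ℕ} (hn : 3 ≤ n) : 2 < critExp n := by
  have hn3 : (3 : ℝ) ≤ n := by exact_mod_cast hn
  rw [critExp, lt_div_iff₀ (by linarith)]
  linarith

/-- The Sobolev inequality `κ ‖u‖_{2^*}^2 ≤ X`, for the constant `κ` of the bubble, solved for
the integral of `|u|^{2^*}`; no integrability is presupposed. -/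
def SobolevBound {n : ℕ} (u : Eucl n → ℝ) (X : ℝ) : Prop :=
  ∫⁻ x, ENNReal.ofReal (|u x| ^ critExp n) ≤
    ENNReal.ofReal ((X / bubbleEnergy n ^ (2 / (n : ℝ))) ^ (critExp n / 2))

lemma sobolevBound_of_test {n : ℕ} (hn : 3 ≤ n) {φ : Eucl n → ℝ} (hφ : ContDiff ℝ ∞ φ)
    (hc : HasCompactSupport φ) {X : ℝ} (hX : ∫ x, ‖∇ φ x‖ ^ 2 ≤ X) : SobolevBound φ X := by
  have hce := critExp_pos hn
  have hK : 0 < bubbleEnergy n ^ (2 / (n : ℝ)) := Real.rpow_pos_of_pos (bubbleEnergy_pos hn) _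
  have hint : Integrable fun x => |φ x| ^ critExp n :=
    (hφ.continuous.abs.rpow_const fun _ => Or.inr hce.le).integrable_of_hasCompactSupport
      (hc.comp_left (g := fun r => |r| ^ critExp n) (by simp [Real.zero_rpow hce.ne']))
  rw [SobolevBound, ← ofReal_integral_eq_lintegral_ofReal hint
    (Eventually.of_forall fun x => by positivity)]
  refine ENNReal.ofReal_le_ofReal ?_
  have h1 := (sharp_sobolev hn hφ hc).trans hX
  rw [← le_div_iff₀' hK] at h1
  have hI : 0 ≤ ∫ x, |φ x| ^ critExp n := integral_nonneg fun x => by positivity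
  calc ∫ x, |φ x| ^ critExp n = ((∫ x, |φ x| ^ critExp n) ^ (2 / critExp n)) ^ (critExp n / 2) := by
        rw [← Real.rpow_mul hI, div_mul_div_cancel₀ hce.ne', div_self two_ne_zero, Real.rpow_one]
    _ ≤ _ := Real.rpow_le_rpow (Real.rpow_nonneg hI _) h1 (by positivity)

/-- The Sobolev bound passes to limits almost everywhere, by Fatou's lemma. -/
lemma SobolevBound.of_tendsto {n : ℕ} (hn : 3 ≤ n) {u : ℕ → Eucl n → ℝ} {v : Eucl n → ℝ}
    {X : ℕ → ℝ} {Y : ℝ} (hu : ∀ k, Continuous (u k)) (hb : ∀ k, SobolevBound (u k) (X k))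
    (hX : Tendsto X atTop (nhds Y))
    (hlim : ∀ᵐ x, Tendsto (fun k => u k x) atTop (nhds (v x))) : SobolevBound v Y := by
  have hce := critExp_pos hn
  have h1 : ∫⁻ x, ENNReal.ofReal (|v x| ^ critExp n) ≤
      ∫⁻ x, liminf (fun k => ENNReal.ofReal (|u k x| ^ critExp n)) atTop := by
    refine lintegral_mono_ae ?_
    filter_upwards [hlim] with x hx
    refine le_of_eq (Tendsto.liminf_eq ?_).symm
    exact ENNReal.tendsto_ofReal (hx.abs.rpow_const (Or.inr hce.le))
  have h2 : Tendsto (fun k => ENNReal.ofReal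
      ((X k / bubbleEnergy n ^ (2 / (n : ℝ))) ^ (critExp n / 2))) atTop (nhds (ENNReal.ofReal
      ((Y / bubbleEnergy n ^ (2 / (n : ℝ))) ^ (critExp n / 2)))) :=
    ENNReal.tendsto_ofReal ((hX.div_const _).rpow_const (Or.inr (by positivity)))
  refine h1.trans ((lintegral_liminf_le fun k => ?_).trans ?_)
  · exact ((hu k).abs.measurable.pow_const _).ennreal_ofReal
  · rw [← h2.liminf_eq]
    exact liminf_le_liminf (Eventually.of_forall hb)

/-- Truncation of a smooth function by the cut-off functions `χ(x / (k+1))`. -/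
lemma sobolevBound_of_smooth {n : ℕ} (hn : 3 ≤ n) {u : Eucl n → ℝ} (hu : ContDiff ℝ ∞ u)
    (hu2 : Integrable fun x => u x ^ 2) {X : ℝ} (hG : Integrable fun x => ‖∇ u x‖ ^ 2)
    (hX : ∫ x, ‖∇ u x‖ ^ 2 ≤ X) : SobolevBound u X := by
  let f : ContDiffBump (0 : Eucl n) := ⟨1, 2, one_pos, one_lt_two⟩
  obtain ⟨C, hC⟩ := ContDiff.lipschitzWith_of_hasCompactSupport (𝕂 := ℝ) (n := ∞)
    f.hasCompactSupport f.contDiff (by simp)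
  set s : ℕ → ℝ := fun k => 1 / ((k : ℝ) + 1) with hs
  have hs0 : ∀ k, 0 < s k := fun k => by positivity
  have hslim : Tendsto s atTop (nhds 0) := tendsto_one_div_add_atTop_nhds_zero_nat
  set χ : ℕ → Eucl n → ℝ := fun k x => f (s k • x) with hχ
  have hχsm : ∀ k, ContDiff ℝ ∞ (χ k) := fun k => f.contDiff.comp (contDiff_const_smul (s k))
  have hχc : ∀ k, HasCompactSupport (χ k) := fun k =>
    f.hasCompactSupport.comp_homeomorph (Homeomorph.smulOfNeZero (s k) (hs0 k).ne')
  have hχd : ∀ k x, ‖fderiv ℝ (χ k) x‖ ≤ C * s k := by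
    intro k x
    have hlip : LipschitzWith (C * (s k).toNNReal) (χ k) := by
      refine LipschitzWith.of_dist_le_mul fun x y => (hC.dist_le_mul _ _).trans (le_of_eq ?_)
      rw [dist_smul₀, Real.norm_of_nonneg (hs0 k).le, NNReal.coe_mul,
        Real.coe_toNNReal _ (hs0 k).le, mul_assoc]
    refine (norm_fderiv_le_of_lipschitz ℝ hlip).trans (le_of_eq ?_)
    rw [NNReal.coe_mul, Real.coe_toNNReal _ (hs0 k).le]
  have hpt : ∀ k x, ‖∇ (fun y => χ k y * u y) x‖ ^ 2 ≤
      (1 + s k) * ‖∇ u x‖ ^ 2 + (1 + (s k)⁻¹) * (C * s k) ^ 2 * u x ^ 2 := by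
    intro k x
    rw [norm_gradient_eq_norm_fderiv, norm_gradient_eq_norm_fderiv,
      fderiv_fun_mul ((hχsm k).differentiable (by simp) x) (hu.differentiable (by simp) x)]
    set a := ‖fderiv ℝ u x‖ with ha
    set b := C * s k * |u x| with hb
    have hb0 : 0 ≤ b := mul_nonneg (mul_nonneg C.2 (hs0 k).le) (abs_nonneg _)
    have h1 : ‖χ k x • fderiv ℝ u x + u x • fderiv ℝ (χ k) x‖ ≤ a + b := by
      refine (norm_add_le _ _).trans (add_le_add ?_ ?_)
      · rw [norm_smul, Real.norm_of_nonneg f.nonneg]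
        exact mul_le_of_le_one_left (norm_nonneg _) f.le_one
      · rw [norm_smul, Real.norm_eq_abs, mul_comm]
        exact mul_le_mul_of_nonneg_right (hχd k x) (abs_nonneg _)
    have h2 : (C * s k) ^ 2 * u x ^ 2 = b ^ 2 := by rw [hb, mul_pow _ |u x|, sq_abs]
    have h3 : 2 * a * b ≤ s k * a ^ 2 + (s k)⁻¹ * b ^ 2 := by
      have h4 : s k * a ^ 2 + (s k)⁻¹ * b ^ 2 - 2 * a * b = s k * (a - (s k)⁻¹ * b) ^ 2 := by
        have := (hs0 k).ne'
        field_simp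
        ring
      have := mul_nonneg (hs0 k).le (sq_nonneg (a - (s k)⁻¹ * b))
      linarith
    rw [mul_assoc, h2]
    calc _ ≤ (a + b) ^ 2 := by gcongr
      _ ≤ _ := by nlinarith
  set A := ∫ x, u x ^ 2 with hA
  have hb : ∀ k, SobolevBound (fun x => χ k x * u x) ((1 + s k) * X + (s k ^ 2 + s k) * (C ^ 2 * A)) := by
    intro k
    refine sobolevBound_of_test hn ((hχsm k).mul hu) ((hχc k).mul_right) ?_
    refine (integral_mono_of_nonneg (Eventually.of_forall fun x => sq_nonneg _)
      ((hG.const_mul (1 + s k)).add (hu2.const_mul ((1 + (s k)⁻¹) * (C * s k) ^ 2)))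
      (Eventually.of_forall (hpt k))).trans ?_
    simp only [Pi.add_apply]
    rw [integral_add (hG.const_mul _) (hu2.const_mul _), integral_const_mul, integral_const_mul]
    have e1 : (1 + (s k)⁻¹) * (C * s k) ^ 2 = (s k ^ 2 + s k) * C ^ 2 := by
      have := (hs0 k).ne'
      field_simp
    rw [e1, ← mul_assoc]
    have := mul_le_mul_of_nonneg_left hX (show 0 ≤ 1 + s k by linarith [hs0 k])
    linarith
  refine SobolevBound.of_tendsto hn (fun k => ((hχsm k).continuous.mul hu.continuous)) hb ?_
    (Eventually.of_forall fun x => ?_)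
  · have : Tendsto (fun k => (1 + s k) * X + (s k ^ 2 + s k) * (C ^ 2 * A)) atTop
        (nhds ((1 + 0) * X + (0 ^ 2 + 0) * (C ^ 2 * A))) :=
      ((hslim.const_add 1).mul_const X).add (((hslim.pow 2).add hslim).mul_const _)
    simpa using this
  · have h1 : Tendsto (fun k => χ k x) atTop (nhds (f (0 : Eucl n))) := by
      have h2 : Tendsto (fun k => s k • x) atTop (nhds ((0 : ℝ) • x)) := hslim.smul_const x
      rw [zero_smul] at h2
      exact (f.continuous.tendsto 0).comp h2
    rw [f.one_of_mem_closedBall (by simp [f])] at h1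
    simpa using h1.mul_const (u x)

/-- Convolution with a probability density does not increase the `L^2` norm. -/
lemma lintegral_convolution_sq_le {n : ℕ} {E : Type*} [NormedAddCommGroup E] [NormedSpace ℝ E]
    {ρ : Eucl n → ℝ} (hρ : Continuous ρ) (hρ0 : ∀ x, 0 ≤ ρ x) (hρi : Integrable ρ)
    (hρ1 : ∫ x, ρ x = 1) {G : Eucl n → E} (hG : AEStronglyMeasurable G volume) :
    ∫⁻ x, ‖∫ y, ρ (x - y) • G y‖ₑ ^ 2 ≤ ∫⁻ x, ‖G x‖ₑ ^ 2 := by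
  have hρl : ∫⁻ x, ENNReal.ofReal (ρ x) = 1 := by
    rw [← ofReal_integral_eq_lintegral_ofReal hρi (Eventually.of_forall hρ0), hρ1]; simp
  have h1 : ∀ x, ‖∫ y, ρ (x - y) • G y‖ₑ ^ 2 ≤
      ∫⁻ y, ENNReal.ofReal (ρ (x - y)) * ‖G y‖ₑ ^ 2 := by
    intro x
    have h2 : ‖∫ y, ρ (x - y) • G y‖ₑ ≤ ∫⁻ y, ENNReal.ofReal (ρ (x - y)) * ‖G y‖ₑ := by
      refine (enorm_integral_le_lintegral_enorm _).trans (le_of_eq ?_)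
      congr with y
      rw [enorm_smul, Real.enorm_eq_ofReal (hρ0 _)]
    -- Hölder's inequality for the measure of density `ρ (x - y)`
    have h3 : ∫⁻ y, ENNReal.ofReal (ρ (x - y)) * ‖G y‖ₑ ≤
        (∫⁻ y, ENNReal.ofReal (ρ (x - y))) ^ (1 / 2 : ℝ) *
        (∫⁻ y, ENNReal.ofReal (ρ (x - y)) * ‖G y‖ₑ ^ 2) ^ (1 / 2 : ℝ) := by
      refine le_trans (le_of_eq ?_) (ENNReal.lintegral_mul_norm_pow_le
        (f := fun y => ENNReal.ofReal (ρ (x - y)))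
        (g := fun y => ENNReal.ofReal (ρ (x - y)) * ‖G y‖ₑ ^ 2) (by fun_prop)
        (AEMeasurable.mul (by fun_prop) (hG.enorm.pow_const 2)) (by norm_num) (by norm_num)
        (by norm_num))
      congr with y
      rw [ENNReal.mul_rpow_of_nonneg _ _ (by norm_num), ← mul_assoc,
        ← ENNReal.rpow_add_of_nonneg _ _ (by norm_num) (by norm_num), ← ENNReal.rpow_natCast,
        ← ENNReal.rpow_mul]
      norm_num
    have h4 : ∫⁻ y, ENNReal.ofReal (ρ (x - y)) = 1 := by
      rw [lintegral_sub_left_eq_self (fun y => ENNReal.ofReal (ρ y)) x, hρl]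
    rw [h4, ENNReal.one_rpow, one_mul] at h3
    calc _ ≤ ((∫⁻ y, ENNReal.ofReal (ρ (x - y)) * ‖G y‖ₑ ^ 2) ^ (1 / 2 : ℝ)) ^ 2 := by
          gcongr
          exact h2.trans h3
      _ = _ := by
        rw [← ENNReal.rpow_natCast, ← ENNReal.rpow_mul]
        norm_num
  calc _ ≤ ∫⁻ x, ∫⁻ y, ENNReal.ofReal (ρ (x - y)) * ‖G y‖ₑ ^ 2 := lintegral_mono h1
    _ = ∫⁻ y, ∫⁻ x, ENNReal.ofReal (ρ (x - y)) * ‖G y‖ₑ ^ 2 := by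
      refine lintegral_lintegral_swap ?_
      have m1 : Measurable fun p : Eucl n × Eucl n => ENNReal.ofReal (ρ (p.1 - p.2)) := by fun_prop
      exact m1.aemeasurable.mul (hG.enorm.comp_snd.pow_const 2)
    _ = ∫⁻ y, ‖G y‖ₑ ^ 2 := by
      congr with y
      rw [lintegral_mul_const _ (by fun_prop), lintegral_sub_right_eq_self
        (fun x => ENNReal.ofReal (ρ x)) y, hρl, one_mul]

lemma lintegral_ofReal_norm_sq {n : ℕ} {E : Type*} [NormedAddCommGroup E] (f : Eucl n → E) :
    ∫⁻ x, ENNReal.ofReal (‖f x‖ ^ 2) = ∫⁻ x, ‖f x‖ₑ ^ 2 := by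
  congr with x
  rw [ENNReal.ofReal_pow (norm_nonneg _), ofReal_norm]

lemma integrable_sq_of_lintegral_le {n : ℕ} {E F : Type*} [NormedAddCommGroup E]
    [NormedAddCommGroup F] {G : Eucl n → E} {H : Eucl n → F} (hH : MemLp H 2 volume)
    (hG : AEStronglyMeasurable G volume) (h : ∫⁻ x, ‖G x‖ₑ ^ 2 ≤ ∫⁻ x, ‖H x‖ₑ ^ 2) :
    Integrable (fun x => ‖G x‖ ^ 2) ∧ ∫ x, ‖G x‖ ^ 2 ≤ ∫ x, ‖H x‖ ^ 2 := by
  have hH' := (memLp_two_iff_integrable_sq_norm hH.1).1 hH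
  have e1 := ofReal_integral_eq_lintegral_ofReal hH' (Eventually.of_forall fun x => sq_nonneg _)
  rw [lintegral_ofReal_norm_sq] at e1
  rw [← e1] at h
  have hi : Integrable (fun x => ‖G x‖ ^ 2) := by
    refine ⟨(hG.norm.pow 2), ?_⟩
    rw [hasFiniteIntegral_iff_ofReal (Eventually.of_forall fun x => sq_nonneg _),
      lintegral_ofReal_norm_sq]
    exact h.trans_lt ENNReal.ofReal_lt_top
  refine ⟨hi, ?_⟩
  rw [← lintegral_ofReal_norm_sq, ← ofReal_integral_eq_lintegral_ofReal hi
    (Eventually.of_forall fun x => sq_nonneg _)] at h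
  exact (ENNReal.ofReal_le_ofReal_iff (integral_nonneg fun x => sq_nonneg _)).1 h

/-- The gradient of the mollification of `u` is the mollification of its weak gradient. -/
lemma gradient_convolution {n : ℕ} {u ρ : Eucl n → ℝ} {G : Eucl n → Eucl n} (hu : MemLp u 2 volume)
    (h : IsWeakGradient u G) (hρ : ContDiff ℝ ∞ ρ) (hc : HasCompactSupport ρ) (x : Eucl n) :
    ∇ (convolution ρ u (ContinuousLinearMap.lsmul ℝ ℝ) volume) x = ∫ y, ρ (x - y) • G y := by
  have hul := hu.locallyIntegrable (by norm_num)
  have h1 := (hc.hasFDerivAt_convolution_left (μ := volume) (ContinuousLinearMap.lsmul ℝ ℝ)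
    (hρ.of_le (by simp)) hul x)
  set φ : Eucl n → ℝ := fun y => ρ (x - y) with hφ
  have hφsm : ContDiff ℝ ∞ φ := hρ.comp (contDiff_const.sub contDiff_id)
  have hφc : HasCompactSupport φ := hc.comp_homeomorph (Homeomorph.subLeft x)
  have h2 := h φ hφsm hφc
  have h3 : ∀ y, ∇ φ y = -∇ ρ (x - y) := by
    intro y
    have h4 : HasFDerivAt φ (-(fderiv ℝ ρ (x - y))) y := by
      refine (((hρ.differentiable (by simp) (x - y)).hasFDerivAt).comp y
        ((hasFDerivAt_id y).const_sub x)).congr_fderiv ?_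
      ext
      simp
    simp [gradient, h4.fderiv]
  rw [← neg_eq_iff_eq_neg] at h2
  rw [← h2, ← integral_neg]
  refine ext_inner_right ℝ fun v => ?_
  have hi : Integrable fun y => -(u y • ∇ φ y) := (integrable_smul_gradient hu hφsm hφc).neg
  rw [real_inner_comm, real_inner_comm v, ← integral_inner hi]
  have h5 : inner ℝ (∇ (convolution ρ u (ContinuousLinearMap.lsmul ℝ ℝ) volume) x) v =
      fderiv ℝ (convolution ρ u (ContinuousLinearMap.lsmul ℝ ℝ) volume) x v := by
    simp [gradient]
  have h6 := ((hc.fderiv ℝ).convolutionExists_left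
    (ContinuousLinearMap.precompL (Eucl n) (ContinuousLinearMap.lsmul ℝ ℝ)) (μ := volume)
    (hρ.continuous_fderiv (by simp)) hul x).integrable_swap
  rw [real_inner_comm, h5, h1.fderiv, convolution_eq_swap, ContinuousLinearMap.integral_apply h6]
  congr with y
  rw [h3, inner_neg_right, real_inner_smul_right, real_inner_comm]
  simp [gradient, mul_comm]

/-- The Sobolev inequality in `H^1`, with the constant of the bubble: mollify, truncate and pass
to the limit by Fatou's lemma. -/
theorem sobolevBound_of_memH1 {n : ℕ} (hn : 3 ≤ n) {u : Eucl n → ℝ} (hu : MemH1 u) :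
    SobolevBound u (gradSq u) := by
  obtain ⟨hG, hw⟩ := hu.weakGradient_spec
  let f : ℕ → ContDiffBump (0 : Eucl n) := fun k => ⟨1 / ((k : ℝ) + 1), 2 * (1 / ((k : ℝ) + 1)),
    by positivity, by
      have : 0 < 1 / ((k : ℝ) + 1) := by positivity
      linarith⟩
  have hlim := ContDiffBump.ae_convolution_tendsto_right_of_locallyIntegrable (μ := volume)
    (φ := f) (l := atTop) (K := 2) (g := u)
    (by simpa [f] using tendsto_one_div_add_atTop_nhds_zero_nat.const_mul (2 : ℝ))
    (Eventually.of_forall fun k => le_rfl) (hu.1.locallyIntegrable (by norm_num))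
  set ρ : ℕ → Eucl n → ℝ := fun k => (f k).normed volume with hρ
  have hρsm : ∀ k, ContDiff ℝ ∞ (ρ k) := fun k => (f k).contDiff_normed
  have hρc : ∀ k, HasCompactSupport (ρ k) := fun k => (f k).hasCompactSupport_normed
  set v : ℕ → Eucl n → ℝ := fun k =>
    convolution (ρ k) u (ContinuousLinearMap.lsmul ℝ ℝ) volume with hv
  have hvsm : ∀ k, ContDiff ℝ ∞ (v k) := fun k =>
    (hρc k).contDiff_convolution_left _ (hρsm k) (hu.1.locallyIntegrable (by norm_num))
  have hconv : ∀ k, ∀ {E : Type} [NormedAddCommGroup E] [NormedSpace ℝ E] {G : Eucl n → E},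
      AEStronglyMeasurable G volume →
      ∫⁻ x, ‖∫ y, ρ k (x - y) • G y‖ₑ ^ 2 ≤ ∫⁻ x, ‖G x‖ₑ ^ 2 := fun k _ _ _ _ hG =>
    lintegral_convolution_sq_le (hρsm k).continuous (fun x => (f k).nonneg_normed x)
      (f k).integrable_normed (f k).integral_normed hG
  refine SobolevBound.of_tendsto hn (fun k => (hvsm k).continuous) (X := fun _ => gradSq u)
    (fun k => ?_) tendsto_const_nhds hlim
  have hv1 : ∀ x, v k x = ∫ y, ρ k (x - y) • u y := fun x => by
    simp only [hv]
    rw [convolution_eq_swap]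
    rfl
  have hv2 : ∀ x, ∇ (v k) x = ∫ y, ρ k (x - y) • weakGradient u y :=
    gradient_convolution hu.1 hw (hρsm k) (hρc k)
  have i1 := integrable_sq_of_lintegral_le hu.1 (hvsm k).continuous.aestronglyMeasurable (by
    simp_rw [hv1]
    exact hconv k hu.1.1)
  have i2 := integrable_sq_of_lintegral_le hG
    (continuous_gradient (hvsm k)).aestronglyMeasurable (by
    simp_rw [hv2]
    exact hconv k hG.1)
  exact sobolevBound_of_smooth hn (hvsm k) (by simpa using i1.1) i2.1 i2.2

/-- Functions of `H^1` lie in `L^{2^*}`, with the Sobolev inequality. -/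
lemma integrable_critExp_of_memH1 {n : ℕ} (hn : 3 ≤ n) {u : Eucl n → ℝ} (hu : MemH1 u) :
    Integrable (fun x => |u x| ^ critExp n) ∧ ∫ x, |u x| ^ critExp n ≤
      (gradSq u / bubbleEnergy n ^ (2 / (n : ℝ))) ^ (critExp n / 2) := by
  have h := sobolevBound_of_memH1 hn hu
  rw [SobolevBound] at h
  have hi : Integrable fun x => |u x| ^ critExp n := by
    refine ⟨(hu.1.1.norm.aemeasurable.pow_const _).aestronglyMeasurable, ?_⟩
    rw [hasFiniteIntegral_iff_ofReal (Eventually.of_forall fun x => by positivity)]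
    exact h.trans_lt ENNReal.ofReal_lt_top
  refine ⟨hi, ?_⟩
  rw [← ofReal_integral_eq_lintegral_ofReal hi (Eventually.of_forall fun x => by positivity)] at h
  exact (ENNReal.ofReal_le_ofReal_iff (Real.rpow_nonneg (div_nonneg (gradSq_nonneg u)
    (Real.rpow_nonneg (bubbleEnergy_pos hn).le _)) _)).1 h

/-! ### Gagliardo-Nirenberg interpolation and the geometry of the energy -/

lemma lt_critExp_of_lt {n : ℕ} (hn : 3 ≤ n) {p : ℝ} (hp' : p < 2 + 4 / (n : ℝ)) :
    p < critExp n := by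
  have hn3 : (3 : ℝ) ≤ n := by exact_mod_cast hn
  refine hp'.trans ?_
  rw [critExp, ← sub_pos]
  have : 2 * (n : ℝ) / (n - 2) - (2 + 4 / n) = 8 / (n * (n - 2)) := by
    have h1 : (n : ℝ) - 2 ≠ 0 := by linarith
    have h2 : (n : ℝ) ≠ 0 := by linarith
    field_simp
    ring
  rw [this]
  have : 0 < (n : ℝ) - 2 := by linarith
  positivity

lemma integrable_rpow_of_memH1 {n : ℕ} (hn : 3 ≤ n) {u : Eucl n → ℝ} (hu : MemH1 u) {r : ℝ}
    (hr : 2 ≤ r) (hr' : r ≤ critExp n) : Integrable fun x => |u x| ^ r := by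
  refine ((integrable_sq_of_memLp hu.1).add (integrable_critExp_of_memH1 hn hu).1).mono'
    (hu.1.1.norm.aemeasurable.pow_const _).aestronglyMeasurable (Eventually.of_forall fun x => ?_)
  rw [Real.norm_of_nonneg (by positivity), Pi.add_apply]
  have hc : 0 ≤ |u x| ^ critExp n := by positivity
  rcases le_total 1 |u x| with h | h
  · have := Real.rpow_le_rpow_of_exponent_le h hr'
    nlinarith [sq_nonneg |u x|]
  · rcases eq_or_lt_of_le (abs_nonneg (u x)) with h0 | h0
    · rw [← h0, Real.zero_rpow (by linarith)]
      rw [← h0] at hc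
      positivity
    · have := Real.rpow_le_rpow_of_exponent_ge h0 h hr
      rw [Real.rpow_two] at this
      linarith

/-- Interpolation between `L^2` and `L^{2^*}`. -/
lemma integral_rpow_le_interpolation {n : ℕ} (hn : 3 ≤ n) {u : Eucl n → ℝ} (hu : MemH1 u)
    {p l M Y : ℝ} (hl : 0 ≤ l) (hl1 : l ≤ 1) (hpl : p = 2 * (1 - l) + critExp n * l)
    (hM : 0 < M) (hY : 0 < Y) (huM : mass u ≤ M) (huY : ∫ x, |u x| ^ critExp n ≤ Y) :
    ∫ x, |u x| ^ p ≤ M ^ (1 - l) * Y ^ l := by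
  have hc := two_lt_critExp hn
  have i1 := integrable_sq_of_memLp hu.1
  have i2 := (integrable_critExp_of_memH1 hn hu).1
  have hD : 0 < M ^ (1 - l) * Y ^ l := by positivity
  have hpt : ∀ x, |u x| ^ p ≤ M ^ (1 - l) * Y ^ l *
      ((1 - l) / M * |u x| ^ 2 + l / Y * |u x| ^ critExp n) := by
    intro x
    have h := Real.geom_mean_le_arith_mean2_weighted (w₁ := 1 - l) (w₂ := l)
      (p₁ := |u x| ^ 2 / M) (p₂ := |u x| ^ critExp n / Y) (by linarith) hl (by positivity)
      (by positivity) (by ring)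
    rw [Real.div_rpow (by positivity) hM.le, Real.div_rpow (by positivity) hY.le,
      ← Real.rpow_natCast, ← Real.rpow_mul (abs_nonneg _), ← Real.rpow_mul (abs_nonneg _),
      div_mul_div_comm, ← Real.rpow_add' (abs_nonneg _)] at h
    · rw [div_le_iff₀ hD] at h
      rw [hpl]
      push_cast at h
      refine h.trans (le_of_eq ?_)
      rw [← Real.rpow_natCast]
      push_cast
      ring
    · push_cast
      nlinarith
  refine (integral_mono_of_nonneg (Eventually.of_forall fun x => by positivity)
    (((i1.const_mul ((1 - l) / M)).add (i2.const_mul (l / Y))).const_mul _)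
    (Eventually.of_forall hpt)).trans ?_
  simp only [Pi.add_apply]
  rw [integral_const_mul, integral_add (i1.const_mul _) (i2.const_mul _), integral_const_mul,
    integral_const_mul]
  refine mul_le_of_le_one_right hD.le ?_
  have h1 : (1 - l) / M * (∫ x, |u x| ^ 2) ≤ 1 - l := by
    rw [div_mul_eq_mul_div, div_le_iff₀ hM]
    exact mul_le_mul_of_nonneg_left huM (by linarith)
  have h2 : l / Y * (∫ x, |u x| ^ critExp n) ≤ l := by
    rw [div_mul_eq_mul_div, div_le_iff₀ hY]
    exact mul_le_mul_of_nonneg_left huY hl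
  linarith

/-- The Gagliardo-Nirenberg inequality; in the mass subcritical range `p < 2 + 4/N` the exponent
of `‖∇u‖_2^2` is less than one. -/
lemma exists_gagliardoNirenberg {n : ℕ} (hn : 3 ≤ n) {p a : ℝ} (hp : 2 < p)
    (hp' : p < 2 + 4 / (n : ℝ)) (ha : 0 < a) : ∃ C > 0, ∀ u : Eucl n → ℝ, MemH1 u → mass u ≤ a →
      ∀ Z > 0, gradSq u ≤ Z → ∫ x, |u x| ^ p ≤ C * Z ^ ((n : ℝ) * (p - 2) / 4) := by
  have hn3 : (3 : ℝ) ≤ n := by exact_mod_cast hn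
  have hpc := lt_critExp_of_lt hn hp'
  have hc := two_lt_critExp hn
  have hK : 0 < bubbleEnergy n ^ (2 / (n : ℝ)) := Real.rpow_pos_of_pos (bubbleEnergy_pos hn) _
  set κ := bubbleEnergy n ^ (2 / (n : ℝ)) with hκ
  set l := (p - 2) / (critExp n - 2) with hl
  have hl0 : 0 ≤ l := div_nonneg (by linarith) (by linarith)
  have hl1 : l ≤ 1 := by rw [hl, div_le_one (by linarith)]; linarith
  have hlc : l * (critExp n - 2) = p - 2 := div_mul_cancel₀ _ (by linarith)
  have he : critExp n / 2 * l = (n : ℝ) * (p - 2) / 4 := by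
    rw [hl, critExp]
    have h1 : (n : ℝ) - 2 ≠ 0 := by linarith
    have h3 : 2 * (n : ℝ) / (n - 2) - 2 = 4 / (n - 2) := by
      field_simp
      ring
    rw [h3]
    field_simp
  refine ⟨a ^ (1 - l) * κ ^ (-((n : ℝ) * (p - 2) / 4)), by positivity, fun u hu hm Z hZ hg => ?_⟩
  have h1 := (integrable_critExp_of_memH1 hn hu).2
  have h2 : ∫ x, |u x| ^ critExp n ≤ (Z / κ) ^ (critExp n / 2) :=
    h1.trans (Real.rpow_le_rpow (div_nonneg (gradSq_nonneg u) hK.le) (by gcongr) (by linarith))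
  refine (integral_rpow_le_interpolation hn hu hl0 hl1 (by linarith) ha (by positivity) hm
    h2).trans (le_of_eq ?_)
  rw [← Real.rpow_mul (by positivity), he, Real.div_rpow hZ.le hK.le, Real.rpow_neg hK.le]
  ring

lemma rpow_mul_rpow_le_add {α β c x y : ℝ} (hα : 0 < α) (hβ : 0 < β) (hc : α + β = c)
    (hx : 0 ≤ x) (hy : 0 ≤ y) : x ^ α * y ^ β ≤ x ^ c + y ^ c := by
  rcases le_total x y with h | h
  · have h1 : x ^ α ≤ y ^ α := Real.rpow_le_rpow hx h hα.le
    calc x ^ α * y ^ β ≤ y ^ α * y ^ β := by gcongr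
      _ = y ^ c := by rw [← hc, Real.rpow_add_of_nonneg hy hα.le hβ.le]
      _ ≤ _ := le_add_of_nonneg_left (by positivity)
  · have h1 : y ^ β ≤ x ^ β := Real.rpow_le_rpow hy h hβ.le
    calc x ^ α * y ^ β ≤ x ^ α * x ^ β := by gcongr
      _ = x ^ c := by rw [← hc, Real.rpow_add_of_nonneg hx hα.le hβ.le]
      _ ≤ _ := le_add_of_nonneg_right (by positivity)

lemma integrable_interaction {n : ℕ} (hn : 3 ≤ n) {u v : Eucl n → ℝ} (hu : MemH1 u) (hv : MemH1 v)
    {α β : ℝ} (hα : 0 < α) (hβ : 0 < β) (hαβ : α + β = critExp n) :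
    Integrable fun x => |u x| ^ α * |v x| ^ β := by
  refine ((integrable_critExp_of_memH1 hn hu).1.add (integrable_critExp_of_memH1 hn hv).1).mono'
    ((hu.1.1.norm.aemeasurable.pow_const _).mul
      (hv.1.1.norm.aemeasurable.pow_const _)).aestronglyMeasurable
    (Eventually.of_forall fun x => ?_)
  rw [Real.norm_of_nonneg (by positivity)]
  exact rpow_mul_rpow_le_add hα hβ hαβ (abs_nonneg _) (abs_nonneg _)

lemma exists_interaction_le {n : ℕ} (hn : 3 ≤ n) {α β : ℝ} (hα : 0 < α) (hβ : 0 < β)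
    (hαβ : α + β = critExp n) : ∃ C > 0, ∀ u v : Eucl n → ℝ, MemH1 u → MemH1 v → ∀ Z > 0,
      gradSq u + gradSq v ≤ Z → ∫ x, |u x| ^ α * |v x| ^ β ≤ C * Z ^ (critExp n / 2) := by
  have hc := critExp_pos hn
  have hK : 0 < bubbleEnergy n ^ (2 / (n : ℝ)) := Real.rpow_pos_of_pos (bubbleEnergy_pos hn) _
  set κ := bubbleEnergy n ^ (2 / (n : ℝ)) with hκ
  refine ⟨2 * (κ ^ (critExp n / 2))⁻¹, by positivity, fun u v hu hv Z hZ hg => ?_⟩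
  have key : ∀ w : Eucl n → ℝ, MemH1 w → gradSq w ≤ Z →
      ∫ x, |w x| ^ critExp n ≤ (κ ^ (critExp n / 2))⁻¹ * Z ^ (critExp n / 2) := fun w hw hwZ => by
    refine (integrable_critExp_of_memH1 hn hw).2.trans ((Real.rpow_le_rpow
      (div_nonneg (gradSq_nonneg w) hK.le) (div_le_div_of_nonneg_right hwZ hK.le)
      (by positivity)).trans (le_of_eq ?_))
    rw [Real.div_rpow hZ.le hK.le]
    ring
  have h1 := key u hu (by linarith [gradSq_nonneg v])
  have h2 := key v hv (by linarith [gradSq_nonneg u])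
  have i1 := (integrable_critExp_of_memH1 hn hu).1
  have i2 := (integrable_critExp_of_memH1 hn hv).1
  refine (integral_mono_of_nonneg (Eventually.of_forall fun x => by positivity) (i1.add i2)
    (Eventually.of_forall fun x =>
      rpow_mul_rpow_le_add hα hβ hαβ (abs_nonneg _) (abs_nonneg _))).trans ?_
  simp only [Pi.add_apply]
  rw [integral_add i1 i2]
  linarith

/-- Lower bound of the energy in which the subcritical terms have exponents below `1` in the size
`Z` of the gradients, since `p, q < 2 + 4/N`; it is uniform in the masses up to `a`, `b`. -/
lemma exists_energy_lower_bound {n : ℕ} (hn : 3 ≤ n) {p q α β μ₁ μ₂ a b : ℝ}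
    (hp : 2 < p) (hp' : p < 2 + 4 / (n : ℝ)) (hq : 2 < q) (hq' : q < 2 + 4 / (n : ℝ))
    (hα : 1 < α) (hβ : 1 < β) (hαβ : α + β = critExp n)
    (hμ₁ : 0 < μ₁) (hμ₂ : 0 < μ₂) (ha : 0 < a) (hb : 0 < b) :
    ∃ C₁ > 0, ∃ C₂ > 0, ∃ C₃ > 0, ∀ a₁ ≤ a, ∀ b₁ ≤ b, ∀ ν ≥ 0, ∀ w ∈ torus n a₁ b₁, ∀ Z > 0,
      gradSq w.1 + gradSq w.2 ≤ Z →
      (1 / 2) * (gradSq w.1 + gradSq w.2) - C₁ * Z ^ ((n : ℝ) * (p - 2) / 4)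
        - C₂ * Z ^ ((n : ℝ) * (q - 2) / 4) - ν * (C₃ * Z ^ (critExp n / 2)) ≤
      energy p q α β μ₁ μ₂ ν w.1 w.2 := by
  obtain ⟨C, hC, h1⟩ := exists_gagliardoNirenberg hn hp hp' ha
  obtain ⟨D, hD, h2⟩ := exists_gagliardoNirenberg hn hq hq' hb
  obtain ⟨E, hE, h3⟩ := exists_interaction_le hn (by linarith) (by linarith) hαβ
  refine ⟨μ₁ / p * C, by positivity, μ₂ / q * D, by positivity, E, hE,
    fun a₁ ha₁ b₁ hb₁ ν hν w hw Z hZ hg => ?_⟩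
  obtain ⟨w1, w2, m1, m2⟩ := hw
  have e1 := mul_le_mul_of_nonneg_left (h1 w.1 w1 (m1.le.trans ha₁) Z hZ
    (by linarith [gradSq_nonneg w.2])) (show 0 ≤ μ₁ / p by positivity)
  have e2 := mul_le_mul_of_nonneg_left (h2 w.2 w2 (m2.le.trans hb₁) Z hZ
    (by linarith [gradSq_nonneg w.1])) (show 0 ≤ μ₂ / q by positivity)
  have e3 := mul_le_mul_of_nonneg_left (h3 w.1 w.2 w1 w2 Z hZ hg) hν
  rw [energy]
  linarith

lemma bddBelow_energy {n : ℕ} (hn : 3 ≤ n) {p q α β μ₁ μ₂ a₁ b₁ ν ρ : ℝ}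
    (hp : 2 < p) (hp' : p < 2 + 4 / (n : ℝ)) (hq : 2 < q) (hq' : q < 2 + 4 / (n : ℝ))
    (hα : 1 < α) (hβ : 1 < β) (hαβ : α + β = critExp n)
    (hμ₁ : 0 < μ₁) (hμ₂ : 0 < μ₂) (hν : 0 ≤ ν) (hρ : 0 < ρ) :
    BddBelow ((fun w : (Eucl n → ℝ) × (Eucl n → ℝ) => energy p q α β μ₁ μ₂ ν w.1 w.2) ''
      setA n a₁ b₁ ρ) := by
  obtain ⟨C₁, -, C₂, -, C₃, -, h⟩ := exists_energy_lower_bound hn hp hp' hq hq' hα hβ hαβ hμ₁ hμ₂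
    (a := |a₁| + 1) (b := |b₁| + 1) (by positivity) (by positivity)
  refine ⟨- C₁ * ρ ^ ((n : ℝ) * (p - 2) / 4) - C₂ * ρ ^ ((n : ℝ) * (q - 2) / 4)
    - ν * (C₃ * ρ ^ (critExp n / 2)), ?_⟩
  rintro _ ⟨w, hw, rfl⟩
  have := h a₁ (by linarith [le_abs_self a₁]) b₁ (by linarith [le_abs_self b₁]) ν hν w hw.1 ρ hρ
    hw.2.le
  linarith [gradSq_nonneg w.1, gradSq_nonneg w.2]

/-! ### The local infimum is negative -/

lemma integral_comp_smul_eucl {n : ℕ} (f : Eucl n → ℝ) {s : ℝ} (hs : 0 < s) :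
    ∫ x, f (s • x) = (s ^ n)⁻¹ * ∫ x, f x := by
  rw [Measure.integral_comp_smul, finrank_euclideanSpace, Fintype.card_fin,
    abs_of_pos (by positivity), smul_eq_mul]

lemma memH1_of_smooth {n : ℕ} {f : Eucl n → ℝ} (hf : ContDiff ℝ ∞ f) (hc : HasCompactSupport f) :
    MemH1 f ∧ gradSq f = ∫ x, ‖∇ f x‖ ^ 2 := by
  obtain ⟨C, hC⟩ := ContDiff.lipschitzWith_of_hasCompactSupport (𝕂 := ℝ) (n := ∞) hc hf (by simp)
  exact ⟨memH1_of_lipschitz hC hc, gradSq_of_lipschitz hC hc⟩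

lemma memH1_comp_smul {n : ℕ} {f : Eucl n → ℝ} (hf : ContDiff ℝ ∞ f) (hc : HasCompactSupport f)
    {s : ℝ} (hs : 0 < s) : MemH1 (fun x => f (s • x)) ∧
      gradSq (fun x => f (s • x)) = s ^ 2 * ((s ^ n)⁻¹ * gradSq f) := by
  have h := memH1_of_smooth (f := fun x => f (s • x)) (hf.comp (contDiff_const_smul s))
    (hc.comp_homeomorph (Homeomorph.smulOfNeZero s hs.ne'))
  refine ⟨h.1, ?_⟩
  rw [h.2, (memH1_of_smooth hf hc).2, ← integral_comp_smul_eucl (fun x => ‖∇ f x‖ ^ 2) hs,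
    ← integral_const_mul]
  congr with x
  rw [norm_gradient_eq_norm_fderiv, norm_gradient_eq_norm_fderiv, fderiv_comp_smul, norm_smul,
    mul_pow, Real.norm_of_nonneg hs.le]

/-- The `L^2`-preserving dilation `c s^{N/2} f(s x)`. -/
lemma dilation_spec {n : ℕ} {f : Eucl n → ℝ} (hf : ContDiff ℝ ∞ f) (hc : HasCompactSupport f)
    {s c : ℝ} (hs : 0 < s) (hc0 : 0 ≤ c) :
    MemH1 (fun x => c * s ^ ((n : ℝ) / 2) * f (s • x)) ∧
    mass (fun x => c * s ^ ((n : ℝ) / 2) * f (s • x)) = c ^ 2 * mass f ∧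
    gradSq (fun x => c * s ^ ((n : ℝ) / 2) * f (s • x)) = s ^ 2 * (c ^ 2 * gradSq f) ∧
    ∀ p : ℝ, (∫ x, |c * s ^ ((n : ℝ) / 2) * f (s • x)| ^ p) =
      s ^ ((n : ℝ) * (p - 2) / 2) * (c ^ p * ∫ x, |f x| ^ p) := by
  have h := memH1_comp_smul hf hc hs
  have hsq : (s ^ ((n : ℝ) / 2)) ^ 2 = s ^ n := by
    rw [← Real.rpow_natCast, ← Real.rpow_mul hs.le, ← Real.rpow_natCast]
    congr 1
    push_cast
    ring
  have hsn : s ^ n ≠ 0 := by positivity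
  refine ⟨h.1.const_mul _, ?_, ?_, fun p => ?_⟩
  · rw [mass_const_mul, mul_pow, hsq, mass, integral_comp_smul_eucl (fun x => |f x| ^ 2) hs, mass]
    field_simp
  · rw [gradSq_const_mul h.1, h.2, mul_pow, hsq]
    field_simp
  · have e : ∀ x, |c * s ^ ((n : ℝ) / 2) * f (s • x)| ^ p =
        (c ^ p * s ^ ((n : ℝ) / 2 * p)) * |f (s • x)| ^ p := fun x => by
      rw [abs_mul, abs_of_nonneg (by positivity), Real.mul_rpow (by positivity) (abs_nonneg _),
        Real.mul_rpow hc0 (by positivity), ← Real.rpow_mul hs.le]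
    simp_rw [e]
    rw [integral_const_mul, integral_comp_smul_eucl (fun x => |f x| ^ p) hs]
    have e2 : s ^ ((n : ℝ) * (p - 2) / 2) = s ^ ((n : ℝ) / 2 * p) * (s ^ n)⁻¹ := by
      rw [← Real.rpow_natCast, ← Real.rpow_neg hs.le, ← Real.rpow_add hs]
      congr 1
      ring
    rw [e2]
    ring

lemma exists_small_scale {A B e ρ : ℝ} (hB : 0 < B) (he : e < 2) (hρ : 0 < ρ) :
    ∃ s > 0, s ^ 2 * A < ρ ∧ s ^ 2 * A < s ^ e * B := by
  have h1 : Tendsto (fun s : ℝ => s ^ 2 * A) (nhdsWithin 0 (Ioi 0)) (nhds (0 ^ 2 * A)) :=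
    tendsto_nhdsWithin_of_tendsto_nhds (Continuous.tendsto (by fun_prop) 0)
  have h2 : Tendsto (fun s : ℝ => s ^ (2 - e) * A) (nhdsWithin 0 (Ioi 0))
      (nhds ((0 : ℝ) ^ (2 - e) * A)) :=
    tendsto_nhdsWithin_of_tendsto_nhds
      ((Real.continuousAt_rpow_const _ _ (Or.inr (by linarith))).tendsto.mul_const A)
  rw [Real.zero_rpow (by linarith), zero_mul] at h2
  rw [zero_pow two_ne_zero, zero_mul] at h1
  obtain ⟨s, ⟨hs1, hs2⟩, hs⟩ := ((h1.eventually_lt_const hρ).and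
    (h2.eventually_lt_const hB)).and self_mem_nhdsWithin |>.exists
  have hs : 0 < s := hs
  refine ⟨s, hs, hs1, ?_⟩
  have : s ^ 2 * A = s ^ e * (s ^ (2 - e) * A) := by
    rw [← mul_assoc, ← Real.rpow_add hs, add_sub_cancel, Real.rpow_two]
  rw [this]
  exact mul_lt_mul_of_pos_left hs2 (Real.rpow_pos_of_pos hs _)

/-- Spreading a test function out makes the energy negative, as `p, q < 2 + 4/N`. -/
lemma exists_energy_neg {n : ℕ} (hn : 3 ≤ n) {p q α β μ₁ μ₂ a₁ b₁ ν ρ : ℝ}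
    (hp : 2 < p) (hp' : p < 2 + 4 / (n : ℝ)) (hq : 2 < q) (hq' : q < 2 + 4 / (n : ℝ))
    (hμ₁ : 0 < μ₁) (hμ₂ : 0 < μ₂) (ha : 0 ≤ a₁) (hb : 0 ≤ b₁) (hab : (a₁, b₁) ≠ (0, 0))
    (hν : 0 ≤ ν) (hρ : 0 < ρ) :
    ∃ w ∈ setA n a₁ b₁ ρ, energy p q α β μ₁ μ₂ ν w.1 w.2 < 0 := by
  have hn3 : (3 : ℝ) ≤ n := by exact_mod_cast hn
  let f : ContDiffBump (0 : Eucl n) := ⟨1, 2, one_pos, one_lt_two⟩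
  have hf : ContDiff ℝ ∞ f := f.contDiff
  have hfc : HasCompactSupport f := f.hasCompactSupport
  have hpos : ∀ r : ℝ, 0 < r → 0 < ∫ x, |f x| ^ r := by
    intro r hr
    have hcont : Continuous fun x => |f x| ^ r :=
      f.continuous.abs.rpow_const fun _ => Or.inr hr.le
    refine hcont.integral_pos_of_hasCompactSupport_nonneg_nonzero (hfc.comp_left
      (g := fun y => |y| ^ r) (by simp [Real.zero_rpow hr.ne'])) (fun x => by positivity) (x := 0) ?_
    rw [f.one_of_mem_closedBall (by simp [f])]
    simp
  have hm : 0 < mass f := by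
    have := hpos 2 two_pos
    simpa [mass] using this
  set c := √(a₁ / mass f) with hcdef
  set d := √(b₁ / mass f) with hddef
  have hc2 : c ^ 2 * mass f = a₁ := by
    rw [hcdef, Real.sq_sqrt (by positivity), div_mul_cancel₀ _ hm.ne']
  have hd2 : d ^ 2 * mass f = b₁ := by
    rw [hddef, Real.sq_sqrt (by positivity), div_mul_cancel₀ _ hm.ne']
  have hc0 : 0 ≤ c := Real.sqrt_nonneg _
  have hd0 : 0 ≤ d := Real.sqrt_nonneg _
  set A := c ^ 2 * gradSq f + d ^ 2 * gradSq f with hA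
  have hA0 : 0 ≤ A := add_nonneg (mul_nonneg (sq_nonneg _) (gradSq_nonneg _))
    (mul_nonneg (sq_nonneg _) (gradSq_nonneg _))
  set P := μ₁ / p * (c ^ p * ∫ x, |f x| ^ p) with hP
  set Q := μ₂ / q * (d ^ q * ∫ x, |f x| ^ q) with hQ
  have hP0 : 0 ≤ P := mul_nonneg (by positivity) (mul_nonneg (by positivity) (hpos p (by linarith)).le)
  have hQ0 : 0 ≤ Q := mul_nonneg (by positivity) (mul_nonneg (by positivity) (hpos q (by linarith)).le)
  have he : ∀ r : ℝ, r < 2 + 4 / (n : ℝ) → (n : ℝ) * (r - 2) / 2 < 2 := fun r hr => by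
    have : (n : ℝ) * (r - 2) < n * (4 / n) := mul_lt_mul_of_pos_left (by linarith) (by linarith)
    rw [mul_div_cancel₀ _ (by linarith)] at this
    linarith
  have hex : ∃ s > 0, s ^ 2 * A < ρ ∧
      s ^ 2 * A < s ^ ((n : ℝ) * (p - 2) / 2) * P + s ^ ((n : ℝ) * (q - 2) / 2) * Q := by
    by_cases h0 : a₁ = 0
    · have hb0 : 0 < b₁ := lt_of_le_of_ne hb fun h => hab (by rw [h0, ← h])
      have hd : 0 < d := Real.sqrt_pos.2 (by positivity)
      have : 0 < Q := mul_pos (by positivity) (mul_pos (by positivity) (hpos q (by linarith)))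
      obtain ⟨s, hs, h1, h2⟩ := exists_small_scale (A := A) this (he q hq') hρ
      exact ⟨s, hs, h1, h2.trans_le (le_add_of_nonneg_left (by positivity))⟩
    · have ha0 : 0 < a₁ := lt_of_le_of_ne ha (Ne.symm h0)
      have hd : 0 < c := Real.sqrt_pos.2 (by positivity)
      have : 0 < P := mul_pos (by positivity) (mul_pos (by positivity) (hpos p (by linarith)))
      obtain ⟨s, hs, h1, h2⟩ := exists_small_scale (A := A) this (he p hp') hρ
      exact ⟨s, hs, h1, h2.trans_le (le_add_of_nonneg_right (by positivity))⟩
  obtain ⟨s, hs, h1, h2⟩ := hex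
  obtain ⟨u1, u2, u3, u4⟩ := dilation_spec hf hfc hs hc0
  obtain ⟨v1, v2, v3, v4⟩ := dilation_spec hf hfc hs hd0
  refine ⟨(fun x => c * s ^ ((n : ℝ) / 2) * f (s • x), fun x => d * s ^ ((n : ℝ) / 2) * f (s • x)),
    ⟨⟨u1, v1, u2.trans hc2, v2.trans hd2⟩, ?_⟩, ?_⟩
  · simp only
    rw [u3, v3, ← mul_add]
    exact h1
  · simp only [energy]
    rw [u3, v3, u4, v4, ← mul_add, ← hA]
    have h3 : 0 ≤ ν * ∫ x, |c * s ^ ((n : ℝ) / 2) * f (s • x)| ^ α *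
        |d * s ^ ((n : ℝ) / 2) * f (s • x)| ^ β :=
      mul_nonneg hν (integral_nonneg fun x => by positivity)
    have e1 : μ₁ / p * (s ^ ((n : ℝ) * (p - 2) / 2) * (c ^ p * ∫ x, |f x| ^ p)) =
      s ^ ((n : ℝ) * (p - 2) / 2) * P := by rw [hP]; ring
    have e2 : μ₂ / q * (s ^ ((n : ℝ) * (q - 2) / 2) * (d ^ q * ∫ x, |f x| ^ q)) =
      s ^ ((n : ℝ) * (q - 2) / 2) * Q := by rw [hQ]; ring
    rw [e1, e2]
    have : 0 ≤ s ^ 2 * A := by positivity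
    linarith

lemma exists_large_radius {C₁ C₂ e₁ e₂ : ℝ} (h₁ : e₁ < 1) (h₂ : e₂ < 1) :
    ∃ ρ > 0, 1 ≤ 1 / 2 * ρ - C₁ * (2 * ρ) ^ e₁ - C₂ * (2 * ρ) ^ e₂ := by
  have key : ∀ e : ℝ, e < 1 → Tendsto (fun Z : ℝ => Z ^ (e - 1)) atTop (nhds 0) := fun e he => by
    have := tendsto_rpow_neg_atTop (show 0 < 1 - e by linarith)
    simpa using this
  have h3 : Tendsto (fun Z : ℝ => 1 / 4 - C₁ * Z ^ (e₁ - 1) - C₂ * Z ^ (e₂ - 1)) atTop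
      (nhds (1 / 4 - C₁ * 0 - C₂ * 0)) :=
    (((key e₁ h₁).const_mul C₁).const_sub _).sub ((key e₂ h₂).const_mul C₂)
  obtain ⟨Z, hZ, hZ8⟩ := ((h3.eventually_const_le (show (1 : ℝ) / 8 < 1 / 4 - C₁ * 0 - C₂ * 0 by
    norm_num)).and (eventually_ge_atTop 8)).exists
  refine ⟨Z / 2, by linarith, ?_⟩
  have hZ0 : 0 < Z := by linarith
  rw [mul_div_cancel₀ _ two_ne_zero]
  have e : ∀ e : ℝ, Z ^ e = Z * Z ^ (e - 1) := fun e => by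
    rw [Real.rpow_sub hZ0, Real.rpow_one]
    field_simp
  rw [e e₁, e e₂]
  nlinarith [mul_le_mul_of_nonneg_left hZ hZ0.le]

/-- A large `ρ₀` makes the energy at least `1` on `B_{ρ₀}` without the coupling term, and a small
`ν₀` keeps it above `k₀ = 1/2` with it. -/
theorem exists_isLocalMinConstants {n : ℕ} (hn : 3 ≤ n) {p q α β μ₁ μ₂ a b : ℝ}
    (hp : 2 < p) (hp' : p < 2 + 4 / (n : ℝ)) (hq : 2 < q) (hq' : q < 2 + 4 / (n : ℝ))
    (hα : 1 < α) (hβ : 1 < β) (hαβ : α + β = critExp n)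
    (hμ₁ : 0 < μ₁) (hμ₂ : 0 < μ₂) (ha : 0 < a) (hb : 0 < b) :
    ∃ ν₀ k₀ ρ₀ : ℝ, IsLocalMinConstants n p q α β μ₁ μ₂ a b ν₀ k₀ ρ₀ := by
  have hn3 : (3 : ℝ) ≤ n := by exact_mod_cast hn
  have he : ∀ r : ℝ, r < 2 + 4 / (n : ℝ) → (n : ℝ) * (r - 2) / 4 < 1 := fun r hr => by
    have : (n : ℝ) * (r - 2) < n * (4 / n) := mul_lt_mul_of_pos_left (by linarith) (by linarith)
    rw [mul_div_cancel₀ _ (by linarith)] at this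
    linarith
  obtain ⟨C₁, hC₁, C₂, hC₂, C₃, hC₃, h⟩ :=
    exists_energy_lower_bound hn hp hp' hq hq' hα hβ hαβ hμ₁ hμ₂ ha hb
  obtain ⟨ρ, hρ, hρ1⟩ := exists_large_radius (C₁ := C₁) (C₂ := C₂) (he p hp') (he q hq')
  have hD : 0 < C₃ * (2 * ρ) ^ (critExp n / 2) := by positivity
  refine ⟨1 / 2 / (C₃ * (2 * ρ) ^ (critExp n / 2)), 1 / 2, ρ, by positivity, by norm_num, hρ,
    fun a₁ ha₁ b₁ hb₁ hab ν hν => ⟨?_, fun w hw => ?_⟩⟩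
  · obtain ⟨w, hw, hw0⟩ := exists_energy_neg hn (α := α) (β := β) hp hp' hq hq' hμ₁ hμ₂ ha₁.1
      hb₁.1 hab hν.1.le hρ
    exact (csInf_le (bddBelow_energy hn hp hp' hq hq' hα hβ hαβ hμ₁ hμ₂ hν.1.le hρ)
      ⟨w, hw, rfl⟩).trans_lt hw0
  · have h1 := h a₁ ha₁.2 b₁ hb₁.2 ν hν.1.le w hw.1 (2 * ρ) (by linarith) hw.2.2
    have h2 := hν.2.le
    rw [le_div_iff₀ hD] at h2
    linarith [hw.2.1]

/-! ### The truncated Aubin-Talenti bubbles -/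

/-- The factor `[N(N-2)]^{(N-2)/4}` of the bubbles. -/
def bubbleAmplitude (N : ℕ) : ℝ := ((N : ℝ) * ((N : ℝ) - 2)) ^ (((N : ℝ) - 2) / 4)

/-- The profile `(n / (1 + n² r²))^{(N-2)/2}` of the concentrating bubble, without cut-off. -/
def bubbleCore (N n : ℕ) (r : ℝ) : ℝ :=
  ((n : ℝ) / (1 + (n : ℝ) ^ 2 * r ^ 2)) ^ (((N : ℝ) - 2) / 2)

lemma bubbleAmplitude_pos {N : ℕ} (hN : 3 ≤ N) : 0 < bubbleAmplitude N := by
  have hN3 : (3 : ℝ) ≤ N := by exact_mod_cast hN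
  exact Real.rpow_pos_of_pos (mul_pos (by linarith) (by linarith)) _

lemma bubbleAmplitude_sq {N : ℕ} (hN : 3 ≤ N) :
    bubbleAmplitude N ^ 2 * ((N : ℝ) * ((N : ℝ) - 2)) =
      ((N : ℝ) * ((N : ℝ) - 2)) ^ ((N : ℝ) / 2) := by
  have hN3 : (3 : ℝ) ≤ N := by exact_mod_cast hN
  have h0 : 0 < (N : ℝ) * (N - 2) := mul_pos (by linarith) (by linarith)
  have h1 : ((N : ℝ) * ((N : ℝ) - 2)) ^ ((N : ℝ) / 2) =
      ((N : ℝ) * ((N : ℝ) - 2)) ^ (((N : ℝ) - 2) / 2) * ((N : ℝ) * ((N : ℝ) - 2)) := by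
    rw [← Real.rpow_add_one h0.ne']
    congr 1
    ring
  rw [h1, bubbleAmplitude, ← Real.rpow_natCast, ← Real.rpow_mul h0.le]
  congr 2
  push_cast
  ring

lemma bubbleAmplitude_rpow_critExp {N : ℕ} (hN : 3 ≤ N) :
    bubbleAmplitude N ^ critExp N = ((N : ℝ) * ((N : ℝ) - 2)) ^ ((N : ℝ) / 2) := by
  have hN3 : (3 : ℝ) ≤ N := by exact_mod_cast hN
  have h0 : 0 < (N : ℝ) * (N - 2) := mul_pos (by linarith) (by linarith)
  have h2 : (N : ℝ) - 2 ≠ 0 := by linarith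
  rw [bubbleAmplitude, ← Real.rpow_mul h0.le, critExp]
  congr 1
  field_simp
  ring

lemma bubbleCore_nonneg (N n : ℕ) (r : ℝ) : 0 ≤ bubbleCore N n r := by
  rw [bubbleCore]
  positivity

lemma bubbleCore_eq (N n : ℕ) (r : ℝ) : bubbleCore N n r = (n : ℝ) ^ (((N : ℝ) - 2) / 2) *
    (1 + (n : ℝ) ^ 2 * r ^ 2) ^ (-(((N : ℝ) - 2) / 2)) := by
  rw [bubbleCore, Real.div_rpow (by positivity) (by positivity), Real.rpow_neg (by positivity),
    div_eq_mul_inv]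

lemma bubbleCore_one (N n : ℕ) :
    bubbleCore N n 1 = ((n : ℝ) / (1 + (n : ℝ) ^ 2)) ^ (((N : ℝ) - 2) / 2) := by
  rw [bubbleCore, one_pow, mul_one]

lemma bubble_of_lt_one {N n : ℕ} {x : Eucl N} (hx : ‖x‖ < 1) :
    bubble N n x = bubbleAmplitude N * bubbleCore N n ‖x‖ := by
  simp only [bubble, bubbleProfile, if_pos hx, bubbleAmplitude, bubbleCore]

lemma bubble_of_mem_Ico {N n : ℕ} {x : Eucl N} (hx : 1 ≤ ‖x‖) (hx' : ‖x‖ < 2) :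
    bubble N n x = bubbleAmplitude N * (bubbleCore N n 1 * (2 - ‖x‖)) := by
  rw [bubbleCore_one]
  simp only [bubble, bubbleProfile, if_neg hx.not_gt, if_pos hx', bubbleAmplitude]

lemma bubble_of_two_le {N n : ℕ} {x : Eucl N} (hx : 2 ≤ ‖x‖) : bubble N n x = 0 := by
  simp only [bubble, bubbleProfile, if_neg hx.not_gt,
    if_neg (show ¬ ‖x‖ < 1 by linarith), mul_zero]

/-- A closed formula, in which the Lipschitz continuity is visible. -/
lemma bubble_eq (N n : ℕ) (x : Eucl N) : bubble N n x = bubbleAmplitude N *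
    (bubbleCore N n (min ‖x‖ 1) - bubbleCore N n 1 * (min (max ‖x‖ 1) 2 - 1)) := by
  rcases lt_or_ge ‖x‖ 1 with h | h
  · rw [bubble_of_lt_one h, min_eq_left h.le, max_eq_right h.le, min_eq_left (by norm_num)]
    ring
  · rw [min_eq_right h, max_eq_left h]
    rcases lt_or_ge ‖x‖ 2 with h' | h'
    · rw [bubble_of_mem_Ico h h', min_eq_left h'.le]
      ring
    · rw [bubble_of_two_le h', min_eq_right h']
      ring

lemma bubble_nonneg {N : ℕ} (hN : 3 ≤ N) (n : ℕ) (x : Eucl N) : 0 ≤ bubble N n x := by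
  have hA := (bubbleAmplitude_pos hN).le
  rcases lt_or_ge ‖x‖ 1 with h | h
  · rw [bubble_of_lt_one h]
    exact mul_nonneg hA (bubbleCore_nonneg _ _ _)
  · rcases lt_or_ge ‖x‖ 2 with h' | h'
    · rw [bubble_of_mem_Ico h h']
      exact mul_nonneg hA (mul_nonneg (bubbleCore_nonneg _ _ _) (by linarith))
    · rw [bubble_of_two_le h']

lemma hasDerivAt_bracket (γ m s : ℝ) (hm : 0 ≤ m) (hs : 0 ≤ s) :
    HasDerivAt (fun s : ℝ => (1 + m * s) ^ (-γ)) (m * (-γ) * (1 + m * s) ^ (-γ - 1)) s := by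
  have h1 : HasDerivAt (fun s : ℝ => 1 + m * s) m s := by
    simpa using ((hasDerivAt_id s).const_mul m).const_add 1
  exact h1.rpow_const (Or.inl (by positivity))

lemma lipschitzWith_bubbleCore {N : ℕ} (hN : 3 ≤ N) (n : ℕ) :
    ∃ C : NNReal, LipschitzWith C (bubbleCore N n) := by
  have hN3 : (3 : ℝ) ≤ N := by exact_mod_cast hN
  set γ := ((N : ℝ) - 2) / 2 with hγ
  have hγ0 : 0 ≤ γ := by rw [hγ]; linarith
  have hd : ∀ r : ℝ, HasDerivAt (bubbleCore N n) ((n : ℝ) ^ γ *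
      ((n : ℝ) ^ 2 * (-γ) * (1 + (n : ℝ) ^ 2 * r ^ 2) ^ (-γ - 1) * (2 * r))) r := by
    intro r
    have h1 : HasDerivAt (fun r : ℝ => r ^ 2) (2 * r) r := by simpa using hasDerivAt_pow 2 r
    have h2 := ((hasDerivAt_bracket γ ((n : ℝ) ^ 2) (r ^ 2) (by positivity)
      (by positivity)).comp r h1).const_mul ((n : ℝ) ^ γ)
    exact h2.congr_of_eventuallyEq (Eventually.of_forall fun y => bubbleCore_eq N n y)
  refine ⟨((n : ℝ) ^ γ * (n * γ)).toNNReal, lipschitzWith_of_nnnorm_deriv_le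
    (fun r => (hd r).differentiableAt) fun r => ?_⟩
  rw [(hd r).deriv, ← NNReal.coe_le_coe, coe_nnnorm, Real.coe_toNNReal _ (by positivity),
    Real.norm_eq_abs, abs_mul, abs_of_nonneg (by positivity : 0 ≤ (n : ℝ) ^ γ)]
  refine mul_le_mul_of_nonneg_left ?_ (by positivity)
  have hb : 1 ≤ 1 + (n : ℝ) ^ 2 * r ^ 2 := le_add_of_nonneg_right (by positivity)
  have h3 : (1 + (n : ℝ) ^ 2 * r ^ 2) ^ (-γ - 1) ≤ (1 + (n : ℝ) ^ 2 * r ^ 2)⁻¹ := by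
    rw [← Real.rpow_neg_one]
    exact Real.rpow_le_rpow_of_exponent_le hb (by linarith)
  have h4 : 2 * (n * |r|) ≤ 1 + (n : ℝ) ^ 2 * r ^ 2 := by
    nlinarith [sq_nonneg (n * |r| - 1), sq_abs r]
  calc |(n : ℝ) ^ 2 * (-γ) * (1 + (n : ℝ) ^ 2 * r ^ 2) ^ (-γ - 1) * (2 * r)|
      = n * γ * ((1 + (n : ℝ) ^ 2 * r ^ 2) ^ (-γ - 1) * (2 * (n * |r|))) := by
        rw [abs_mul, abs_mul, abs_mul, abs_neg, abs_of_nonneg hγ0, abs_mul,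
          abs_of_nonneg (by positivity : 0 ≤ (n : ℝ) ^ 2),
          abs_of_nonneg (by positivity : 0 ≤ (1 + (n : ℝ) ^ 2 * r ^ 2) ^ (-γ - 1)), abs_two]
        ring
    _ ≤ n * γ * ((1 + (n : ℝ) ^ 2 * r ^ 2)⁻¹ * (1 + (n : ℝ) ^ 2 * r ^ 2)) := by gcongr
    _ = n * γ := by rw [inv_mul_cancel₀ (by linarith), mul_one]

lemma lipschitzWith_bubble {N : ℕ} (hN : 3 ≤ N) (n : ℕ) :
    ∃ C : NNReal, LipschitzWith C (bubble N n) := by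
  obtain ⟨C, hC⟩ := lipschitzWith_bubbleCore hN n
  have h1 : LipschitzWith (C * 1) fun x : Eucl N => bubbleCore N n (min ‖x‖ 1) :=
    hC.comp (lipschitzWith_one_norm.min_const 1)
  have h2 : LipschitzWith 1 fun x : Eucl N => min (max ‖x‖ 1) 2 :=
    (lipschitzWith_one_norm.max_const 1).min_const 2
  have h3 := (lipschitzWith_smul (bubbleCore N n 1)).comp h2
  have h4 := (lipschitzWith_smul (bubbleAmplitude N)).comp
    ((h1.sub h3).add (LipschitzWith.const' (K := 0) (bubbleCore N n 1)))
  refine ⟨‖bubbleAmplitude N‖₊ * (C * 1 + ‖bubbleCore N n 1‖₊ * 1 + 0), ?_⟩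
  have e : bubble N n = (fun x : ℝ => bubbleAmplitude N • x) ∘ fun x : Eucl N =>
      bubbleCore N n (min ‖x‖ 1) - ((fun x : ℝ => bubbleCore N n 1 • x) ∘
        fun x : Eucl N => min (max ‖x‖ 1) 2) x + bubbleCore N n 1 := by
    funext x
    rw [bubble_eq]
    simp only [Function.comp, smul_eq_mul]
    ring
  rw [e]
  exact h4

lemma hasCompactSupport_bubble (N n : ℕ) : HasCompactSupport (bubble N n) := by
  refine HasCompactSupport.intro (isCompact_closedBall (0 : Eucl N) 2) fun x hx => ?_
  rw [mem_closedBall_zero_iff, not_le] at hx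
  exact bubble_of_two_le hx.le

lemma memH1_bubble {N : ℕ} (hN : 3 ≤ N) (n : ℕ) : MemH1 (bubble N n) := by
  obtain ⟨C, hC⟩ := lipschitzWith_bubble hN n
  exact memH1_of_lipschitz hC (hasCompactSupport_bubble N n)

lemma integral_bracket_scaled {N n : ℕ} (hn : 1 ≤ n) (r : ℝ) :
    ∫ x : Eucl N, (1 + (n : ℝ) ^ 2 * ‖x‖ ^ 2) ^ (-r) =
      ((n : ℝ) ^ N)⁻¹ * ∫ x : Eucl N, (1 + ‖x‖ ^ 2) ^ (-r) := by
  have hn0 : (0 : ℝ) < n := by exact_mod_cast hn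
  rw [← integral_comp_smul_eucl (fun x : Eucl N => (1 + ‖x‖ ^ 2) ^ (-r)) hn0]
  congr with x
  rw [norm_smul, mul_pow, Real.norm_of_nonneg hn0.le]

lemma integrable_bracket_scaled {N n : ℕ} (hn : 1 ≤ n) {r : ℝ} (hr : (N : ℝ) < 2 * r) :
    Integrable fun x : Eucl N => (1 + (n : ℝ) ^ 2 * ‖x‖ ^ 2) ^ (-r) := by
  have hn0 : (n : ℝ) ≠ 0 := by exact_mod_cast (by omega : n ≠ 0)
  refine ((integrable_bracket_rpow hr).comp_smul hn0).congr (Eventually.of_forall fun x => ?_)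
  simp only
  rw [norm_smul, mul_pow, Real.norm_eq_abs, sq_abs]

lemma norm_gradient_bubble_core {N n : ℕ} (hN : 3 ≤ N) {x : Eucl N} (hx : ‖x‖ < 1) :
    ‖∇ (bubble N n) x‖ ^ 2 = bubbleAmplitude N ^ 2 * ((N : ℝ) - 2) ^ 2 * (n : ℝ) ^ (N : ℝ) *
      ((1 + (n : ℝ) ^ 2 * ‖x‖ ^ 2) ^ (-((N : ℝ) - 1)) -
        (1 + (n : ℝ) ^ 2 * ‖x‖ ^ 2) ^ (-(N : ℝ))) := by
  have hN3 : (3 : ℝ) ≤ N := by exact_mod_cast hN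
  set γ := ((N : ℝ) - 2) / 2 with hγ
  have hγ0 : 0 ≤ γ := by rw [hγ]; linarith
  have hb : 0 < 1 + (n : ℝ) ^ 2 * ‖x‖ ^ 2 := by positivity
  have h1 := ((hasDerivAt_bracket γ ((n : ℝ) ^ 2) (‖x‖ ^ 2) (by positivity)
    (by positivity)).comp_hasFDerivAt x (hasStrictFDerivAt_norm_sq x).hasFDerivAt).const_mul
      (bubbleAmplitude N * (n : ℝ) ^ γ)
  have h2 : bubble N n =ᶠ[nhds x] fun y => bubbleAmplitude N * (n : ℝ) ^ γ *
      ((fun s : ℝ => (1 + (n : ℝ) ^ 2 * s) ^ (-γ)) ∘ fun y : Eucl N => ‖y‖ ^ 2) y := by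
    filter_upwards [(continuous_norm.tendsto x).eventually_lt_const hx] with y hy
    rw [bubble_of_lt_one hy, bubbleCore_eq]
    simp only [Function.comp]
    ring
  rw [norm_gradient_eq_norm_fderiv, (h1.congr_of_eventuallyEq h2).fderiv, norm_smul, norm_smul,
    two_smul, ← two_smul ℝ, norm_smul, innerSL_apply_norm]
  simp only [Real.norm_eq_abs, mul_pow, sq_abs]
  set w := 1 + (n : ℝ) ^ 2 * ‖x‖ ^ 2 with hw
  have e1 : w ^ (-((N : ℝ) - 1)) = w * w ^ (-(N : ℝ)) := by
    nth_rewrite 2 [← Real.rpow_one w]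
    rw [← Real.rpow_add hb]
    congr 1
    ring
  have e2 : (w ^ (-γ - 1)) ^ 2 = w ^ (-(N : ℝ)) := by
    rw [← Real.rpow_natCast, ← Real.rpow_mul hb.le]
    congr 1
    rw [hγ]
    push_cast
    ring
  have e3 : ((n : ℝ) ^ γ) ^ 2 * (n : ℝ) ^ 2 = (n : ℝ) ^ (N : ℝ) := by
    rw [← Real.rpow_natCast, ← Real.rpow_natCast, ← Real.rpow_mul (by positivity),
      ← Real.rpow_add' (by positivity) (by rw [hγ]; push_cast; linarith)]
    congr 1
    rw [hγ]
    push_cast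
    ring
  rw [e1, e2, ← e3, hw, hγ]
  ring

lemma norm_gradient_bubble_of_mem_Ioo {N n : ℕ} (hN : 3 ≤ N) {x : Eucl N} (hx : 1 < ‖x‖)
    (hx' : ‖x‖ < 2) : ‖∇ (bubble N n) x‖ ≤ bubbleAmplitude N * bubbleCore N n 1 := by
  have hA := (bubbleAmplitude_pos hN).le
  have h0 : 0 ≤ bubbleAmplitude N * bubbleCore N n 1 := mul_nonneg hA (bubbleCore_nonneg _ _ _)
  have hs : {y : Eucl N | 1 < ‖y‖ ∧ ‖y‖ < 2} ∈ nhds x :=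
    ((continuous_norm.tendsto x).eventually_const_lt hx).and
      ((continuous_norm.tendsto x).eventually_lt_const hx')
  rw [norm_gradient_eq_norm_fderiv]
  refine (norm_fderiv_le_of_lipschitzOn ℝ hs (C := (bubbleAmplitude N * bubbleCore N n 1).toNNReal)
    (LipschitzOnWith.of_dist_le_mul fun y hy z hz => ?_)).trans
    (le_of_eq (Real.coe_toNNReal _ h0))
  rw [bubble_of_mem_Ico hy.1.le hy.2, bubble_of_mem_Ico hz.1.le hz.2, Real.coe_toNNReal _ h0,
    Real.dist_eq, show bubbleAmplitude N * (bubbleCore N n 1 * (2 - ‖y‖)) -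
      bubbleAmplitude N * (bubbleCore N n 1 * (2 - ‖z‖)) =
      (bubbleAmplitude N * bubbleCore N n 1) * (‖z‖ - ‖y‖) by ring, abs_mul, abs_of_nonneg h0,
    dist_comm, dist_eq_norm]
  exact mul_le_mul_of_nonneg_left (abs_norm_sub_norm_le _ _) h0

lemma gradient_bubble_of_two_lt {N n : ℕ} {x : Eucl N} (hx : 2 < ‖x‖) :
    ∇ (bubble N n) x = 0 := by
  have h : bubble N n =ᶠ[nhds x] fun _ => 0 := by
    filter_upwards [(continuous_norm.tendsto x).eventually_const_lt hx] with y hy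
    exact bubble_of_two_le hy.le
  rw [gradient, h.fderiv_eq]
  simp

lemma bubbleCore_one_sq_le {N n : ℕ} (hN : 3 ≤ N) (hn : 1 ≤ n) :
    bubbleCore N n 1 ^ 2 ≤ (n : ℝ) ^ (-((N : ℝ) - 2)) := by
  have hN3 : (3 : ℝ) ≤ N := by exact_mod_cast hN
  have hn0 : (0 : ℝ) < n := by exact_mod_cast hn
  have h1 : (n : ℝ) / (1 + (n : ℝ) ^ 2) ≤ (n : ℝ)⁻¹ := by
    rw [div_le_iff₀ (by positivity)]
    field_simp
    linarith
  rw [bubbleCore_one, ← Real.rpow_natCast, ← Real.rpow_mul (by positivity), Real.rpow_neg hn0.le,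
    ← Real.inv_rpow hn0.le]
  refine (Real.rpow_le_rpow (by positivity) h1 ?_).trans (le_of_eq ?_)
  · push_cast; linarith
  · congr 1
    push_cast
    ring

/-- The gradient of the truncated bubble has at most the energy of the Aubin-Talenti function, up
to the energy of the linear piece. -/
lemma gradSq_bubble_le {N : ℕ} (hN : 3 ≤ N) : ∃ C > 0, ∀ n : ℕ, 1 ≤ n →
    gradSq (bubble N n) ≤ bubbleEnergy N + C * (n : ℝ) ^ (-((N : ℝ) - 2)) := by
  have hN3 : (3 : ℝ) ≤ N := by exact_mod_cast hN
  have : Nontrivial (Eucl N) := by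
    have : Nonempty (Fin N) := ⟨⟨0, by omega⟩⟩
    infer_instance
  have hA := bubbleAmplitude_pos hN
  set V := (volume (Metric.ball (0 : Eucl N) 2)).toReal with hV
  have hV0 : 0 < V := ENNReal.toReal_pos (Metric.measure_ball_pos _ _ two_pos).ne'
    measure_ball_lt_top.ne
  refine ⟨bubbleAmplitude N ^ 2 * V, by positivity, fun n hn => ?_⟩
  have hn0 : (0 : ℝ) < n := by exact_mod_cast hn
  obtain ⟨C, hC⟩ := lipschitzWith_bubble hN n
  rw [gradSq_of_lipschitz hC (hasCompactSupport_bubble N n)]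
  have i1 : Integrable fun x : Eucl N => (1 + (n : ℝ) ^ 2 * ‖x‖ ^ 2) ^ (-((N : ℝ) - 1)) :=
    integrable_bracket_scaled hn (by linarith)
  have i2 : Integrable fun x : Eucl N => (1 + (n : ℝ) ^ 2 * ‖x‖ ^ 2) ^ (-(N : ℝ)) :=
    integrable_bracket_scaled hn (by linarith)
  set D := bubbleAmplitude N ^ 2 * ((N : ℝ) - 2) ^ 2 * (n : ℝ) ^ (N : ℝ) with hD
  set E := (bubbleAmplitude N * bubbleCore N n 1) ^ 2 with hE
  have i3 : Integrable ((Metric.ball (0 : Eucl N) 2).indicator fun _ => E) :=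
    (integrable_indicator_iff measurableSet_ball).2 (integrableOn_const measure_ball_lt_top.ne)
  have hpos : ∀ x : Eucl N, 0 ≤ D * ((1 + (n : ℝ) ^ 2 * ‖x‖ ^ 2) ^ (-((N : ℝ) - 1)) -
      (1 + (n : ℝ) ^ 2 * ‖x‖ ^ 2) ^ (-(N : ℝ))) := fun x => by
    refine mul_nonneg (by positivity) (sub_nonneg.2 ?_)
    exact Real.rpow_le_rpow_of_exponent_le (le_add_of_nonneg_right (by positivity)) (by linarith)
  have hle : ∀ᵐ x : Eucl N, ‖∇ (bubble N n) x‖ ^ 2 ≤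
      D * ((1 + (n : ℝ) ^ 2 * ‖x‖ ^ 2) ^ (-((N : ℝ) - 1)) -
        (1 + (n : ℝ) ^ 2 * ‖x‖ ^ 2) ^ (-(N : ℝ))) +
      (Metric.ball (0 : Eucl N) 2).indicator (fun _ => E) x := by
    have s1 := measure_eq_zero_iff_ae_notMem.1 (Measure.addHaar_sphere volume (0 : Eucl N) 1)
    have s2 := measure_eq_zero_iff_ae_notMem.1 (Measure.addHaar_sphere volume (0 : Eucl N) 2)
    filter_upwards [s1, s2] with x h1 h2
    rw [mem_sphere_zero_iff_norm] at h1 h2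
    have hE0 : 0 ≤ (Metric.ball (0 : Eucl N) 2).indicator (fun _ => E) x :=
      indicator_nonneg (fun _ _ => sq_nonneg _) x
    rcases lt_or_gt_of_ne h1 with h | h
    · rw [norm_gradient_bubble_core hN h]
      exact le_add_of_nonneg_right hE0
    · rcases lt_or_gt_of_ne h2 with h' | h'
      · rw [indicator_of_mem (by simpa using h')]
        refine le_add_of_nonneg_of_le (hpos x) ?_
        exact pow_le_pow_left₀ (norm_nonneg _) (norm_gradient_bubble_of_mem_Ioo hN h h') 2
      · rw [gradient_bubble_of_two_lt h', norm_zero, zero_pow two_ne_zero]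
        exact add_nonneg (hpos x) hE0
  have i4 : Integrable fun x : Eucl N => D * ((1 + (n : ℝ) ^ 2 * ‖x‖ ^ 2) ^ (-((N : ℝ) - 1)) -
        (1 + (n : ℝ) ^ 2 * ‖x‖ ^ 2) ^ (-(N : ℝ))) := (i1.sub i2).const_mul D
  refine (integral_mono_of_nonneg (Eventually.of_forall fun x => sq_nonneg _)
    (i4.add i3) hle).trans ?_
  simp only [Pi.add_apply]
  rw [integral_add i4 i3, integral_const_mul, integral_sub i1 i2, integral_bracket_scaled hn,
    integral_bracket_scaled hn, neg_sub, integral_bracket_succ hN, integral_indicator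
    measurableSet_ball, setIntegral_const, smul_eq_mul]
  refine add_le_add (le_of_eq ?_) ?_
  · rw [bubbleEnergy_eq hN, ← bubbleAmplitude_sq hN, hD, Real.rpow_natCast]
    have h1 : (N : ℝ) - 2 ≠ 0 := by linarith
    field_simp
    ring
  · have := bubbleCore_one_sq_le hN hn
    rw [hE, mul_pow, mul_comm, measureReal_def, ← hV, mul_right_comm]
    exact mul_le_mul_of_nonneg_left this (by positivity)

/-- The bubbles keep the critical norm of the Aubin-Talenti function up to `O(n^{-N})`. -/
lemma le_integral_bubble_critExp {N : ℕ} (hN : 3 ≤ N) {n : ℕ} (hn : 1 ≤ n) :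
    bubbleEnergy N - 2 ^ N * bubbleEnergy N * (n : ℝ) ^ (-(N : ℝ)) ≤
      ∫ x, bubble N n x ^ critExp N := by
  have hN3 : (3 : ℝ) ≤ N := by exact_mod_cast hN
  have hn0 : (0 : ℝ) < n := by exact_mod_cast hn
  have hn1 : (1 : ℝ) ≤ n := by exact_mod_cast hn
  have hA := bubbleAmplitude_pos hN
  have i1 : Integrable fun x : Eucl N => (1 + (n : ℝ) ^ 2 * ‖x‖ ^ 2) ^ (-(N : ℝ)) :=
    integrable_bracket_scaled hn (by linarith)
  have i2 : Integrable fun x : Eucl N => (1 + ‖x‖ ^ 2) ^ (-(N : ℝ)) :=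
    integrable_bracket_rpow (by linarith)
  have i3 : Integrable fun x : Eucl N => bubble N n x ^ critExp N :=
    (integrable_critExp_of_memH1 hN (memH1_bubble hN n)).1.congr (Eventually.of_forall fun x => by
      simp only [abs_of_nonneg (bubble_nonneg hN n x)])
  set D := ((N : ℝ) * ((N : ℝ) - 2)) ^ ((N : ℝ) / 2) with hD
  have hD0 : 0 < D := Real.rpow_pos_of_pos (mul_pos (by linarith) (by linarith)) _
  have hpt : ∀ x : Eucl N, D * ((n : ℝ) ^ N * (1 + (n : ℝ) ^ 2 * ‖x‖ ^ 2) ^ (-(N : ℝ)) -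
      2 ^ N * (n : ℝ) ^ (-(N : ℝ)) * (1 + ‖x‖ ^ 2) ^ (-(N : ℝ))) ≤ bubble N n x ^ critExp N := by
    intro x
    rcases lt_or_ge ‖x‖ 1 with h | h
    · rw [bubble_of_lt_one h, Real.mul_rpow hA.le (bubbleCore_nonneg _ _ _),
        bubbleAmplitude_rpow_critExp hN, ← hD, bubbleCore, ← Real.rpow_mul (by positivity)]
      refine mul_le_mul_of_nonneg_left ((sub_le_self _ (by positivity)).trans (le_of_eq ?_)) hD0.le
      have h2 : (N : ℝ) - 2 ≠ 0 := by linarith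
      rw [critExp, show ((N : ℝ) - 2) / 2 * (2 * N / (N - 2)) = N by field_simp,
        Real.div_rpow hn0.le (by positivity), Real.rpow_neg (by positivity), Real.rpow_natCast,
        Real.rpow_natCast, div_eq_mul_inv]
    · refine le_trans (mul_nonpos_of_nonneg_of_nonpos hD0.le (sub_nonpos.2 ?_))
        (Real.rpow_nonneg (bubble_nonneg hN n x) _)
      have h1 : (n : ℝ) ^ 2 * (1 + ‖x‖ ^ 2) ≤ 2 * (1 + (n : ℝ) ^ 2 * ‖x‖ ^ 2) := by
        have : (n : ℝ) ^ 2 * 1 ≤ (n : ℝ) ^ 2 * ‖x‖ ^ 2 :=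
          mul_le_mul_of_nonneg_left (one_le_pow₀ h) (by positivity)
        linarith
      simp only [Real.rpow_neg_natCast, zpow_neg, zpow_natCast]
      have h2 : ((n : ℝ) ^ 2 * (1 + ‖x‖ ^ 2)) ^ N ≤ (2 * (1 + (n : ℝ) ^ 2 * ‖x‖ ^ 2)) ^ N := by
        gcongr
      rw [mul_pow, mul_pow] at h2
      rw [← div_eq_mul_inv, ← div_eq_mul_inv, ← div_eq_mul_inv, div_div,
        div_le_div_iff₀ (by positivity) (by positivity)]
      calc (n : ℝ) ^ N * ((n : ℝ) ^ N * (1 + ‖x‖ ^ 2) ^ N)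
          = ((n : ℝ) ^ 2) ^ N * (1 + ‖x‖ ^ 2) ^ N := by rw [pow_right_comm]; ring
        _ ≤ _ := h2
  refine le_trans (le_of_eq ?_) (integral_mono (((i1.const_mul _).sub (i2.const_mul _)).const_mul _)
    i3 hpt)
  simp only [Pi.sub_apply]
  rw [integral_const_mul, integral_sub (i1.const_mul _) (i2.const_mul _), integral_const_mul,
    integral_const_mul, integral_bracket_scaled hn, bubbleEnergy_eq hN, ← hD]
  field_simp

/-- On its support the bubble is comparable to the Aubin-Talenti function. -/
lemma bubble_le {N n : ℕ} (hN : 3 ≤ N) (x : Eucl N) :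
    bubble N n x ≤ bubbleAmplitude N * 4 ^ (((N : ℝ) - 2) / 2) * bubbleCore N n ‖x‖ := by
  have hN3 : (3 : ℝ) ≤ N := by exact_mod_cast hN
  have hA := bubbleAmplitude_pos hN
  have hγ0 : 0 ≤ ((N : ℝ) - 2) / 2 := by linarith
  have hc := bubbleCore_nonneg N n ‖x‖
  rw [mul_assoc]
  rcases lt_or_ge ‖x‖ 1 with h | h
  · rw [bubble_of_lt_one h]
    exact mul_le_mul_of_nonneg_left (le_mul_of_one_le_left hc
      (Real.one_le_rpow (by norm_num) hγ0)) hA.le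
  · rcases lt_or_ge ‖x‖ 2 with h' | h'
    · rw [bubble_of_mem_Ico h h']
      refine mul_le_mul_of_nonneg_left ?_ hA.le
      refine (mul_le_of_le_one_right (bubbleCore_nonneg _ _ _) (by linarith)).trans ?_
      rw [bubbleCore_one, bubbleCore, ← Real.mul_rpow (by norm_num) (by positivity)]
      refine Real.rpow_le_rpow (by positivity) ?_ hγ0
      rw [← mul_div_assoc, div_le_div_iff₀ (by positivity) (by positivity)]
      have : ‖x‖ ^ 2 ≤ 2 ^ 2 := by gcongr
      have h2 : (n : ℝ) ^ 2 * ‖x‖ ^ 2 ≤ (n : ℝ) ^ 2 * 2 ^ 2 := by gcongr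
      have h3 : (0 : ℝ) ≤ n := by positivity
      nlinarith
    · rw [bubble_of_two_le h']
      positivity

lemma mass_bubble_le {N : ℕ} (hN : 3 ≤ N) {η : ℝ} (hη : 0 ≤ η) (hη' : 4 - (N : ℝ) < 2 * η) :
    ∃ C > 0, ∀ n : ℕ, 1 ≤ n → mass (bubble N n) ≤ C * (n : ℝ) ^ (2 * η - 2) := by
  have hN3 : (3 : ℝ) ≤ N := by exact_mod_cast hN
  have hA := bubbleAmplitude_pos hN
  have hI := integral_bracket_pos (n := N) (r := (N : ℝ) - 2 + η) (by linarith)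
  set I := ∫ x : Eucl N, (1 + ‖x‖ ^ 2) ^ (-((N : ℝ) - 2 + η)) with hIdef
  set D := (bubbleAmplitude N * 4 ^ (((N : ℝ) - 2) / 2)) ^ 2 with hD
  refine ⟨D * 5 ^ η * I, by positivity, fun n hn => ?_⟩
  have hn0 : (0 : ℝ) < n := by exact_mod_cast hn
  have hn1 : (1 : ℝ) ≤ n := by exact_mod_cast hn
  have i1 : Integrable fun x : Eucl N => (1 + (n : ℝ) ^ 2 * ‖x‖ ^ 2) ^ (-((N : ℝ) - 2 + η)) :=
    integrable_bracket_scaled hn (by linarith)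
  have hpt : ∀ x : Eucl N, |bubble N n x| ^ 2 ≤ D * ((n : ℝ) ^ ((N : ℝ) - 2) *
      ((5 * (n : ℝ) ^ 2) ^ η * (1 + (n : ℝ) ^ 2 * ‖x‖ ^ 2) ^ (-((N : ℝ) - 2 + η)))) := by
    intro x
    rw [abs_of_nonneg (bubble_nonneg hN n x)]
    rcases lt_or_ge ‖x‖ 2 with h | h
    · have h1 := pow_le_pow_left₀ (bubble_nonneg hN n x) (bubble_le hN x) 2
      refine h1.trans ?_
      rw [mul_pow]
      refine mul_le_mul_of_nonneg_left ?_ (by positivity)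
      set w := 1 + (n : ℝ) ^ 2 * ‖x‖ ^ 2 with hw
      have hw0 : 0 < w := by positivity
      have hw5 : w ≤ 5 * (n : ℝ) ^ 2 := by
        have : ‖x‖ ^ 2 ≤ 2 ^ 2 := by gcongr
        have h2 : (n : ℝ) ^ 2 * ‖x‖ ^ 2 ≤ (n : ℝ) ^ 2 * 2 ^ 2 := by gcongr
        nlinarith [one_le_pow₀ hn1 (n := 2)]
      have e1 : bubbleCore N n ‖x‖ ^ 2 = (n : ℝ) ^ ((N : ℝ) - 2) * w ^ (-((N : ℝ) - 2)) := by
        rw [bubbleCore_eq, mul_pow, ← hw, ← Real.rpow_natCast, ← Real.rpow_natCast,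
          ← Real.rpow_mul hn0.le, ← Real.rpow_mul hw0.le]
        congr 2 <;> push_cast <;> ring
      rw [e1]
      refine mul_le_mul_of_nonneg_left ?_ (by positivity)
      have e2 : w ^ (-((N : ℝ) - 2)) = w ^ η * w ^ (-((N : ℝ) - 2 + η)) := by
        rw [← Real.rpow_add hw0]
        congr 1
        ring
      rw [e2]
      gcongr
    · rw [bubble_of_two_le h, zero_pow two_ne_zero]
      positivity
  refine (integral_mono_of_nonneg (Eventually.of_forall fun x => sq_nonneg _)
    (((i1.const_mul _).const_mul _).const_mul _) (Eventually.of_forall hpt)).trans (le_of_eq ?_)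
  rw [integral_const_mul, integral_const_mul, integral_const_mul, integral_bracket_scaled hn,
    ← hIdef, Real.mul_rpow (by norm_num) (by positivity)]
  have e3 : (n : ℝ) ^ (2 * η - 2) =
      (n : ℝ) ^ ((N : ℝ) - 2) * ((n : ℝ) ^ 2) ^ η * ((n : ℝ) ^ N)⁻¹ := by
    rw [← Real.rpow_natCast, ← Real.rpow_natCast, ← Real.rpow_mul hn0.le, ← Real.rpow_neg hn0.le,
      ← Real.rpow_add hn0, ← Real.rpow_add hn0]
    congr 1
    push_cast
    ring
  rw [e3]
  ring

/-- The three error terms of the bubble have a common bound `O(n^{2η-2})`, where `η > 0` is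
arbitrary if `N ≥ 4` and `η > 1/2` if `N = 3`. -/
lemma bubble_estimates {N : ℕ} (hN : 3 ≤ N) {η : ℝ} (hη : 0 ≤ η) (hη' : 4 - (N : ℝ) < 2 * η) :
    ∃ C > 0, ∀ n : ℕ, 1 ≤ n → mass (bubble N n) ≤ C * (n : ℝ) ^ (2 * η - 2) ∧
      gradSq (bubble N n) ≤ bubbleEnergy N + C * (n : ℝ) ^ (2 * η - 2) ∧
      bubbleEnergy N - C * (n : ℝ) ^ (2 * η - 2) ≤ ∫ x, bubble N n x ^ critExp N := by
  have hN3 : (3 : ℝ) ≤ N := by exact_mod_cast hN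
  obtain ⟨C, hC, h1⟩ := mass_bubble_le hN hη hη'
  obtain ⟨D, hD, h2⟩ := gradSq_bubble_le hN
  have hK := bubbleEnergy_pos hN
  refine ⟨C + D + 2 ^ N * bubbleEnergy N, by positivity, fun n hn => ?_⟩
  have hn1 : (1 : ℝ) ≤ n := by exact_mod_cast hn
  have e1 : (n : ℝ) ^ (-((N : ℝ) - 2)) ≤ (n : ℝ) ^ (2 * η - 2) :=
    Real.rpow_le_rpow_of_exponent_le hn1 (by linarith)
  have e2 : (n : ℝ) ^ (-(N : ℝ)) ≤ (n : ℝ) ^ (2 * η - 2) :=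
    Real.rpow_le_rpow_of_exponent_le hn1 (by linarith)
  have e0 : 0 < (n : ℝ) ^ (2 * η - 2) := by positivity
  have hKN : 0 < 2 ^ N * bubbleEnergy N := by positivity
  refine ⟨(h1 n hn).trans (mul_le_mul_of_nonneg_right (by linarith) e0.le),
    (h2 n hn).trans ?_, le_trans ?_ (le_integral_bubble_critExp hN hn)⟩
  · nlinarith [mul_le_mul_of_nonneg_left e1 hD.le]
  · nlinarith [mul_le_mul_of_nonneg_left e2 hKN.le]

/-- Near the origin the bubble has size `n^{(N-2)/2}`. -/
lemma exists_bubble_bounds {N : ℕ} (hN : 3 ≤ N) : ∃ c > 0, ∃ C > 0, ∀ n : ℕ, 1 ≤ n →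
    ∀ x : Eucl N, ‖x‖ < (n : ℝ)⁻¹ → c * (n : ℝ) ^ (((N : ℝ) - 2) / 2) ≤ bubble N n x ∧
      bubble N n x ≤ C * (n : ℝ) ^ (((N : ℝ) - 2) / 2) := by
  have hN3 : (3 : ℝ) ≤ N := by exact_mod_cast hN
  have hA := bubbleAmplitude_pos hN
  refine ⟨bubbleAmplitude N * 2 ^ (-(((N : ℝ) - 2) / 2)), by positivity, bubbleAmplitude N, hA,
    fun n hn x hx => ?_⟩
  have hn0 : (0 : ℝ) < n := by exact_mod_cast hn
  have hn1 : (1 : ℝ) ≤ n := by exact_mod_cast hn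
  have hx1 : ‖x‖ < 1 := hx.trans_le (inv_le_one_of_one_le₀ hn1)
  have hnx : (n : ℝ) ^ 2 * ‖x‖ ^ 2 ≤ 1 := by
    rw [← mul_pow]
    refine pow_le_one₀ (by positivity) ?_
    rw [← mul_inv_cancel₀ hn0.ne']
    exact mul_le_mul_of_nonneg_left hx.le hn0.le
  have hb : 1 ≤ 1 + (n : ℝ) ^ 2 * ‖x‖ ^ 2 := le_add_of_nonneg_right (by positivity)
  rw [bubble_of_lt_one hx1, bubbleCore_eq]
  set P := (n : ℝ) ^ (((N : ℝ) - 2) / 2) with hP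
  have hP0 : 0 < P := by positivity
  have e1 : (1 + (n : ℝ) ^ 2 * ‖x‖ ^ 2) ^ (-(((N : ℝ) - 2) / 2)) ≤ 1 :=
    Real.rpow_le_one_of_one_le_of_nonpos hb (by linarith)
  have e2 : (2 : ℝ) ^ (-(((N : ℝ) - 2) / 2)) ≤
      (1 + (n : ℝ) ^ 2 * ‖x‖ ^ 2) ^ (-(((N : ℝ) - 2) / 2)) :=
    Real.rpow_le_rpow_of_nonpos (by positivity) (by linarith) (by linarith)
  constructor
  · rw [mul_assoc, mul_comm P]
    gcongr
  · exact mul_le_mul_of_nonneg_left (mul_le_of_le_one_right hP0.le e1) hA.le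

lemma volume_ball_inv {N n : ℕ} (hN : 3 ≤ N) :
    (volume (Metric.ball (0 : Eucl N) (n : ℝ)⁻¹)).toReal =
      (n : ℝ) ^ (-(N : ℝ)) * (volume (Metric.ball (0 : Eucl N) 1)).toReal := by
  have : Nontrivial (Eucl N) := by
    have : Nonempty (Fin N) := ⟨⟨0, by omega⟩⟩
    infer_instance
  rw [Measure.addHaar_ball _ _ (by positivity), finrank_euclideanSpace, Fintype.card_fin,
    ENNReal.toReal_mul, ENNReal.toReal_ofReal (by positivity), Real.rpow_neg (by positivity),
    Real.rpow_natCast, inv_pow]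

/-- A function bounded below near the origin by a multiple of `n^e` has integral at least of order
`n^{e-N}`. -/
lemma le_integral_of_le_on_ball {N : ℕ} (hN : 3 ≤ N) {n : ℕ} (hn : 1 ≤ n) {f : Eucl N → ℝ}
    (hf : Integrable f) (hf0 : ∀ x, 0 ≤ f x) {c e : ℝ}
    (h : ∀ x : Eucl N, ‖x‖ < (n : ℝ)⁻¹ → c * (n : ℝ) ^ e ≤ f x) :
    c * (volume (Metric.ball (0 : Eucl N) 1)).toReal * (n : ℝ) ^ (e - N) ≤ ∫ x, f x := by
  have hn0 : (0 : ℝ) < n := by exact_mod_cast hn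
  have h1 : ∫ x in Metric.ball (0 : Eucl N) (n : ℝ)⁻¹, c * (n : ℝ) ^ e ≤
      ∫ x in Metric.ball (0 : Eucl N) (n : ℝ)⁻¹, f x :=
    setIntegral_mono_on (integrableOn_const measure_ball_lt_top.ne) hf.integrableOn
      measurableSet_ball fun x hx => h x (by simpa using hx)
  refine le_trans (le_of_eq ?_) (h1.trans (setIntegral_le_integral hf (Eventually.of_forall hf0)))
  rw [setIntegral_const, measureReal_def, volume_ball_inv hN, smul_eq_mul, sub_eq_add_neg,
    Real.rpow_add hn0]
  ring

lemma exists_le_integral_bubble_rpow {N : ℕ} (hN : 3 ≤ N) {p : ℝ} (hp : 2 ≤ p)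
    (hp' : p ≤ critExp N) : ∃ c > 0, ∀ n : ℕ, 1 ≤ n →
      c * (n : ℝ) ^ (((N : ℝ) - 2) / 2 * p - N) ≤ ∫ x, bubble N n x ^ p := by
  obtain ⟨c, hc, C, -, h⟩ := exists_bubble_bounds hN
  have hV : 0 < (volume (Metric.ball (0 : Eucl N) 1)).toReal :=
    ENNReal.toReal_pos (Metric.measure_ball_pos _ _ one_pos).ne' measure_ball_lt_top.ne
  refine ⟨c ^ p * (volume (Metric.ball (0 : Eucl N) 1)).toReal, by positivity, fun n hn => ?_⟩
  have hn0 : (0 : ℝ) < n := by exact_mod_cast hn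
  refine le_integral_of_le_on_ball hN hn ?_ (fun x => Real.rpow_nonneg (bubble_nonneg hN n x) _)
    fun x hx => ?_
  · exact (integrable_rpow_of_memH1 hN (memH1_bubble hN n) hp hp').congr
      (Eventually.of_forall fun x => by simp only [abs_of_nonneg (bubble_nonneg hN n x)])
  · have h1 := (h n hn x hx).1
    rw [Real.rpow_mul hn0.le, ← Real.mul_rpow hc.le (by positivity)]
    exact Real.rpow_le_rpow (by positivity) h1 (by linarith)

/-! ### Pointwise inequalities for powers -/

lemma rpow_mul_rpow_add_le {r s a b x y : ℝ} (hr : 0 ≤ r) (hs : 1 ≤ s) (ha : 0 ≤ a) (hb : 0 ≤ b)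
    (hx : 0 ≤ x) (hy : 0 ≤ y) : a ^ r * b ^ s + x ^ r * y ^ s ≤ (a + x) ^ r * (b + y) ^ s := by
  have h1 := Real.rpow_add_rpow_le_add hb hy hs
  have h2 : a ^ r ≤ (a + x) ^ r := Real.rpow_le_rpow ha (by linarith) hr
  have h3 : x ^ r ≤ (a + x) ^ r := Real.rpow_le_rpow hx (by linarith) hr
  have h4 : b ^ s + y ^ s ≤ (b + y) ^ s := by
    have h5 := Real.rpow_le_rpow (by positivity) h1 (show 0 ≤ s by linarith)
    rwa [← Real.rpow_mul (by positivity), one_div, inv_mul_cancel₀ (by linarith),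
      Real.rpow_one] at h5
  calc a ^ r * b ^ s + x ^ r * y ^ s ≤ (a + x) ^ r * b ^ s + (a + x) ^ r * y ^ s := by gcongr
    _ = (a + x) ^ r * (b ^ s + y ^ s) := by ring
    _ ≤ _ := by gcongr

/-- Superadditivity of `a^α b^β` beyond its first-order expansion. -/
lemma rpow_mul_rpow_expansion_le {α β a b x y : ℝ} (hα : 1 ≤ α) (hβ : 1 ≤ β) (ha : 0 < a)
    (hb : 0 < b) (hx : 0 ≤ x) (hy : 0 ≤ y) :
    a ^ α * b ^ β + α * (a ^ (α - 1) * b ^ β * x) + β * (a ^ α * b ^ (β - 1) * y) + x ^ α * y ^ β ≤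
      (a + x) ^ α * (b + y) ^ β := by
  set L := α * (a ^ (α - 1) * b ^ β * x) + β * (a ^ α * b ^ (β - 1) * y) with hL
  set f : ℝ → ℝ := fun θ => (a + θ * x) ^ α * (b + θ * y) ^ β - θ * L - θ ^ (α + β) * (x ^ α * y ^ β)
    with hf
  set f' : ℝ → ℝ := fun θ => (x * α * (a + θ * x) ^ (α - 1)) * (b + θ * y) ^ β +
    (a + θ * x) ^ α * (y * β * (b + θ * y) ^ (β - 1)) - L -
    (α + β) * θ ^ (α + β - 1) * (x ^ α * y ^ β) with hf'
  have hd : ∀ θ : ℝ, 0 ≤ θ → HasDerivAt f (f' θ) θ := by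
    intro θ hθ
    have h1 : HasDerivAt (fun θ : ℝ => a + θ * x) x θ := by
      simpa using ((hasDerivAt_id θ).mul_const x).const_add a
    have h2 : HasDerivAt (fun θ : ℝ => b + θ * y) y θ := by
      simpa using ((hasDerivAt_id θ).mul_const y).const_add b
    have h3 : HasDerivAt (fun θ : ℝ => θ * L) L θ := by
      simpa using (hasDerivAt_id θ).mul_const L
    have h4 := (Real.hasDerivAt_rpow_const (x := θ) (p := α + β)
      (Or.inr (by linarith))).mul_const (x ^ α * y ^ β)
    have h5 := h1.rpow_const (p := α) (Or.inl (by positivity))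
    have h6 := h2.rpow_const (p := β) (Or.inl (by positivity))
    exact ((h5.mul h6).sub h3).sub h4
  have hpos : ∀ θ : ℝ, 0 ≤ θ → 0 ≤ f' θ := by
    intro θ hθ
    have e1 : ∀ r z : ℝ, 0 ≤ z → 1 ≤ r → z * z ^ (r - 1) = z ^ r := fun r z hz hr => by
      have := Real.rpow_add_one' hz (y := r - 1) (by linarith)
      rw [sub_add_cancel] at this
      rw [this, mul_comm]
    have k1 := rpow_mul_rpow_add_le (r := α - 1) (s := β) (by linarith) hβ ha.le hb.le
      (mul_nonneg hθ hx) (mul_nonneg hθ hy)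
    have k2 := rpow_mul_rpow_add_le (r := β - 1) (s := α) (by linarith) hα hb.le ha.le
      (mul_nonneg hθ hy) (mul_nonneg hθ hx)
    rw [Real.mul_rpow hθ hx, Real.mul_rpow hθ hy] at k1 k2
    have m1 := mul_le_mul_of_nonneg_left k1 (show 0 ≤ x * α by positivity)
    have m2 := mul_le_mul_of_nonneg_left k2 (show 0 ≤ y * β by positivity)
    have e2 : θ ^ (α - 1) * θ ^ β = θ ^ (α + β - 1) := by
      rw [← Real.rpow_add_of_nonneg hθ (by linarith) (by linarith)]
      congr 1
      ring
    have e3 : θ ^ (β - 1) * θ ^ α = θ ^ (α + β - 1) := by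
      rw [← Real.rpow_add_of_nonneg hθ (by linarith) (by linarith)]
      congr 1
      ring
    have t1 : x * α * (θ ^ (α - 1) * x ^ (α - 1) * (θ ^ β * y ^ β)) =
        α * θ ^ (α + β - 1) * (x ^ α * y ^ β) := by
      rw [← e1 α x hx hα, ← e2]
      ring
    have t2 : y * β * (θ ^ (β - 1) * y ^ (β - 1) * (θ ^ α * x ^ α)) =
        β * θ ^ (α + β - 1) * (x ^ α * y ^ β) := by
      rw [← e1 β y hy hβ, ← e3]
      ring
    rw [mul_add, t1] at m1
    rw [mul_add, t2] at m2
    simp only [hf', hL]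
    linarith
  have hmono : MonotoneOn f (Icc 0 1) := by
    refine monotoneOn_of_deriv_nonneg (convex_Icc 0 1)
      (fun θ hθ => (hd θ hθ.1).continuousAt.continuousWithinAt)
      (fun θ hθ => ?_) fun θ hθ => ?_
    · rw [interior_Icc] at hθ
      exact (hd θ hθ.1.le).differentiableAt.differentiableWithinAt
    · rw [interior_Icc] at hθ
      rw [(hd θ hθ.1.le).deriv]
      exact hpos θ hθ.1.le
  have h := hmono (left_mem_Icc.2 zero_le_one) (right_mem_Icc.2 zero_le_one) zero_le_one
  simp only [hf, zero_mul, add_zero, sub_zero, one_mul, Real.one_rpow] at h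
  rw [Real.zero_rpow (by linarith), zero_mul, sub_zero] at h
  linarith

lemma rpow_expansion_le {p a x : ℝ} (hp : 2 ≤ p) (ha : 0 < a) (hx : 0 ≤ x) :
    a ^ p + p * (a ^ (p - 1) * x) + x ^ p ≤ (a + x) ^ p := by
  have h := rpow_mul_rpow_expansion_le (α := p - 1) (β := 1) (by linarith) le_rfl ha ha hx hx
  have e : ∀ z : ℝ, 0 ≤ z → z ^ (p - 1) * z = z ^ p := fun z hz => by
    have := Real.rpow_add_one' hz (y := p - 1) (by linarith)
    rw [sub_add_cancel] at this
    rw [this]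
  have e' : a ^ (p - 1 - 1) * a = a ^ (p - 1) := by
    rw [← Real.rpow_add_one ha.ne', sub_add_cancel]
  rw [sub_self, Real.rpow_zero, mul_one, Real.rpow_one, Real.rpow_one, Real.rpow_one, e', e a ha.le,
    e x hx, e _ (by linarith)] at h
  linarith

/-- The tangent line of the convex function `z^r`. -/
lemma rpow_tangent_le {r a h : ℝ} (hr : 1 ≤ r) (ha : 0 < a) (hh : 0 ≤ a + h) :
    a ^ r + r * (a ^ (r - 1) * h) ≤ (a + h) ^ r := by
  have h1 : -1 ≤ h / a := by rw [le_div_iff₀ ha]; linarith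
  have h2 := mul_le_mul_of_nonneg_left (one_add_mul_self_le_rpow_one_add h1 hr)
    (Real.rpow_nonneg ha.le r)
  rw [← Real.mul_rpow ha.le (by linarith), mul_add, mul_one, mul_add, mul_one,
    mul_div_cancel₀ _ ha.ne'] at h2
  refine le_trans (le_of_eq ?_) h2
  rw [Real.rpow_sub_one ha.ne']
  field_simp

/-! ### The Euler-Lagrange inequality of the minimizer -/

lemma nonneg_of_hasDerivAt_of_eventually_nonneg {f : ℝ → ℝ} {L : ℝ} (hf : HasDerivAt f L 0)
    (h0 : f 0 = 0) (h : ∀ᶠ e in nhdsWithin 0 (Ioi 0), 0 ≤ f e) : 0 ≤ L := by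
  refine ge_of_tendsto hf.tendsto_slope_zero_right ?_
  filter_upwards [h, self_mem_nhdsWithin] with e he he0
  rw [zero_add, h0, sub_zero, smul_eq_mul]
  exact mul_nonneg (inv_nonneg.2 (le_of_lt he0)) he

lemma integral_abs_const_mul_rpow {n : ℕ} (u : Eucl n → ℝ) {c : ℝ} (hc : 0 ≤ c) (p : ℝ) :
    ∫ x, |c * u x| ^ p = c ^ p * ∫ x, |u x| ^ p := by
  rw [← integral_const_mul]
  congr with x
  rw [abs_mul, abs_of_nonneg hc, Real.mul_rpow hc (abs_nonneg _)]

lemma integral_interaction_const_mul {n : ℕ} (u v : Eucl n → ℝ) {c d : ℝ} (hc : 0 ≤ c) (hd : 0 ≤ d)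
    (α β : ℝ) : ∫ x, |c * u x| ^ α * |d * v x| ^ β =
      c ^ α * d ^ β * ∫ x, |u x| ^ α * |v x| ^ β := by
  rw [← integral_const_mul]
  congr with x
  rw [abs_mul, abs_mul, abs_of_nonneg hc, abs_of_nonneg hd, Real.mul_rpow hc (abs_nonneg _),
    Real.mul_rpow hd (abs_nonneg _)]
  ring

lemma energy_swap {N : ℕ} (p q α β μ₁ μ₂ ν : ℝ) (u v : Eucl N → ℝ) :
    energy p q α β μ₁ μ₂ ν u v = energy q p β α μ₂ μ₁ ν v u := by
  rw [energy, energy]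
  simp_rw [mul_comm (|u _| ^ α)]
  ring

/-- Weighted products `u^{r-1} w U` are integrable as soon as `u^r w` is, if `U ≤ κ u`. -/
lemma integrable_rpow_sub_one_mul {n : ℕ} {u w U : Eucl n → ℝ} {r κ : ℝ}
    (hu0 : ∀ x, 0 < u x) (hw0 : ∀ x, 0 ≤ w x) (hU0 : ∀ x, 0 ≤ U x) (hU : ∀ x, U x ≤ κ * u x)
    (hum : AEStronglyMeasurable u volume) (hwm : AEStronglyMeasurable w volume)
    (hUm : AEStronglyMeasurable U volume) (hi : Integrable fun x => u x ^ r * w x) :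
    Integrable fun x => u x ^ (r - 1) * w x * U x := by
  refine (hi.const_mul κ).mono' (((hum.aemeasurable.pow_const _).mul hwm.aemeasurable).mul
    hUm.aemeasurable).aestronglyMeasurable (Eventually.of_forall fun x => ?_)
  have h0 := hu0 x
  have h1 : 0 ≤ u x ^ (r - 1) * w x := mul_nonneg (by positivity) (hw0 x)
  rw [Real.norm_of_nonneg (mul_nonneg h1 (hU0 x))]
  refine (mul_le_mul_of_nonneg_left (hU x) h1).trans (le_of_eq ?_)
  rw [Real.rpow_sub_one h0.ne']
  field_simp

/-- The Euler-Lagrange equation of a minimizer on the mass constraint, in the form of the one-sided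
inequality that results from the variations `u - e U`, `e > 0`, for `0 ≤ U ≤ κ u`. -/
lemma euler_lagrange_le {N : ℕ} (hN : 3 ≤ N) {p q α β μ₁ μ₂ ν a₁ ρ κ : ℝ} {u v U : Eucl N → ℝ}
    (hp : 2 < p) (hp' : p < critExp N) (hα : 1 < α) (hβ : 1 < β) (hαβ : α + β = critExp N)
    (hμ₁ : 0 < μ₁) (hν : 0 < ν) (ha : 0 < a₁) (hu : MemH1 u) (hv : MemH1 v) (hU : MemH1 U)
    (hmass : mass u = a₁) (hgrad : gradSq u + gradSq v < ρ)
    (hu0 : ∀ x, 0 < u x) (hv0 : ∀ x, 0 < v x)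
    (hmin : ∀ w, MemH1 w → mass w = a₁ → gradSq w + gradSq v < ρ →
      energy p q α β μ₁ μ₂ ν u v ≤ energy p q α β μ₁ μ₂ ν w v)
    (hU0 : ∀ x, 0 ≤ U x) (hUκ : ∀ x, U x ≤ κ * u x) :
    gradInner u U - μ₁ * (∫ x, u x ^ (p - 1) * U x) - ν * α * (∫ x, u x ^ (α - 1) * v x ^ β * U x) ≤
      (∫ x, u x * U x) / a₁ * (gradSq u - μ₁ * (∫ x, u x ^ p) - ν * α * ∫ x, u x ^ α * v x ^ β) := by
  have iP : Integrable fun x => u x ^ p :=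
    (integrable_rpow_of_memH1 hN hu hp.le hp'.le).congr
      (Eventually.of_forall fun x => by simp only [abs_of_pos (hu0 x)])
  have iR : Integrable fun x => u x ^ α * v x ^ β :=
    (integrable_interaction hN hu hv (by linarith) (by linarith) hαβ).congr
      (Eventually.of_forall fun x => by simp only [abs_of_pos (hu0 x), abs_of_pos (hv0 x)])
  have iP' : Integrable fun x => u x ^ (p - 1) * U x := by
    have := integrable_rpow_sub_one_mul (w := fun _ => 1) hu0 (fun _ => zero_le_one) hU0 hUκ hu.1.1
      aestronglyMeasurable_const hU.1.1 (r := p) (by simpa using iP)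
    simpa using this
  have iR' : Integrable fun x => u x ^ (α - 1) * v x ^ β * U x :=
    integrable_rpow_sub_one_mul hu0 (fun x => Real.rpow_nonneg (hv0 x).le β) hU0 hUκ hu.1.1
      (hv.1.1.aemeasurable.pow_const _).aestronglyMeasurable hU.1.1 iR
  set G := gradSq u with hG
  set D := gradInner u U with hD
  set A := gradSq U with hA
  set I := ∫ x, u x * U x with hI
  set W := mass U with hW
  set P := ∫ x, u x ^ p with hP
  set P' := ∫ x, u x ^ (p - 1) * U x with hP'
  set R := ∫ x, u x ^ α * v x ^ β with hR
  set R' := ∫ x, u x ^ (α - 1) * v x ^ β * U x with hR'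
  -- the normalization factor, squared
  set k : ℝ → ℝ := fun e => a₁ / (a₁ + 2 * (-e) * I + (-e) ^ 2 * W) with hk
  have hk0 : k 0 = 1 := by simp [hk, ha.ne']
  have hkd : HasDerivAt k (2 * I / a₁) 0 := by
    have h1 : HasDerivAt (fun e : ℝ => a₁ + 2 * (-e) * I + (-e) ^ 2 * W) (-2 * I) 0 := by
      have h2 : HasDerivAt (fun e : ℝ => -e) (-1) 0 := (hasDerivAt_id (0 : ℝ)).neg
      have := (((h2.const_mul 2).mul_const I).const_add a₁).add ((h2.pow 2).mul_const W)
      refine this.congr_deriv ?_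
      simp
    have h3 := (hasDerivAt_const (0 : ℝ) a₁).div h1 (by simpa using ha.ne')
    refine h3.congr_deriv ?_
    rw [show a₁ + 2 * -0 * I + (-0) ^ 2 * W = a₁ by ring]
    field_simp
    ring
  have hkr : ∀ r : ℝ, HasDerivAt (fun e => k e ^ (r / 2)) (r * (I / a₁)) 0 := fun r => by
    refine (hkd.rpow_const (p := r / 2) (Or.inl (by rw [hk0]; exact one_ne_zero))).congr_deriv ?_
    rw [hk0, Real.one_rpow]
    ring
  have hlin : ∀ c Y Y' : ℝ, HasDerivAt (fun e : ℝ => Y - c * (e * Y')) (-(c * Y')) 0 :=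
    fun c Y Y' => by
      have := (((hasDerivAt_id (0 : ℝ)).mul_const Y').const_mul c).const_sub Y
      simpa using this
  set F : ℝ → ℝ := fun e => 1 / 2 * (k e * (G + 2 * (-e) * D + (-e) ^ 2 * A) - G)
    - μ₁ / p * (k e ^ (p / 2) * (P - p * (e * P')) - P)
    - ν * (k e ^ (α / 2) * (R - α * (e * R')) - R) with hF
  have hFd : HasDerivAt F (1 / 2 * (2 * I / a₁ * G - 2 * D) - μ₁ / p * (p * (I / a₁) * P - p * P')
      - ν * (α * (I / a₁) * R - α * R')) 0 := by
    have h1 : HasDerivAt (fun e : ℝ => G + 2 * (-e) * D + (-e) ^ 2 * A) (-2 * D) 0 := by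
      have h2 : HasDerivAt (fun e : ℝ => -e) (-1) 0 := (hasDerivAt_id (0 : ℝ)).neg
      have := (((h2.const_mul 2).mul_const D).const_add G).add ((h2.pow 2).mul_const A)
      refine this.congr_deriv ?_
      simp
    have g1 := ((hkd.mul h1).sub_const G).const_mul (1 / 2)
    have g2 := (((hkr p).mul (hlin p P P')).sub_const P).const_mul (μ₁ / p)
    have g3 := (((hkr α).mul (hlin α R R')).sub_const R).const_mul ν
    refine ((g1.sub g2).sub g3).congr_deriv ?_
    simp only [hk0, Real.one_rpow]
    ring
  have hF0 : F 0 = 0 := by simp [hF, hk0]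
  have hev : ∀ᶠ e in nhdsWithin 0 (Ioi (0 : ℝ)), 0 ≤ F e := by
    have c1 : ∀ᶠ e in nhds (0 : ℝ), 0 < a₁ + 2 * (-e) * I + (-e) ^ 2 * W := by
      refine ContinuousAt.eventually_lt continuousAt_const ?_ (by simpa using ha)
      fun_prop
    have c2 : ∀ᶠ e in nhds (0 : ℝ), k e * (G + 2 * (-e) * D + (-e) ^ 2 * A) + gradSq v < ρ := by
      refine ContinuousAt.eventually_lt ?_ continuousAt_const (by simpa [hk0] using hgrad)
      have := hkd.continuousAt
      exact (this.mul (by fun_prop)).add continuousAt_const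
    have c3 : ∀ᶠ e in nhds (0 : ℝ), e * κ < 1 := by
      refine ContinuousAt.eventually_lt ?_ continuousAt_const (by simp)
      fun_prop
    filter_upwards [nhdsWithin_le_nhds c1, nhdsWithin_le_nhds c2, nhdsWithin_le_nhds c3,
      self_mem_nhdsWithin] with e h1 h2 h3 he
    have he : 0 < e := he
    set w : Eucl N → ℝ := fun x => u x + (-e) * U x with hw
    have hwH : MemH1 w := hu.add (hU.const_mul (-e))
    have hwm : mass w = a₁ + 2 * (-e) * I + (-e) ^ 2 * W := by
      rw [hw, mass_add_mul hu.1 hU.1, hmass]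
    have hwg : gradSq w = G + 2 * (-e) * D + (-e) ^ 2 * A := gradSq_add_mul hu hU (-e)
    have hke : 0 < k e := div_pos ha h1
    set c := √(k e) with hc
    have hc0 : 0 ≤ c := Real.sqrt_nonneg _
    have hc2 : c ^ 2 = k e := Real.sq_sqrt hke.le
    have hcr : ∀ r : ℝ, c ^ r = k e ^ (r / 2) := fun r => by
      rw [← hc2, ← Real.rpow_natCast, ← Real.rpow_mul hc0]
      congr 1
      push_cast
      ring
    have hw0 : ∀ x, 0 ≤ w x := fun x => by
      have := mul_le_mul_of_nonneg_left (hUκ x) he.le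
      have h4 : e * κ * u x ≤ 1 * u x := mul_le_mul_of_nonneg_right h3.le (hu0 x).le
      simp only [hw]
      linarith
    have hJ := hmin (fun x => c * w x) (hwH.const_mul c)
      (by rw [mass_const_mul, hc2, hwm]; exact div_mul_cancel₀ _ h1.ne')
      (by rw [gradSq_const_mul hwH, hc2, hwg]; exact h2)
    have hJ1 : ∫ x, |c * w x| ^ p = k e ^ (p / 2) * ∫ x, w x ^ p := by
      rw [integral_abs_const_mul_rpow w hc0, hcr]
      simp_rw [abs_of_nonneg (hw0 _)]
    have hJ2 : ∫ x, |c * w x| ^ α * |v x| ^ β = k e ^ (α / 2) * ∫ x, w x ^ α * v x ^ β := by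
      have := integral_interaction_const_mul w v hc0 zero_le_one α β
      simp_rw [one_mul, Real.one_rpow, mul_one] at this
      rw [this, hcr]
      simp_rw [abs_of_nonneg (hw0 _), abs_of_pos (hv0 _)]
    rw [energy, energy, gradSq_const_mul hwH, hc2, hwg, hJ1, hJ2] at hJ
    simp_rw [abs_of_pos (hu0 _), abs_of_pos (hv0 _)] at hJ
    have l1 : P - p * (e * P') ≤ ∫ x, w x ^ p := by
      rw [hP, hP', ← integral_const_mul, ← integral_const_mul,
        ← integral_sub iP ((iP'.const_mul e).const_mul p)]
      refine integral_mono (iP.sub ((iP'.const_mul e).const_mul p))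
        ((integrable_rpow_of_memH1 hN hwH hp.le hp'.le).congr
          (Eventually.of_forall fun x => by simp only [abs_of_nonneg (hw0 x)])) fun x => ?_
      have := rpow_tangent_le (r := p) (h := -e * U x) (by linarith) (hu0 x) (hw0 x)
      simp only [hw]
      linarith
    have l2 : R - α * (e * R') ≤ ∫ x, w x ^ α * v x ^ β := by
      rw [hR, hR', ← integral_const_mul, ← integral_const_mul,
        ← integral_sub iR ((iR'.const_mul e).const_mul α)]
      refine integral_mono (iR.sub ((iR'.const_mul e).const_mul α))
        ((integrable_interaction hN hwH hv (by linarith) (by linarith) hαβ).congr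
          (Eventually.of_forall fun x => by
            simp only [abs_of_nonneg (hw0 x), abs_of_pos (hv0 x)])) fun x => ?_
      have := mul_le_mul_of_nonneg_right (rpow_tangent_le (r := α) (h := -e * U x) hα.le
        (hu0 x) (hw0 x)) (Real.rpow_nonneg (hv0 x).le β)
      simp only [hw]
      linarith
    have m1 := mul_le_mul_of_nonneg_left (mul_le_mul_of_nonneg_left l1
      (show 0 ≤ k e ^ (p / 2) by positivity)) (show 0 ≤ μ₁ / p by positivity)
    have m2 := mul_le_mul_of_nonneg_left (mul_le_mul_of_nonneg_left l2
      (show 0 ≤ k e ^ (α / 2) by positivity)) hν.le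
    simp only [hF]
    linarith
  have hfin := nonneg_of_hasDerivAt_of_eventually_nonneg hFd hF0 hev
  have e1 : μ₁ / p * (p * (I / a₁) * P - p * P') = μ₁ * (I / a₁ * P - P') := by
    field_simp
  have e2 : 2 * I / a₁ = 2 * (I / a₁) := by ring
  rw [e1, e2] at hfin
  linarith

/-! ### Expansion of the energy along the normalized path -/

/-- The factor `√a / ‖u‖_2` that normalizes `u` to the mass `a`. -/
def massFactor {N : ℕ} (a : ℝ) (u : Eucl N → ℝ) : ℝ := √a / √(mass u)

lemma normalizeMass_eq {N : ℕ} (a : ℝ) (u : Eucl N → ℝ) :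
    normalizeMass a u = fun x => massFactor a u * u x := rfl

lemma integral_mul_le_sqrt_mass {N : ℕ} {u U : Eucl N → ℝ} (hu : MemLp u 2 volume)
    (hU : MemLp U 2 volume) : ∫ x, u x * U x ≤ √(mass u) * √(mass U) := by
  have h : ∀ t : ℝ, 0 ≤ mass U * (t * t) + 2 * (∫ x, u x * U x) * t + mass u := fun t => by
    have h1 := mass_nonneg (fun x => u x + t * U x)
    rw [mass_add_mul hu hU] at h1
    linarith
  have h2 := discrim_le_zero h
  rw [discrim] at h2
  rw [← Real.sqrt_mul (mass_nonneg u)]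
  exact Real.le_sqrt_of_sq_le (by linarith)

/-- The normalization factor of `u + t U` is `1 - O(‖U‖_2)`. -/
lemma massFactor_spec {N : ℕ} {a t T : ℝ} {u U : Eucl N → ℝ} (ha : 0 < a) (hu : MemLp u 2 volume)
    (hU : MemLp U 2 volume) (hm : mass u = a) (hI : 0 ≤ ∫ x, u x * U x) (hW : mass U ≤ 1)
    (ht : 0 ≤ t) (htT : t ≤ T) :
    let σ := massFactor a (fun x => u x + t * U x)
    0 < σ ∧ σ ≤ 1 ∧ σ ^ 2 * (a + 2 * t * (∫ x, u x * U x) + t ^ 2 * mass U) = a ∧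
      0 ≤ (σ ^ 2)⁻¹ - 1 ∧ (σ ^ 2)⁻¹ - 1 ≤ (2 * T * √a + T ^ 2) / a * √(mass U) ∧
      1 - σ ≤ (2 * T * √a + T ^ 2) / a * √(mass U) := by
  intro σ
  set I := ∫ x, u x * U x
  set W := mass U with hWdef
  have hW0 : 0 ≤ W := mass_nonneg U
  have hM : 0 < a + 2 * t * I + t ^ 2 * W := by positivity
  have hσ : σ = √a / √(a + 2 * t * I + t ^ 2 * W) := by
    simp only [σ, massFactor]
    rw [mass_add_mul hu hU, hm]
  have hσ0 : 0 < σ := by rw [hσ]; positivity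
  have hσ2 : σ ^ 2 = a / (a + 2 * t * I + t ^ 2 * W) := by
    rw [hσ, div_pow, Real.sq_sqrt ha.le, Real.sq_sqrt hM.le]
  have hinv : (σ ^ 2)⁻¹ - 1 = (2 * t * I + t ^ 2 * W) / a := by
    rw [hσ2, inv_div]
    field_simp
    ring
  have h0 : 0 ≤ (σ ^ 2)⁻¹ - 1 := by rw [hinv]; positivity
  have hσ1 : σ ≤ 1 := by
    have h1 : 1 ≤ (σ ^ 2)⁻¹ := by linarith
    have h2 := (one_le_inv₀ (by positivity)).1 h1
    nlinarith
  have hW1 : √W ≤ 1 := Real.sqrt_le_one.2 hW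
  have hWs : √W * √W = W := Real.mul_self_sqrt hW0
  have hle : (σ ^ 2)⁻¹ - 1 ≤ (2 * T * √a + T ^ 2) / a * √W := by
    rw [hinv, div_mul_eq_mul_div]
    refine div_le_div_of_nonneg_right ?_ ha.le
    have h1 : I ≤ √a * √W := by
      have := integral_mul_le_sqrt_mass hu hU
      rwa [hm] at this
    have hT : 0 ≤ T := ht.trans htT
    have h2 : 2 * t * I ≤ 2 * T * (√a * √W) := by gcongr
    have h3 : W ≤ √W := by
      rw [← hWs]
      exact mul_le_of_le_one_left (Real.sqrt_nonneg _) hW1 |>.trans_eq (by rw [hWs])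
    have h4 : t ^ 2 * W ≤ T ^ 2 * √W := by gcongr
    linarith
  refine ⟨hσ0, hσ1, ?_, h0, hle, le_trans ?_ hle⟩
  · rw [hσ2]
    exact div_mul_cancel₀ _ hM.ne'
  · have h1 : (σ ^ 2)⁻¹ - 1 - (1 - σ) = (1 - σ) * (1 + σ - σ ^ 2) * (σ ^ 2)⁻¹ := by
      field_simp
      ring
    have h2 : 0 ≤ (1 - σ) * (1 + σ - σ ^ 2) * (σ ^ 2)⁻¹ :=
      mul_nonneg (mul_nonneg (by linarith) (by nlinarith)) (by positivity)
    linarith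

/-- The terms of the expansion that are linear in the perturbation cancel against the change of the
normalization, by the Euler-Lagrange inequality; a quadratic error remains. -/
lemma first_order_defect_le {G D P P' R R' I a p μ ν α β t T y c σ s w ε : ℝ}
    (ha : 0 < a) (hp : 0 < p) (hμ : 0 ≤ μ) (hν : 0 ≤ ν) (hα : 0 < α) (hβ : 0 < β) (hG : 0 ≤ G)
    (hP : 0 ≤ P) (hP' : 0 ≤ P') (hR' : 0 ≤ R') (ht : 0 ≤ t) (htT : t ≤ T) (hy : 0 ≤ y)
    (hc : 0 ≤ c) (hσ : 0 < σ) (hσ1 : σ ≤ 1) (hmass : σ ^ 2 * (a + 2 * t * I + t ^ 2 * y ^ 2) = a)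
    (hEL : D - μ * P' - ν * α * R' ≤ I / a * (G - μ * P - ν * α * R))
    (hδ : 1 - σ ≤ c * y) (hε : ε ≤ c * y) (hP'y : P' ≤ c * y) (hR'y : R' ≤ c * y)
    (hs : 1 - p * (1 - σ) ≤ s) (hw : 1 - α * (1 - σ) - β * ε ≤ w) :
    1 / 2 * (σ ^ 2 - 1) * G + σ ^ 2 * t * D + μ / p * (1 - s) * P - s * (μ * t * P')
        - ν * w * (α * t * R') + ν * α * (1 - σ) * R ≤
      (|G - μ * P - ν * α * R| * (c ^ 2 / 2 + T ^ 2 / (2 * a)) + 1 / 2 * c ^ 2 * G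
        + p * μ * T * c ^ 2 + ν * (α + β) * α * T * c ^ 2) * y ^ 2 := by
  set Λ := G - μ * P - ν * α * R with hΛ
  set δ := 1 - σ with hδdef
  have hδ0 : 0 ≤ δ := by linarith
  have hT : 0 ≤ T := ht.trans htT
  have hcy : 0 ≤ c * y := mul_nonneg hc hy
  have hσ2 : σ ^ 2 ≤ 1 := pow_le_one₀ hσ.le hσ1
  have hδ2 : δ ^ 2 ≤ c ^ 2 * y ^ 2 := by
    rw [← mul_pow]
    exact pow_le_pow_left₀ hδ0 hδ 2
  have h1 : μ / p * (1 - s) * P ≤ μ * δ * P := by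
    have : μ / p * (1 - s) ≤ μ / p * (p * δ) := mul_le_mul_of_nonneg_left (by linarith)
      (by positivity)
    rw [show μ / p * (p * δ) = μ * δ by field_simp] at this
    exact mul_le_mul_of_nonneg_right this hP
  have h2 : (σ ^ 2 - s) * (μ * t * P') ≤ p * μ * T * c ^ 2 * y ^ 2 := by
    calc (σ ^ 2 - s) * (μ * t * P') ≤ (p * δ) * (μ * t * P') :=
          mul_le_mul_of_nonneg_right (by linarith) (by positivity)
      _ ≤ (p * (c * y)) * (μ * T * (c * y)) := by gcongr
      _ = _ := by ring
  have h3 : ν * (σ ^ 2 - w) * (α * t * R') ≤ ν * (α + β) * α * T * c ^ 2 * y ^ 2 := by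
    calc ν * (σ ^ 2 - w) * (α * t * R') ≤ ν * (α * δ + β * ε) * (α * t * R') :=
          mul_le_mul_of_nonneg_right (mul_le_mul_of_nonneg_left (by linarith) hν) (by positivity)
      _ ≤ ν * (α * (c * y) + β * (c * y)) * (α * T * (c * y)) := by gcongr
      _ = _ := by ring
  have h4 := mul_le_mul_of_nonneg_left hEL (show 0 ≤ σ ^ 2 * t by positivity)
  have h5 : σ ^ 2 * t * (I / a * Λ) = Λ * (δ - δ ^ 2 / 2 - 1 / 2 * σ ^ 2 * t ^ 2 * y ^ 2 / a) := by
    have h6 : 2 * (σ ^ 2 * t * I) = a - a * σ ^ 2 - σ ^ 2 * t ^ 2 * y ^ 2 := by linarith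
    have h7 : σ ^ 2 * t * I / a = δ - δ ^ 2 / 2 - 1 / 2 * σ ^ 2 * t ^ 2 * y ^ 2 / a := by
      rw [hδdef]
      field_simp
      linarith
    rw [← h7]
    ring
  have h6 : -(Λ * (δ ^ 2 / 2 + 1 / 2 * σ ^ 2 * t ^ 2 * y ^ 2 / a)) ≤
      |Λ| * (c ^ 2 / 2 + T ^ 2 / (2 * a)) * y ^ 2 := by
    have h7 : 1 / 2 * σ ^ 2 * t ^ 2 * y ^ 2 / a ≤ T ^ 2 / (2 * a) * y ^ 2 := by
      calc 1 / 2 * σ ^ 2 * t ^ 2 * y ^ 2 / a ≤ 1 / 2 * 1 * T ^ 2 * y ^ 2 / a := by gcongr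
        _ = _ := by ring
    have h8 : 0 ≤ δ ^ 2 / 2 + 1 / 2 * σ ^ 2 * t ^ 2 * y ^ 2 / a := by positivity
    calc -(Λ * (δ ^ 2 / 2 + 1 / 2 * σ ^ 2 * t ^ 2 * y ^ 2 / a))
        ≤ |Λ| * (δ ^ 2 / 2 + 1 / 2 * σ ^ 2 * t ^ 2 * y ^ 2 / a) := by
          rw [← neg_mul]
          exact mul_le_mul_of_nonneg_right (neg_le_abs Λ) h8
      _ ≤ |Λ| * (c ^ 2 * y ^ 2 / 2 + T ^ 2 / (2 * a) * y ^ 2) := by gcongr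
      _ = _ := by ring
  have h7 : 1 / 2 * δ ^ 2 * G ≤ 1 / 2 * (c ^ 2 * y ^ 2) * G := by gcongr
  have h8 : 1 / 2 * (σ ^ 2 - 1) * G = -δ * G + 1 / 2 * δ ^ 2 * G := by
    rw [hδdef]
    ring
  have h9 : ν * α * δ * R = δ * (G - μ * P - Λ) := by
    rw [hΛ]
    ring
  rw [h8, h9]
  linarith

lemma one_sub_le_rpow {z r : ℝ} (hz : 0 < z) (hr : 1 ≤ r) : 1 - r * (1 - z) ≤ z ^ r := by
  have := one_add_mul_self_le_rpow_one_add (s := z - 1) (p := r) (by linarith) hr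
  rw [add_sub_cancel] at this
  linarith

lemma one_sub_le_rpow_mul_rpow {z w α β : ℝ} (hz : 0 < z) (hz1 : z ≤ 1) (hw : 0 < w) (hw1 : w ≤ 1)
    (hα : 1 ≤ α) (hβ : 1 ≤ β) : 1 - α * (1 - z) - β * (1 - w) ≤ z ^ α * w ^ β := by
  have h1 := one_sub_le_rpow hz hα
  have h2 := one_sub_le_rpow hw hβ
  have h3 := mul_nonneg (sub_nonneg.2 (Real.rpow_le_one hz.le hz1 (by linarith : 0 ≤ α)))
    (sub_nonneg.2 (Real.rpow_le_one hw.le hw1 (by linarith : 0 ≤ β)))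
  linarith

/-- The remainder of the interaction integral beyond its first-order expansion at `(u, v)`. -/
def interactionRemainder {N : ℕ} (α β : ℝ) (u v U : Eucl N → ℝ) (t s : ℝ) : ℝ :=
  ∫ x, ((u x + t * U x) ^ α * (v x + s * U x) ^ β - u x ^ α * v x ^ β
    - α * t * (u x ^ (α - 1) * v x ^ β * U x) - β * s * (v x ^ (β - 1) * u x ^ α * U x))

/-- As the energy is bounded below on `A_{ρ₀}`, the infimum `m_ν` is a genuine lower bound. -/
lemma IsLocalMinimizer.minimal {N : ℕ} (hN : 3 ≤ N) {p q α β μ₁ μ₂ ν ρ₀ a₁ b₁ : ℝ}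
    (hp : 2 < p) (hp' : p < 2 + 4 / (N : ℝ)) (hq : 2 < q) (hq' : q < 2 + 4 / (N : ℝ))
    (hα : 1 < α) (hβ : 1 < β) (hαβ : α + β = critExp N) (hμ₁ : 0 < μ₁) (hμ₂ : 0 < μ₂) (hν : 0 < ν)
    {u v : Eucl N → ℝ} (h : IsLocalMinimizer N p q α β μ₁ μ₂ ν ρ₀ a₁ b₁ u v) :
    ∀ w ∈ setA N a₁ b₁ ρ₀, energy p q α β μ₁ μ₂ ν u v ≤ energy p q α β μ₁ μ₂ ν w.1 w.2 := by
  intro w hw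
  have hρ : 0 < ρ₀ := lt_of_le_of_lt (add_nonneg (gradSq_nonneg w.1) (gradSq_nonneg w.2)) hw.2
  rw [h.attains]
  exact csInf_le (bddBelow_energy hN hp hp' hq hq' hα hβ hαβ hμ₁ hμ₂ hν.le hρ) ⟨w, hw, rfl⟩

lemma integral_mul_le_const_mul {N : ℕ} {f w U : Eucl N → ℝ} {c : ℝ} (hf : ∀ x, 0 ≤ f x)
    (hfw : ∀ x, f x ≤ c * w x) (hU : ∀ x, 0 ≤ U x) (hi : Integrable fun x => w x * U x) :
    ∫ x, f x * U x ≤ c * ∫ x, w x * U x := by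
  rw [← integral_const_mul]
  refine integral_mono_of_nonneg (Eventually.of_forall fun x => mul_nonneg (hf x) (hU x))
    (hi.const_mul c) (Eventually.of_forall fun x => ?_)
  simp only
  rw [← mul_assoc]
  exact mul_le_mul_of_nonneg_right (hfw x) (hU x)

lemma rpow_sub_one_le {z M p : ℝ} (hz : 0 < z) (hM : z ≤ M) (hp : 2 ≤ p) :
    z ^ (p - 1) ≤ M ^ (p - 2) * z := by
  have h1 : z ^ (p - 1) = z ^ (p - 2) * z := by
    rw [← Real.rpow_add_one hz.ne']
    congr 1
    ring
  rw [h1]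
  exact mul_le_mul_of_nonneg_right (Real.rpow_le_rpow hz.le hM (by linarith)) hz.le

lemma rpow_mul_rpow_le_mul {z w M L α β : ℝ} (hz : 0 < z) (hw : 0 < w) (hM : z ≤ M) (hL : w ≤ L)
    (hα : 1 ≤ α) (hβ : 1 ≤ β) : z ^ (α - 1) * w ^ β ≤ M ^ (α - 1) * L ^ (β - 1) * w := by
  have h1 : w ^ β = w ^ (β - 1) * w := by
    rw [← Real.rpow_add_one hw.ne', sub_add_cancel]
  have hM0 : 0 < M := hz.trans_le hM
  rw [h1, ← mul_assoc]
  refine mul_le_mul_of_nonneg_right (mul_le_mul (Real.rpow_le_rpow hz.le hM (by linarith))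
    (Real.rpow_le_rpow hw.le hL (by linarith)) (by positivity) (by positivity)) hw.le

set_option maxHeartbeats 1000000 in
/-- Energy of the normalized perturbation `(u + t U, v + s U)` of the minimizer, for small `‖U‖_2`:
up to `O(‖U‖_2^2)`, only the gradient of the bubble, the interaction remainder and the
`L^p`-contribution of the bubble are left. -/
lemma exists_energy_normalized_le {N : ℕ} (hN : 3 ≤ N) {p q α β μ₁ μ₂ ν ρ₀ a₁ b₁ : ℝ}
    (hp : 2 < p) (hp' : p < 2 + 4 / (N : ℝ)) (hq : 2 < q) (hq' : q < 2 + 4 / (N : ℝ))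
    (hα : 1 < α) (hβ : 1 < β) (hαβ : α + β = critExp N) (hμ₁ : 0 < μ₁) (hμ₂ : 0 < μ₂) (hν : 0 < ν)
    (ha : 0 < a₁) (hb : 0 < b₁) {u v : Eucl N → ℝ}
    (h : IsLocalMinimizer N p q α β μ₁ μ₂ ν ρ₀ a₁ b₁ u v) {T : ℝ} (hT : 0 ≤ T) :
    ∃ C ≥ 0, ∀ U : Eucl N → ℝ, MemH1 U → (∀ x, 0 ≤ U x) →
      (∃ κ, ∀ x, U x ≤ κ * u x ∧ U x ≤ κ * v x) → mass U ≤ 1 →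
      ∀ t, 0 ≤ t → t ≤ T → ∀ s, 0 ≤ s → s ≤ T → ∀ σ τ,
      σ = massFactor a₁ (fun x => u x + t * U x) → τ = massFactor b₁ (fun x => v x + s * U x) →
      energy p q α β μ₁ μ₂ ν (fun x => σ * (u x + t * U x)) (fun x => τ * (v x + s * U x)) ≤
        localInf N p q α β μ₁ μ₂ ν ρ₀ a₁ b₁ + 1 / 2 * (σ ^ 2 * t ^ 2 + τ ^ 2 * s ^ 2) * gradSq U
          - μ₁ / p * σ ^ p * (t ^ p * ∫ x, U x ^ p)
          - ν * (σ ^ α * τ ^ β) * interactionRemainder α β u v U t s + C * mass U := by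
  have hpc := lt_critExp_of_lt hN hp'
  have hqc := lt_critExp_of_lt hN hq'
  have hmin := h.minimal hN hp hp' hq hq' hα hβ hαβ hμ₁ hμ₂ hν
  obtain ⟨⟨⟨hu, hv, hmu, hmv⟩, hgr⟩, hatt, hu0, hv0, hsu, hsv⟩ := h
  simp only at hu hv hmu hmv hgr
  set M := u 0 with hM
  set L := v 0 with hL
  have huM : ∀ x, u x ≤ M := fun x => hsu 0 x (by simp)
  have hvL : ∀ x, v x ≤ L := fun x => hsv 0 x (by simp)
  have hM0 : 0 < M := hu0 0
  have hL0 : 0 < L := hv0 0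
  set G := gradSq u with hG
  set K := gradSq v with hK
  set P := ∫ x, u x ^ p with hP
  set Q := ∫ x, v x ^ q with hQ
  set R := ∫ x, u x ^ α * v x ^ β with hR
  set c := (2 * T * √a₁ + T ^ 2) / a₁ + (2 * T * √b₁ + T ^ 2) / b₁ + M ^ (p - 2) * √a₁ +
    L ^ (q - 2) * √b₁ + M ^ (α - 1) * L ^ (β - 1) * √b₁ + L ^ (β - 1) * M ^ (α - 1) * √a₁ with hc
  have n1 : 0 ≤ (2 * T * √a₁ + T ^ 2) / a₁ := by positivity
  have n2 : 0 ≤ (2 * T * √b₁ + T ^ 2) / b₁ := by positivity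
  have n3 : 0 ≤ M ^ (p - 2) * √a₁ := by positivity
  have n4 : 0 ≤ L ^ (q - 2) * √b₁ := by positivity
  have n5 : 0 ≤ M ^ (α - 1) * L ^ (β - 1) * √b₁ := by positivity
  have n6 : 0 ≤ L ^ (β - 1) * M ^ (α - 1) * √a₁ := by positivity
  have hc0 : 0 ≤ c := by rw [hc]; positivity
  set C₁ := |G - μ₁ * P - ν * α * R| * (c ^ 2 / 2 + T ^ 2 / (2 * a₁)) + 1 / 2 * c ^ 2 * G
        + p * μ₁ * T * c ^ 2 + ν * (α + β) * α * T * c ^ 2 with hC₁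
  set C₂ := |K - μ₂ * Q - ν * β * R| * (c ^ 2 / 2 + T ^ 2 / (2 * b₁)) + 1 / 2 * c ^ 2 * K
        + q * μ₂ * T * c ^ 2 + ν * (β + α) * β * T * c ^ 2 with hC₂
  have hG0 : 0 ≤ G := gradSq_nonneg u
  have hK0 : 0 ≤ K := gradSq_nonneg v
  refine ⟨C₁ + C₂, by positivity, fun U hU hU0 hκ hW t ht htT s hs hsT σ τ hσ hτ => ?_⟩
  obtain ⟨κ, hκ⟩ := hκ
  -- integrability
  have iP : Integrable fun x => u x ^ p := (integrable_rpow_of_memH1 hN hu hp.le hpc.le).congr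
      (Eventually.of_forall fun x => by simp only [abs_of_pos (hu0 x)])
  have iQ : Integrable fun x => v x ^ q := (integrable_rpow_of_memH1 hN hv hq.le hqc.le).congr
      (Eventually.of_forall fun x => by simp only [abs_of_pos (hv0 x)])
  have iU : Integrable fun x => U x ^ p := (integrable_rpow_of_memH1 hN hU hp.le hpc.le).congr
      (Eventually.of_forall fun x => by simp only [abs_of_nonneg (hU0 x)])
  have iR : Integrable fun x => u x ^ α * v x ^ β :=
    (integrable_interaction hN hu hv (by linarith) (by linarith) hαβ).congr
      (Eventually.of_forall fun x => by simp only [abs_of_pos (hu0 x), abs_of_pos (hv0 x)])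
  have iP' : Integrable fun x => u x ^ (p - 1) * U x := by
    simpa using integrable_rpow_sub_one_mul (w := fun _ => 1) hu0 (fun _ => zero_le_one) hU0
      (fun x => (hκ x).1) hu.1.1 aestronglyMeasurable_const hU.1.1 (r := p) (by simpa using iP)
  have iQ' : Integrable fun x => v x ^ (q - 1) * U x := by
    simpa using integrable_rpow_sub_one_mul (w := fun _ => 1) hv0 (fun _ => zero_le_one) hU0
      (fun x => (hκ x).2) hv.1.1 aestronglyMeasurable_const hU.1.1 (r := q) (by simpa using iQ)
  have iR₁ : Integrable fun x => u x ^ (α - 1) * v x ^ β * U x :=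
    integrable_rpow_sub_one_mul hu0 (fun x => Real.rpow_nonneg (hv0 x).le β) hU0
      (fun x => (hκ x).1) hu.1.1 (hv.1.1.aemeasurable.pow_const _).aestronglyMeasurable hU.1.1 iR
  have iR₂ : Integrable fun x => v x ^ (β - 1) * u x ^ α * U x :=
    integrable_rpow_sub_one_mul hv0 (fun x => Real.rpow_nonneg (hu0 x).le α) hU0
      (fun x => (hκ x).2) hv.1.1 (hu.1.1.aemeasurable.pow_const _).aestronglyMeasurable hU.1.1
      (by simpa only [mul_comm] using iR)
  have iI := integrable_mul_of_memLp hu.1 hU.1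
  have iJ := integrable_mul_of_memLp hv.1 hU.1
  have hut : MemH1 fun x => u x + t * U x := hu.add (hU.const_mul t)
  have hvs : MemH1 fun x => v x + s * U x := hv.add (hU.const_mul s)
  have hut0 : ∀ x, 0 < u x + t * U x := fun x =>
    add_pos_of_pos_of_nonneg (hu0 x) (mul_nonneg ht (hU0 x))
  have hvs0 : ∀ x, 0 < v x + s * U x := fun x =>
    add_pos_of_pos_of_nonneg (hv0 x) (mul_nonneg hs (hU0 x))
  have iPt : Integrable fun x => (u x + t * U x) ^ p :=
    (integrable_rpow_of_memH1 hN hut hp.le hpc.le).congr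
      (Eventually.of_forall fun x => by simp only [abs_of_pos (hut0 x)])
  have iQt : Integrable fun x => (v x + s * U x) ^ q :=
    (integrable_rpow_of_memH1 hN hvs hq.le hqc.le).congr
      (Eventually.of_forall fun x => by simp only [abs_of_pos (hvs0 x)])
  have iRt : Integrable fun x => (u x + t * U x) ^ α * (v x + s * U x) ^ β :=
    (integrable_interaction hN hut hvs (by linarith) (by linarith) hαβ).congr
      (Eventually.of_forall fun x => by simp only [abs_of_pos (hut0 x), abs_of_pos (hvs0 x)])
  -- the normalization factors
  have hI0 : 0 ≤ ∫ x, u x * U x := integral_nonneg fun x => mul_nonneg (hu0 x).le (hU0 x)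
  have hJ0 : 0 ≤ ∫ x, v x * U x := integral_nonneg fun x => mul_nonneg (hv0 x).le (hU0 x)
  obtain ⟨σ0, σ1, σm, -, -, σd⟩ := massFactor_spec ha hu.1 hU.1 hmu hI0 hW ht htT
  obtain ⟨τ0, τ1, τm, -, -, τd⟩ := massFactor_spec hb hv.1 hU.1 hmv hJ0 hW hs hsT
  rw [← hσ] at σ0 σ1 σm σd
  rw [← hτ] at τ0 τ1 τm τd
  have hI := integral_mul_le_sqrt_mass hu.1 hU.1
  have hJ := integral_mul_le_sqrt_mass hv.1 hU.1
  rw [hmu] at hI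
  rw [hmv] at hJ
  set y := √(mass U) with hy
  have hy0 : 0 ≤ y := Real.sqrt_nonneg _
  have hy2 : y ^ 2 = mass U := Real.sq_sqrt (mass_nonneg U)
  rw [← hy2] at σm τm ⊢
  -- Euler-Lagrange
  have EL₁ := euler_lagrange_le hN (p := p) (q := q) (μ₂ := μ₂) (ρ := ρ₀) hp hpc hα hβ hαβ hμ₁ hν ha
    hu hv hU hmu hgr hu0 hv0 (fun f hf hfm hfg => hmin (f, v) ⟨⟨hf, hv, hfm, hmv⟩, hfg⟩) hU0
    (fun x => (hκ x).1)
  have EL₂ := euler_lagrange_le hN (p := q) (q := p) (α := β) (β := α) (μ₁ := μ₂) (μ₂ := μ₁) (ν := ν)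
    (ρ := ρ₀) hq hqc hβ hα (by linarith) hμ₂ hν hb hv hu hU hmv (by linarith) hv0 hu0
    (fun f hf hfm hfg => by
      have := hmin (u, f) ⟨⟨hu, hf, hmu, hfm⟩, by simp only; linarith⟩
      simpa only [energy_swap p q α β μ₁ μ₂ ν] using this) hU0 (fun x => (hκ x).2)
  have hRc : ∫ x, v x ^ β * u x ^ α = R := by simp_rw [hR, mul_comm]
  rw [hRc] at EL₂
  have hw := one_sub_le_rpow_mul_rpow σ0 σ1 τ0 τ1 hα.le hβ.le
  have bP : ∫ x, u x ^ (p - 1) * U x ≤ c * y := by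
    refine (integral_mul_le_const_mul (fun x => Real.rpow_nonneg (hu0 x).le _)
      (fun x => rpow_sub_one_le (hu0 x) (huM x) hp.le) hU0 iI).trans ?_
    calc _ ≤ M ^ (p - 2) * (√a₁ * y) := by gcongr
      _ = (M ^ (p - 2) * √a₁) * y := by ring
      _ ≤ c * y := mul_le_mul_of_nonneg_right (by linarith) hy0
  have bQ : ∫ x, v x ^ (q - 1) * U x ≤ c * y := by
    refine (integral_mul_le_const_mul (fun x => Real.rpow_nonneg (hv0 x).le _)
      (fun x => rpow_sub_one_le (hv0 x) (hvL x) hq.le) hU0 iJ).trans ?_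
    calc _ ≤ L ^ (q - 2) * (√b₁ * y) := by gcongr
      _ = (L ^ (q - 2) * √b₁) * y := by ring
      _ ≤ c * y := mul_le_mul_of_nonneg_right (by linarith) hy0
  have bR₁ : ∫ x, u x ^ (α - 1) * v x ^ β * U x ≤ c * y := by
    refine (integral_mul_le_const_mul (fun x => mul_nonneg (Real.rpow_nonneg (hu0 x).le _)
      (Real.rpow_nonneg (hv0 x).le _)) (fun x => rpow_mul_rpow_le_mul (hu0 x) (hv0 x) (huM x)
      (hvL x) hα.le hβ.le) hU0 iJ).trans ?_
    calc _ ≤ M ^ (α - 1) * L ^ (β - 1) * (√b₁ * y) := by gcongr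
      _ = (M ^ (α - 1) * L ^ (β - 1) * √b₁) * y := by ring
      _ ≤ c * y := mul_le_mul_of_nonneg_right (by linarith) hy0
  have bR₂ : ∫ x, v x ^ (β - 1) * u x ^ α * U x ≤ c * y := by
    refine (integral_mul_le_const_mul (fun x => mul_nonneg (Real.rpow_nonneg (hv0 x).le _)
      (Real.rpow_nonneg (hu0 x).le _)) (fun x => rpow_mul_rpow_le_mul (hv0 x) (hu0 x) (hvL x)
      (huM x) hβ.le hα.le) hU0 iI).trans ?_
    calc _ ≤ L ^ (β - 1) * M ^ (α - 1) * (√a₁ * y) := by gcongr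
      _ = (L ^ (β - 1) * M ^ (α - 1) * √a₁) * y := by ring
      _ ≤ c * y := mul_le_mul_of_nonneg_right (by linarith) hy0
  have hσc : 1 - σ ≤ c * y := σd.trans (mul_le_mul_of_nonneg_right (by linarith) hy0)
  have hτc : 1 - τ ≤ c * y := τd.trans (mul_le_mul_of_nonneg_right (by linarith) hy0)
  have p0 : 0 ≤ ∫ x, u x ^ p := integral_nonneg fun x => Real.rpow_nonneg (hu0 x).le _
  have q0 : 0 ≤ ∫ x, v x ^ q := integral_nonneg fun x => Real.rpow_nonneg (hv0 x).le _
  have p0' : 0 ≤ ∫ x, u x ^ (p - 1) * U x :=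
    integral_nonneg fun x => mul_nonneg (Real.rpow_nonneg (hu0 x).le _) (hU0 x)
  have q0' : 0 ≤ ∫ x, v x ^ (q - 1) * U x :=
    integral_nonneg fun x => mul_nonneg (Real.rpow_nonneg (hv0 x).le _) (hU0 x)
  have r0₁ : 0 ≤ ∫ x, u x ^ (α - 1) * v x ^ β * U x := integral_nonneg fun x =>
    mul_nonneg (mul_nonneg (Real.rpow_nonneg (hu0 x).le _) (Real.rpow_nonneg (hv0 x).le _)) (hU0 x)
  have r0₂ : 0 ≤ ∫ x, v x ^ (β - 1) * u x ^ α * U x := integral_nonneg fun x =>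
    mul_nonneg (mul_nonneg (Real.rpow_nonneg (hv0 x).le _) (Real.rpow_nonneg (hu0 x).le _)) (hU0 x)
  have r0 : 0 ≤ R := integral_nonneg fun x =>
    mul_nonneg (Real.rpow_nonneg (hu0 x).le _) (Real.rpow_nonneg (hv0 x).le _)
  have d₁ := first_order_defect_le ha (by linarith : 0 < p) hμ₁.le hν.le (by linarith : 0 < α)
    (by linarith : 0 < β) hG0 p0 p0' r0₁ ht htT hy0 hc0 σ0 σ1 σm EL₁ hσc hτc bP bR₁
    (one_sub_le_rpow σ0 (by linarith : 1 ≤ p)) hw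
  have d₂ := first_order_defect_le hb (by linarith : 0 < q) hμ₂.le hν.le (by linarith : 0 < β)
    (by linarith : 0 < α) hK0 q0 q0' r0₂ hs hsT hy0 hc0 τ0 τ1 τm EL₂ hτc hσc bQ bR₂
    (one_sub_le_rpow τ0 (by linarith : 1 ≤ q))
    (by linarith : 1 - β * (1 - τ) - α * (1 - σ) ≤ σ ^ α * τ ^ β)
  -- lower bounds of the integrals
  have hPt : P + p * t * (∫ x, u x ^ (p - 1) * U x) + t ^ p * (∫ x, U x ^ p) ≤
      ∫ x, (u x + t * U x) ^ p := by
    have i1 : Integrable fun x => u x ^ p + p * t * (u x ^ (p - 1) * U x) :=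
      iP.add (iP'.const_mul (p * t))
    rw [hP, ← integral_const_mul, ← integral_const_mul, ← integral_add iP (iP'.const_mul (p * t)),
      ← integral_add i1 (iU.const_mul _)]
    refine integral_mono (i1.add (iU.const_mul _)) iPt fun x => ?_
    have := rpow_expansion_le hp.le (hu0 x) (mul_nonneg ht (hU0 x))
    rw [Real.mul_rpow ht (hU0 x)] at this
    simp only
    linarith
  have hQt : Q + q * s * (∫ x, v x ^ (q - 1) * U x) ≤ ∫ x, (v x + s * U x) ^ q := by
    rw [hQ, ← integral_const_mul, ← integral_add iQ (iQ'.const_mul (q * s))]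
    refine integral_mono (iQ.add (iQ'.const_mul _)) iQt fun x => ?_
    have := rpow_tangent_le (r := q) (h := s * U x) (by linarith) (hv0 x) (hvs0 x).le
    simp only
    linarith
  have hRt : ∫ x, (u x + t * U x) ^ α * (v x + s * U x) ^ β = R +
      α * t * (∫ x, u x ^ (α - 1) * v x ^ β * U x) + β * s * (∫ x, v x ^ (β - 1) * u x ^ α * U x) +
      interactionRemainder α β u v U t s := by
    have i1 : Integrable fun x => (u x + t * U x) ^ α * (v x + s * U x) ^ β - u x ^ α * v x ^ β :=
      iRt.sub iR
    have i2 : Integrable fun x => (u x + t * U x) ^ α * (v x + s * U x) ^ β - u x ^ α * v x ^ β -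
      α * t * (u x ^ (α - 1) * v x ^ β * U x) := i1.sub (iR₁.const_mul _)
    rw [interactionRemainder, integral_sub i2 (iR₂.const_mul _), integral_sub i1 (iR₁.const_mul _),
      integral_sub iRt iR, integral_const_mul, integral_const_mul]
    ring
  have hEn : energy p q α β μ₁ μ₂ ν (fun x => σ * (u x + t * U x)) (fun x => τ * (v x + s * U x)) =
      1 / 2 * (σ ^ 2 * (G + 2 * t * gradInner u U + t ^ 2 * gradSq U) +
        τ ^ 2 * (K + 2 * s * gradInner v U + s ^ 2 * gradSq U)) -
      μ₁ / p * (σ ^ p * ∫ x, (u x + t * U x) ^ p) - μ₂ / q * (τ ^ q * ∫ x, (v x + s * U x) ^ q) -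
      ν * (σ ^ α * τ ^ β * ∫ x, (u x + t * U x) ^ α * (v x + s * U x) ^ β) := by
    rw [energy, gradSq_const_mul hut, gradSq_const_mul hvs, gradSq_add_mul hu hU,
      gradSq_add_mul hv hU, integral_abs_const_mul_rpow (fun x => u x + t * U x) σ0.le,
      integral_abs_const_mul_rpow (fun x => v x + s * U x) τ0.le,
      integral_interaction_const_mul (fun x => u x + t * U x) (fun x => v x + s * U x) σ0.le τ0.le]
    simp_rw [abs_of_pos (hut0 _), abs_of_pos (hvs0 _)]
    rfl
  have hJ0 : localInf N p q α β μ₁ μ₂ ν ρ₀ a₁ b₁ =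
      1 / 2 * (G + K) - μ₁ / p * P - μ₂ / q * Q - ν * R := by
    rw [← hatt, energy]
    simp_rw [abs_of_pos (hu0 _), abs_of_pos (hv0 _)]
    rfl
  have e1 := mul_le_mul_of_nonneg_left (mul_le_mul_of_nonneg_left hPt
    (Real.rpow_nonneg σ0.le p)) (show 0 ≤ μ₁ / p by positivity)
  have e2 := mul_le_mul_of_nonneg_left (mul_le_mul_of_nonneg_left hQt
    (Real.rpow_nonneg τ0.le q)) (show 0 ≤ μ₂ / q by positivity)
  have e3 := mul_le_mul_of_nonneg_left (mul_le_mul_of_nonneg_right hw r0) hν.le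
  have f1 : μ₁ / p * (σ ^ p * (p * t * ∫ x, u x ^ (p - 1) * U x)) =
      σ ^ p * (μ₁ * t * ∫ x, u x ^ (p - 1) * U x) := by
    field_simp
  have f2 : μ₂ / q * (τ ^ q * (q * s * ∫ x, v x ^ (q - 1) * U x)) =
      τ ^ q * (μ₂ * s * ∫ x, v x ^ (q - 1) * U x) := by
    field_simp
  rw [mul_add, mul_add, mul_add, mul_add, f1] at e1
  rw [mul_add, mul_add, f2] at e2
  rw [hEn, hJ0, hRt]
  rw [← hC₁] at d₁
  rw [← hC₂] at d₂
  linarith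

/-! ### The energy level of the bubble -/

/-- The maximum over `z ≥ 0` of `(2^*/(2α)) z - ν (β/α)^{β/2} z^{2^*/2}`, read off the tangent at the
critical point. -/
lemma bubbleLevel_le {N : ℕ} (hN : 3 ≤ N) {α β ν z : ℝ} (hα : 0 < α) (hβ : 0 < β)
    (hαβ : α + β = critExp N) (hν : 0 < ν) (hz : 0 ≤ z) :
    critExp N / (2 * α) * z - ν * (β / α) ^ (β / 2) * z ^ (critExp N / 2) ≤
      2 / ((N : ℝ) - 2) * ν ^ (-(((N : ℝ) - 2) / 2)) * α ^ (-(((N : ℝ) - 2) * α / 4)) *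
        β ^ (-(((N : ℝ) - 2) * β / 4)) := by
  have hN3 : (3 : ℝ) ≤ N := by exact_mod_cast hN
  have hc := two_lt_critExp hN
  set γ := ((N : ℝ) - 2) / 2 with hγ
  have hγ0 : 0 < γ := by rw [hγ]; linarith
  set b := ν * (β / α) ^ (β / 2) with hb
  have hb0 : 0 < b := by positivity
  have hcγ : critExp N * γ = N := by
    rw [critExp, hγ]
    have : (N : ℝ) - 2 ≠ 0 := by linarith
    field_simp
  set q := critExp N / 2 with hq
  have hq1 : 1 ≤ q := by rw [hq]; linarith
  -- the critical point
  set z₀ := (α * b) ^ (-γ) with hz₀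
  have hz₀0 : 0 < z₀ := by positivity
  have h1 := rpow_tangent_le (r := q) (h := z - z₀) hq1 hz₀0 (by linarith)
  rw [add_sub_cancel] at h1
  have hqγ : γ * (q - 1) = 1 := by
    rw [hq, mul_sub, mul_div_assoc', mul_comm γ, hcγ, hγ]
    ring
  have h2 : z₀ ^ (q - 1) = (α * b)⁻¹ := by
    rw [hz₀, ← Real.rpow_mul (by positivity), neg_mul, hqγ, Real.rpow_neg_one]
  have h3 : z₀ ^ q = (α * b)⁻¹ * z₀ := by
    rw [← h2, ← Real.rpow_add_one hz₀0.ne', sub_add_cancel]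
  rw [h2, h3] at h1
  have h4 := mul_le_mul_of_nonneg_left h1 hb0.le
  have h5 : b * ((α * b)⁻¹ * z₀ + q * ((α * b)⁻¹ * (z - z₀))) = (z₀ + q * (z - z₀)) / α := by
    field_simp
  rw [h5] at h4
  have h6 : critExp N / (2 * α) * z = q * z / α := by
    rw [hq]
    field_simp
  have h7 : q - 1 = 2 / ((N : ℝ) - 2) := by
    have : (N : ℝ) - 2 ≠ 0 := by linarith
    rw [hq, critExp]
    field_simp
    ring
  have h8 : z₀ / α = ν ^ (-γ) * α ^ (-(((N : ℝ) - 2) * α / 4)) * β ^ (-(((N : ℝ) - 2) * β / 4)) := by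
    have e1 : z₀ = α ^ (-γ) * (ν ^ (-γ) * (β ^ (β / 2 * -γ) * (α ^ (β / 2 * -γ))⁻¹)) := by
      rw [hz₀, hb, Real.mul_rpow hα.le (by positivity), Real.mul_rpow hν.le (by positivity),
        ← Real.rpow_mul (by positivity), Real.div_rpow hβ.le hα.le, div_eq_mul_inv]
    have e2 : α ^ (-(((N : ℝ) - 2) * α / 4)) = α ^ (-γ) * (α ^ (β / 2 * -γ))⁻¹ * α⁻¹ := by
      rw [← Real.rpow_neg hα.le, ← Real.rpow_neg_one α, ← Real.rpow_add hα, ← Real.rpow_add hα]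
      congr 1
      rw [← hαβ] at hcγ
      rw [hγ] at hcγ ⊢
      linarith
    have e3 : β ^ (-(((N : ℝ) - 2) * β / 4)) = β ^ (β / 2 * -γ) := by
      congr 1
      rw [hγ]
      ring
    rw [e1, e2, e3]
    ring
  calc critExp N / (2 * α) * z - b * z ^ q ≤ q * z / α - (z₀ + q * (z - z₀)) / α := by
        rw [h6]
        linarith
    _ = (q - 1) * (z₀ / α) := by ring
    _ = _ := by rw [h7, h8]; ring

/-- The weighted arithmetic mean exceeds the geometric mean only to second order; the harmonic mean
is used as a lower bound of the geometric one. -/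
lemma arith_mean_le_geom_mean {θ x y : ℝ} (hθ : 0 ≤ θ) (hθ1 : θ ≤ 1) (hx : 0 < x) (hx1 : x ≤ 1)
    (hy : 0 < y) (hy1 : y ≤ 1) :
    θ * x + (1 - θ) * y ≤ x ^ θ * y ^ (1 - θ) * (1 + (x⁻¹ - y⁻¹) ^ 2) := by
  have h1 := Real.geom_mean_le_arith_mean2_weighted (w₁ := θ) (w₂ := 1 - θ) (p₁ := x⁻¹)
    (p₂ := y⁻¹) hθ (by linarith) (by positivity) (by positivity) (by ring)
  rw [Real.inv_rpow hx.le, Real.inv_rpow hy.le, ← mul_inv] at h1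
  have hg : 0 < x ^ θ * y ^ (1 - θ) := by positivity
  rw [inv_le_iff_one_le_mul₀ hg] at h1
  have hA : 0 ≤ θ * x + (1 - θ) * y :=
    add_nonneg (mul_nonneg hθ hx.le) (mul_nonneg (by linarith) hy.le)
  have h2 : (θ * x + (1 - θ) * y) * (θ * x⁻¹ + (1 - θ) * y⁻¹) =
      1 + θ * (1 - θ) * (x * y) * (x⁻¹ - y⁻¹) ^ 2 := by
    field_simp
    ring
  have h3 : θ * (1 - θ) * (x * y) ≤ 1 := by
    have a1 : θ * (1 - θ) ≤ 1 := by nlinarith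
    exact mul_le_one₀ a1 (by positivity) (mul_le_one₀ hx1 hy.le hy1)
  calc θ * x + (1 - θ) * y
      ≤ (θ * x + (1 - θ) * y) * ((θ * x⁻¹ + (1 - θ) * y⁻¹) * (x ^ θ * y ^ (1 - θ))) :=
        le_mul_of_one_le_right hA h1
    _ = x ^ θ * y ^ (1 - θ) * (1 + θ * (1 - θ) * (x * y) * (x⁻¹ - y⁻¹) ^ 2) := by
        rw [← h2]
        ring
    _ ≤ _ := by
        refine mul_le_mul_of_nonneg_left ?_ hg.le
        have := mul_le_mul_of_nonneg_right h3 (sq_nonneg (x⁻¹ - y⁻¹))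
        linarith

/-- The leading part of the energy of the path in terms of `z = t² σ^{2θ} τ^{2(1-θ)}`,
`θ = α/2^*`. -/
lemma bracket_le {κ α β ν σ τ t T A B K e d : ℝ} (hα : 0 < α) (hβ : 0 < β)
    (hκ : α + β = κ) (hν : 0 < ν) (hσ : 0 < σ) (hσ1 : σ ≤ 1) (hτ : 0 < τ) (hτ1 : τ ≤ 1) (ht : 0 ≤ t)
    (htT : t ≤ T) (hK : 0 < K) (he : 0 ≤ e) (he1 : e ≤ 1) (hA : A ≤ K + e) (hB : K - e ≤ B)
    (hd : ((σ ^ 2)⁻¹ - (τ ^ 2)⁻¹) ^ 2 ≤ d) :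
    1 / 2 * (σ ^ 2 * t ^ 2 + τ ^ 2 * (√(β / α) * t) ^ 2) * A
        - ν * (σ ^ α * τ ^ β) * (t ^ α * (√(β / α) * t) ^ β * B) ≤
      K * (κ / (2 * α) * (t ^ 2 * ((σ ^ 2) ^ (α / κ) * (τ ^ 2) ^ (1 - α / κ)))
        - ν * (β / α) ^ (β / 2) *
          (t ^ 2 * ((σ ^ 2) ^ (α / κ) * (τ ^ 2) ^ (1 - α / κ))) ^ (κ / 2))
      + (κ / (2 * α) * T ^ 2 * (K + 1) + ν * (β / α) ^ (β / 2) * (T ^ 2) ^ (κ / 2)) * (d + e) := by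
  have hκ0 : 0 < κ := by linarith
  have hθ1 : α / κ ≤ 1 := by rw [div_le_one hκ0]; linarith
  have hθ0 : 0 ≤ α / κ := by positivity
  set x := σ ^ 2 with hx
  set y := τ ^ 2 with hy
  have hx0 : 0 < x := by positivity
  have hy0 : 0 < y := by positivity
  have hx1 : x ≤ 1 := pow_le_one₀ hσ.le hσ1
  have hy1 : y ≤ 1 := pow_le_one₀ hτ.le hτ1
  have hd0 : 0 ≤ d := (sq_nonneg _).trans hd
  have hG := arith_mean_le_geom_mean hθ0 hθ1 hx0 hx1 hy0 hy1
  set g := x ^ (α / κ) * y ^ (1 - α / κ) with hg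
  have hg0 : 0 < g := by positivity
  have hg1 : g ≤ 1 := mul_le_one₀ (Real.rpow_le_one hx0.le hx1 hθ0) (by positivity)
    (Real.rpow_le_one hy0.le hy1 (by linarith))
  set z := t ^ 2 * g with hz
  have hz0 : 0 ≤ z := by positivity
  have hzT : z ≤ T ^ 2 := by
    calc z ≤ t ^ 2 := mul_le_of_le_one_right (by positivity) hg1
      _ ≤ T ^ 2 := by gcongr
  have hs2 : (√(β / α) * t) ^ 2 = β / α * t ^ 2 := by
    rw [mul_pow, Real.sq_sqrt (by positivity)]
  have k1 : 1 / 2 * (x * t ^ 2 + y * (√(β / α) * t) ^ 2) =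
      κ / (2 * α) * (t ^ 2 * (α / κ * x + (1 - α / κ) * y)) := by
    rw [hs2]
    have : β = κ - α := by linarith
    rw [this]
    field_simp
  have k2 : κ / (2 * α) * (t ^ 2 * (α / κ * x + (1 - α / κ) * y)) ≤ κ / (2 * α) * (z * (1 + d)) := by
    refine mul_le_mul_of_nonneg_left ?_ (by positivity)
    rw [hz, mul_assoc]
    refine mul_le_mul_of_nonneg_left (hG.trans ?_) (by positivity)
    gcongr
  have k3 : 0 ≤ 1 / 2 * (x * t ^ 2 + y * (√(β / α) * t) ^ 2) := by positivity
  have k4 : 1 / 2 * (x * t ^ 2 + y * (√(β / α) * t) ^ 2) * A ≤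
      κ / (2 * α) * (z * (1 + d)) * (K + e) := by
    calc _ ≤ 1 / 2 * (x * t ^ 2 + y * (√(β / α) * t) ^ 2) * (K + e) :=
          mul_le_mul_of_nonneg_left hA k3
      _ ≤ _ := mul_le_mul_of_nonneg_right (k1.trans_le k2) (by linarith)
  have k5 : κ / (2 * α) * (z * (1 + d)) * (K + e) ≤
      K * (κ / (2 * α) * z) + κ / (2 * α) * T ^ 2 * (K + 1) * (d + e) := by
    have l1 : d * K + e + d * e ≤ (K + 1) * (d + e) := by nlinarith
    have l2 : κ / (2 * α) * z * (d * K + e + d * e) ≤ κ / (2 * α) * T ^ 2 * ((K + 1) * (d + e)) := by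
      gcongr
    linarith
  have k6 : ν * (σ ^ α * τ ^ β) * (t ^ α * (√(β / α) * t) ^ β) =
      ν * (β / α) ^ (β / 2) * z ^ (κ / 2) := by
    have r1 : z ^ (κ / 2) = t ^ κ * (σ ^ α * τ ^ β) := by
      rw [hz, hg, Real.mul_rpow (by positivity) (by positivity),
        Real.mul_rpow (by positivity) (by positivity), hx, hy, ← Real.rpow_natCast,
        ← Real.rpow_natCast, ← Real.rpow_natCast, ← Real.rpow_mul ht, ← Real.rpow_mul hσ.le,
        ← Real.rpow_mul hτ.le, ← Real.rpow_mul hσ.le, ← Real.rpow_mul hτ.le]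
      have : β = κ - α := by linarith
      congr 2
      · push_cast; ring
      · congr 1; push_cast; field_simp
      · congr 1; push_cast; rw [this]; field_simp
    have r2 : √(β / α) ^ β = (β / α) ^ (β / 2) := by
      rw [Real.sqrt_eq_rpow, ← Real.rpow_mul (by positivity)]
      congr 1
      ring
    have r3 : t ^ α * t ^ β = t ^ κ := by rw [← hκ, Real.rpow_add_of_nonneg ht hα.le hβ.le]
    rw [Real.mul_rpow (Real.sqrt_nonneg _) ht, r1, r2, ← r3]
    ring
  have k7 : ν * (β / α) ^ (β / 2) * z ^ (κ / 2) * (K - e) ≤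
      ν * (σ ^ α * τ ^ β) * (t ^ α * (√(β / α) * t) ^ β * B) := by
    rw [← mul_assoc, k6]
    exact mul_le_mul_of_nonneg_left hB (by positivity)
  have k8 : ν * (β / α) ^ (β / 2) * z ^ (κ / 2) * e ≤
      ν * (β / α) ^ (β / 2) * (T ^ 2) ^ (κ / 2) * (d + e) := by
    have : z ^ (κ / 2) ≤ (T ^ 2) ^ (κ / 2) := Real.rpow_le_rpow hz0 hzT (by positivity)
    gcongr
    linarith
  linarith

/-! ### The interaction remainder -/

lemma integrable_interactionRemainder {N : ℕ} (hN : 3 ≤ N) {α β t s κ : ℝ} {u v U : Eucl N → ℝ}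
    (hα : 1 < α) (hβ : 1 < β) (hαβ : α + β = critExp N) (hu : MemH1 u) (hv : MemH1 v) (hU : MemH1 U)
    (hu0 : ∀ x, 0 < u x) (hv0 : ∀ x, 0 < v x) (hU0 : ∀ x, 0 ≤ U x)
    (hκ : ∀ x, U x ≤ κ * u x ∧ U x ≤ κ * v x) (ht : 0 ≤ t) (hs : 0 ≤ s) :
    Integrable fun x => (u x + t * U x) ^ α * (v x + s * U x) ^ β - u x ^ α * v x ^ β
      - α * t * (u x ^ (α - 1) * v x ^ β * U x) - β * s * (v x ^ (β - 1) * u x ^ α * U x) := by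
  have iR : Integrable fun x => u x ^ α * v x ^ β :=
    (integrable_interaction hN hu hv (by linarith) (by linarith) hαβ).congr
      (Eventually.of_forall fun x => by simp only [abs_of_pos (hu0 x), abs_of_pos (hv0 x)])
  have iR₁ : Integrable fun x => u x ^ (α - 1) * v x ^ β * U x :=
    integrable_rpow_sub_one_mul hu0 (fun x => Real.rpow_nonneg (hv0 x).le β) hU0
      (fun x => (hκ x).1) hu.1.1 (hv.1.1.aemeasurable.pow_const _).aestronglyMeasurable hU.1.1 iR
  have iR₂ : Integrable fun x => v x ^ (β - 1) * u x ^ α * U x :=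
    integrable_rpow_sub_one_mul hv0 (fun x => Real.rpow_nonneg (hu0 x).le α) hU0
      (fun x => (hκ x).2) hv.1.1 (hu.1.1.aemeasurable.pow_const _).aestronglyMeasurable hU.1.1
      (by simpa only [mul_comm] using iR)
  have iRt : Integrable fun x => (u x + t * U x) ^ α * (v x + s * U x) ^ β :=
    (integrable_interaction hN (hu.add (hU.const_mul t)) (hv.add (hU.const_mul s)) (by linarith)
      (by linarith) hαβ).congr (Eventually.of_forall fun x => by
        simp only [abs_of_nonneg (add_nonneg (hu0 x).le (mul_nonneg ht (hU0 x))),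
          abs_of_nonneg (add_nonneg (hv0 x).le (mul_nonneg hs (hU0 x)))])
  exact ((iRt.sub iR).sub (iR₁.const_mul _)).sub (iR₂.const_mul _)

lemma integrable_rpow_critExp_of_nonneg {N : ℕ} (hN : 3 ≤ N) {U : Eucl N → ℝ} (hU : MemH1 U)
    (hU0 : ∀ x, 0 ≤ U x) : Integrable fun x => U x ^ critExp N :=
  (integrable_critExp_of_memH1 hN hU).1.congr
    (Eventually.of_forall fun x => by simp only [abs_of_nonneg (hU0 x)])

/-- The pointwise remainder dominates the pure bubble interaction. -/
lemma rpow_critExp_le_remainder {κ α β t s a b w : ℝ} (hα : 1 < α) (hβ : 1 < β) (hκ : α + β = κ)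
    (ha : 0 < a) (hb : 0 < b) (hw : 0 ≤ w) (ht : 0 ≤ t) (hs : 0 ≤ s) :
    t ^ α * s ^ β * w ^ κ ≤ (a + t * w) ^ α * (b + s * w) ^ β - a ^ α * b ^ β
      - α * t * (a ^ (α - 1) * b ^ β * w) - β * s * (b ^ (β - 1) * a ^ α * w) := by
  have h := rpow_mul_rpow_expansion_le hα.le hβ.le ha hb (mul_nonneg ht hw) (mul_nonneg hs hw)
  have e : (t * w) ^ α * (s * w) ^ β = t ^ α * s ^ β * w ^ κ := by
    rw [Real.mul_rpow ht hw, Real.mul_rpow hs hw, ← hκ,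
      Real.rpow_add_of_nonneg hw (by linarith) (by linarith)]
    ring
  rw [e] at h
  linarith

/-- A positive radially decreasing function is bounded below on the support of the bubble, the ball
of radius `2`. -/
lemma exists_bubble_le_mul {N : ℕ} (hN : 3 ≤ N) (n : ℕ) {u v : Eucl N → ℝ} (hu0 : ∀ x, 0 < u x)
    (hv0 : ∀ x, 0 < v x) (hu : IsRadialDecreasing u) (hv : IsRadialDecreasing v) :
    ∃ κ, ∀ x, bubble N n x ≤ κ * u x ∧ bubble N n x ≤ κ * v x := by
  obtain ⟨C, hC⟩ := lipschitzWith_bubble hN n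
  obtain ⟨M, hM⟩ := (hasCompactSupport_bubble N n).exists_bound_of_continuous hC.continuous
  have hM0 : 0 ≤ M := (norm_nonneg _).trans (hM 0)
  set e : Eucl N := EuclideanSpace.single ⟨0, by omega⟩ 2 with he
  have hen : ‖e‖ = 2 := by simp [he]
  have key : ∀ w : Eucl N → ℝ, (∀ x, 0 < w x) → IsRadialDecreasing w → ∀ κ, M / w e ≤ κ →
      ∀ x, bubble N n x ≤ κ * w x := by
    intro w hw hwd κ hκ x
    have hκ0 : 0 ≤ κ := (div_nonneg hM0 (hw e).le).trans hκ
    rcases lt_or_ge ‖x‖ 2 with h | h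
    · calc bubble N n x ≤ M := (Real.le_norm_self _).trans (hM x)
        _ = M / w e * w e := (div_mul_cancel₀ _ (hw e).ne').symm
        _ ≤ κ * w x := mul_le_mul hκ (hwd x e (by rw [hen]; exact h.le)) (hw e).le hκ0
    · rw [bubble_of_two_le h]
      exact mul_nonneg hκ0 (hw x).le
  exact ⟨max (M / u e) (M / v e), fun x => ⟨key u hu0 hu _ (le_max_left _ _) x,
    key v hv0 hv _ (le_max_right _ _) x⟩⟩

lemma integral_bubble_critExp_le_interactionRemainder {N : ℕ} (hN : 3 ≤ N) (n : ℕ) {α β t s : ℝ}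
    {u v : Eucl N → ℝ} (hα : 1 < α) (hβ : 1 < β) (hαβ : α + β = critExp N) (hu : MemH1 u)
    (hv : MemH1 v) (hu0 : ∀ x, 0 < u x) (hv0 : ∀ x, 0 < v x) (hud : IsRadialDecreasing u)
    (hvd : IsRadialDecreasing v) (ht : 0 ≤ t) (hs : 0 ≤ s) :
    t ^ α * s ^ β * (∫ x, bubble N n x ^ critExp N) ≤
      interactionRemainder α β u v (bubble N n) t s := by
  obtain ⟨κ, hκ⟩ := exists_bubble_le_mul hN n hu0 hv0 hud hvd
  rw [← integral_const_mul]
  exact integral_mono ((integrable_rpow_critExp_of_nonneg hN (memH1_bubble hN n)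
    (bubble_nonneg hN n)).const_mul _) (integrable_interactionRemainder hN hα hβ hαβ hu hv
    (memH1_bubble hN n) hu0 hv0 (bubble_nonneg hN n) hκ ht hs)
    fun x => rpow_critExp_le_remainder hα hβ hαβ (hu0 x) (hv0 x) (bubble_nonneg hN n x) ht hs

/-- Where the bubble is large, the interaction of the bubble in the second component with `u₀` in
the first component adds to the pure bubble interaction. -/
lemma rpow_critExp_add_le_remainder {κ α β t s t₀ s₀ T S a b l M L w w₀ w₁ : ℝ}
    (hα : 1 < α) (hβ : 1 < β) (hκ : α + β = κ) (hl : 0 < l) (hla : l ≤ a) (haM : a ≤ M) (hb : 0 < b)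
    (hbL : b ≤ L) (hw₀ : 0 < w₀) (hw : w₀ ≤ w) (hw' : w ≤ w₁) (ht₀ : 0 < t₀) (ht : t₀ ≤ t)
    (htT : t ≤ T) (hs₀ : 0 < s₀) (hs : s₀ ≤ s) (hsS : s ≤ S) :
    α * l * ((t₀ * w₀) ^ (α - 1) * (s₀ * w₀) ^ β) - (M ^ α * L ^ β +
      α * T * (M ^ (α - 1) * L ^ β * w₁) + β * S * (L ^ (β - 1) * M ^ α * w₁)) ≤
    (a + t * w) ^ α * (b + s * w) ^ β - a ^ α * b ^ β - α * t * (a ^ (α - 1) * b ^ β * w)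
      - β * s * (b ^ (β - 1) * a ^ α * w) - t ^ α * s ^ β * w ^ κ := by
  have ha : 0 < a := hl.trans_le hla
  have hw0 : 0 < w := hw₀.trans_le hw
  have ht0 : 0 < t := ht₀.trans_le ht
  have hs0 : 0 < s := hs₀.trans_le hs
  have hM : 0 < M := ha.trans_le haM
  have hL : 0 < L := hb.trans_le hbL
  have h1 := rpow_tangent_le (r := α) (a := t * w) (h := a) hα.le (by positivity) (by positivity)
  rw [add_comm (t * w) a] at h1
  have h2 : (s * w) ^ β ≤ (b + s * w) ^ β :=
    Real.rpow_le_rpow (by positivity) (by linarith) (by linarith)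
  have h3 : ((t * w) ^ α + α * ((t * w) ^ (α - 1) * a)) * (s * w) ^ β ≤
      (a + t * w) ^ α * (b + s * w) ^ β := mul_le_mul h1 h2 (by positivity) (by positivity)
  have e : (t * w) ^ α * (s * w) ^ β = t ^ α * s ^ β * w ^ κ := by
    rw [Real.mul_rpow ht0.le hw0.le, Real.mul_rpow hs0.le hw0.le, ← hκ, Real.rpow_add hw0]
    ring
  have h4 : α * l * ((t₀ * w₀) ^ (α - 1) * (s₀ * w₀) ^ β) ≤
      α * a * ((t * w) ^ (α - 1) * (s * w) ^ β) := by
    have k1 : (t₀ * w₀) ^ (α - 1) ≤ (t * w) ^ (α - 1) :=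
      Real.rpow_le_rpow (by positivity) (by gcongr) (by linarith)
    have k2 : (s₀ * w₀) ^ β ≤ (s * w) ^ β :=
      Real.rpow_le_rpow (by positivity) (by gcongr) (by linarith)
    gcongr
  have m1 : a ^ α ≤ M ^ α := Real.rpow_le_rpow ha.le haM (by linarith)
  have m2 : b ^ β ≤ L ^ β := Real.rpow_le_rpow hb.le hbL (by linarith)
  have m3 : a ^ (α - 1) ≤ M ^ (α - 1) := Real.rpow_le_rpow ha.le haM (by linarith)
  have m4 : b ^ (β - 1) ≤ L ^ (β - 1) := Real.rpow_le_rpow hb.le hbL (by linarith)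
  have h5 : a ^ α * b ^ β ≤ M ^ α * L ^ β := by gcongr
  have hT : 0 < T := ht0.trans_le htT
  have hS : 0 < S := hs0.trans_le hsS
  have h6 : α * t * (a ^ (α - 1) * b ^ β * w) ≤ α * T * (M ^ (α - 1) * L ^ β * w₁) := by gcongr
  have h7 : β * s * (b ^ (β - 1) * a ^ α * w) ≤ β * S * (L ^ (β - 1) * M ^ α * w₁) := by gcongr
  rw [add_mul, e] at h3
  linarith

/-- The bubbles gain at least `c n^{-(N-2)/2}` from their interaction with the minimizer. -/
lemma exists_interaction_gain {N : ℕ} (hN : 3 ≤ N) {α β k t₀ T : ℝ} {u v : Eucl N → ℝ} (hα : 1 < α)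
    (hβ : 1 < β) (hαβ : α + β = critExp N) (hu : MemH1 u)
    (hv : MemH1 v) (hu0 : ∀ x, 0 < u x) (hv0 : ∀ x, 0 < v x) (hud : IsRadialDecreasing u)
    (hvd : IsRadialDecreasing v) (hk : 0 < k) (ht₀ : 0 < t₀) :
    ∃ c > 0, ∃ n₁ : ℕ, 1 ≤ n₁ ∧ ∀ n ≥ n₁, ∀ t, t₀ ≤ t → t ≤ T →
      c * (n : ℝ) ^ (-(((N : ℝ) - 2) / 2)) ≤ interactionRemainder α β u v (bubble N n) t (k * t) -
        t ^ α * (k * t) ^ β * (∫ x, bubble N n x ^ critExp N) := by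
  have hN3 : (3 : ℝ) ≤ N := by exact_mod_cast hN
  have hce := two_lt_critExp hN
  set γ := ((N : ℝ) - 2) / 2 with hγ
  have hγ0 : 0 < γ := by rw [hγ]; linarith
  obtain ⟨c, hc, C, hC, hb⟩ := exists_bubble_bounds hN
  set e : Eucl N := EuclideanSpace.single ⟨0, by omega⟩ 2 with he
  have hen : ‖e‖ = 2 := by simp [he]
  set l := u e with hl
  set M := u 0 with hM
  set L := v 0 with hL
  have hl0 : 0 < l := hu0 e
  have hM0 : 0 < M := hu0 0
  have hL0 : 0 < L := hv0 0
  set D := α * l * ((t₀ * c) ^ (α - 1) * (k * t₀ * c) ^ β) with hD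
  have hD0 : 0 < D := by positivity
  set E₀ := M ^ α * L ^ β with hE₀
  set E₁ := α * T * (M ^ (α - 1) * L ^ β * C) + β * (k * T) * (L ^ (β - 1) * M ^ α * C) with hE₁
  -- `D X^{2^* - 1}` dominates `E₀ + E₁ X` as `X = n^{(N-2)/2}` grows
  have hlim : ∀ᶠ n : ℕ in atTop, E₀ + E₁ * (n : ℝ) ^ γ ≤ D / 2 * ((n : ℝ) ^ γ) ^ (critExp N - 1) := by
    have hX : Tendsto (fun n : ℕ => (n : ℝ) ^ γ) atTop atTop :=
      (tendsto_rpow_atTop hγ0).comp tendsto_natCast_atTop_atTop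
    have hZ : Tendsto (fun X : ℝ => X ^ (critExp N - 2)) atTop atTop :=
      tendsto_rpow_atTop (by linarith)
    filter_upwards [hX.eventually_ge_atTop 1,
      (hZ.comp hX).eventually_ge_atTop ((|E₀| + |E₁|) / (D / 2))] with n h1 h2
    simp only [Function.comp] at h2
    set X := (n : ℝ) ^ γ with hXdef
    rw [div_le_iff₀ (by positivity)] at h2
    have h3 : X ^ (critExp N - 1) = X ^ (critExp N - 2) * X := by
      rw [← Real.rpow_add_one (by linarith)]
      congr 1
      ring
    rw [h3]
    have h4 := mul_le_mul_of_nonneg_right h2 (show 0 ≤ X by linarith)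
    have h5 := le_abs_self E₀
    have h6 := mul_le_mul_of_nonneg_right (le_abs_self E₁) (show 0 ≤ X by linarith)
    have h7 := mul_le_mul_of_nonneg_left h1 (abs_nonneg E₀)
    linarith
  obtain ⟨n₂, hn₂⟩ := eventually_atTop.1 hlim
  have hV : 0 < (volume (Metric.ball (0 : Eucl N) 1)).toReal :=
    ENNReal.toReal_pos (Metric.measure_ball_pos _ _ one_pos).ne' measure_ball_lt_top.ne
  refine ⟨D / 2 * (volume (Metric.ball (0 : Eucl N) 1)).toReal, by positivity, max n₂ 1,
    le_max_right _ _, fun n hn t ht htT => ?_⟩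
  have hn1 : 1 ≤ n := (le_max_right _ _).trans hn
  have hn0 : (0 : ℝ) < n := by exact_mod_cast hn1
  have hn1' : (1 : ℝ) ≤ n := by exact_mod_cast hn1
  have ht0 : 0 < t := ht₀.trans_le ht
  obtain ⟨κ, hκ⟩ := exists_bubble_le_mul hN n hu0 hv0 hud hvd
  have i1 := integrable_interactionRemainder hN hα hβ hαβ hu hv (memH1_bubble hN n) hu0 hv0
    (bubble_nonneg hN n) hκ ht0.le (by positivity : 0 ≤ k * t)
  have i2 := (integrable_rpow_critExp_of_nonneg hN (memH1_bubble hN n)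
    (bubble_nonneg hN n)).const_mul (t ^ α * (k * t) ^ β)
  rw [interactionRemainder, ← integral_const_mul, ← integral_sub i1 i2]
  have hexp : γ * (critExp N - 1) - N = -γ := by
    have : (N : ℝ) - 2 ≠ 0 := by linarith
    rw [hγ, critExp]
    field_simp
    ring
  rw [← hexp]
  refine le_integral_of_le_on_ball hN hn1 (i1.sub i2) (fun x => sub_nonneg.2
    (rpow_critExp_le_remainder hα hβ hαβ (hu0 x) (hv0 x) (bubble_nonneg hN n x) ht0.le
      (by positivity))) fun x hx => ?_
  obtain ⟨b1, b2⟩ := hb n hn1 x hx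
  have hx2 : ‖x‖ ≤ ‖e‖ := by
    rw [hen]
    linarith [inv_le_one_of_one_le₀ hn1']
  refine le_trans ?_ (rpow_critExp_add_le_remainder hα hβ hαβ hl0 (hud x e hx2)
    (hud 0 x (by simp)) (hv0 x) (hvd 0 x (by simp)) (by positivity) b1 b2 ht₀ ht htT
    (by positivity : 0 < k * t₀) (by gcongr) (by gcongr : k * t ≤ k * T))
  have h1 := hn₂ n ((le_max_left _ _).trans hn)
  rw [Real.rpow_mul hn0.le]
  set X := (n : ℝ) ^ γ with hX
  have hX0 : 0 < X := by positivity
  have h2 : α * l * ((t₀ * (c * X)) ^ (α - 1) * (k * t₀ * (c * X)) ^ β) =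
      D * X ^ (critExp N - 1) := by
    rw [← mul_assoc t₀, ← mul_assoc (k * t₀), Real.mul_rpow (by positivity) hX0.le,
      Real.mul_rpow (by positivity) hX0.le, ← hαβ, show α + β - 1 = (α - 1) + β by ring,
      Real.rpow_add hX0, hD]
    ring
  rw [h2]
  have h3 : M ^ α * L ^ β + α * T * (M ^ (α - 1) * L ^ β * (C * X)) +
      β * (k * T) * (L ^ (β - 1) * M ^ α * (C * X)) = E₀ + E₁ * X := by
    rw [hE₀, hE₁]
    ring
  rw [h3]
  linarith

/-! ### The energy along the path of bubbles -/

lemma tendsto_const_mul_rpow_zero {C e : ℝ} (he : e < 0) :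
    Tendsto (fun n : ℕ => C * (n : ℝ) ^ e) atTop (nhds 0) := by
  have h := (tendsto_rpow_neg_atTop (y := -e) (by linarith)).comp tendsto_natCast_atTop_atTop
  simpa [Function.comp_def] using h.const_mul C

lemma eventually_mul_rpow_lt {C c d e : ℝ} (hc : 0 < c) (hde : d < e) :
    ∀ᶠ n : ℕ in atTop, C * (n : ℝ) ^ d < c * (n : ℝ) ^ e := by
  filter_upwards [(tendsto_const_mul_rpow_zero (C := C) (sub_neg.2 hde)).eventually_lt_const hc,
    eventually_ge_atTop 1] with n h1 hn
  have hn0 : (0 : ℝ) < n := by exact_mod_cast hn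
  rw [Real.rpow_sub hn0, ← mul_div_assoc, div_lt_iff₀ (by positivity)] at h1
  exact h1

lemma half_le_of_half_le_sq {r : ℝ} (hr : 0 < r) (h : 1 / 2 ≤ r ^ 2) : 1 / 2 ≤ r := by
  by_contra hlt
  nlinarith

/-- Upper bound of the energy along the path: the energy of the minimizer, the energy of a bubble
of size `z ∈ [t²/2, t²]`, an error `O(n^{2η-2})`, and two nonpositive terms. -/
lemma exists_pathEnergy_le {N : ℕ} (hN : 3 ≤ N) {p q α β μ₁ μ₂ ν ρ₀ a₁ b₁ : ℝ}
    (hp : 2 < p) (hp' : p < 2 + 4 / (N : ℝ)) (hq : 2 < q) (hq' : q < 2 + 4 / (N : ℝ))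
    (hα : 1 < α) (hβ : 1 < β) (hαβ : α + β = critExp N) (hμ₁ : 0 < μ₁) (hμ₂ : 0 < μ₂) (hν : 0 < ν)
    (ha : 0 < a₁) (hb : 0 < b₁) {u v : Eucl N → ℝ}
    (h : IsLocalMinimizer N p q α β μ₁ μ₂ ν ρ₀ a₁ b₁ u v) {T : ℝ} (hT : 0 ≤ T) {η : ℝ} (hη : 0 ≤ η)
    (hη' : 4 - (N : ℝ) < 2 * η) (hη1 : η < 1) :
    ∃ C : ℝ, ∃ n₁ : ℕ, 1 ≤ n₁ ∧ ∀ n ≥ n₁, ∀ t, 0 ≤ t → t ≤ T → ∃ σ τ z : ℝ, 1 / 2 ≤ σ ∧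
      1 / 2 ≤ τ ∧ t ^ 2 / 2 ≤ z ∧ z ≤ t ^ 2 ∧
      pathEnergy N p q α β μ₁ μ₂ ν a₁ b₁ u v n t ≤ localInf N p q α β μ₁ μ₂ ν ρ₀ a₁ b₁ +
        bubbleEnergy N * (critExp N / (2 * α) * z -
          ν * (β / α) ^ (β / 2) * z ^ (critExp N / 2)) + C * (n : ℝ) ^ (2 * η - 2)
        - μ₁ / p * σ ^ p * (t ^ p * ∫ x, bubble N n x ^ p)
        - ν * (σ ^ α * τ ^ β) * (interactionRemainder α β u v (bubble N n) t (√(β / α) * t) -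
          t ^ α * (√(β / α) * t) ^ β * ∫ x, bubble N n x ^ critExp N) := by
  set k := √(β / α) with hk
  have hk0 : 0 < k := Real.sqrt_pos.2 (by positivity)
  set S := T + k * T with hS
  have hS0 : 0 ≤ S := by positivity
  have hK := bubbleEnergy_pos hN
  obtain ⟨C₀, hC₀, hen⟩ := exists_energy_normalized_le hN hp hp' hq hq' hα hβ hαβ hμ₁ hμ₂ hν ha hb
    h hS0
  obtain ⟨⟨⟨hu, hv, hmu, hmv⟩, -⟩, -, hu0, hv0, hsu, hsv⟩ := h
  simp only at hu hv hmu hmv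
  obtain ⟨D, hD, hest⟩ := bubble_estimates hN hη hη'
  set c := (2 * S * √a₁ + S ^ 2) / a₁ + (2 * S * √b₁ + S ^ 2) / b₁ with hc
  have n1 : 0 ≤ (2 * S * √a₁ + S ^ 2) / a₁ := by positivity
  have n2 : 0 ≤ (2 * S * √b₁ + S ^ 2) / b₁ := by positivity
  have hc0 : 0 ≤ c := add_nonneg n1 n2
  set F := critExp N / (2 * α) * T ^ 2 * (bubbleEnergy N + 1) +
    ν * (β / α) ^ (β / 2) * (T ^ 2) ^ (critExp N / 2) with hF
  have hce := critExp_pos hN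
  have hF0 : 0 ≤ F := by positivity
  have hlim := tendsto_const_mul_rpow_zero (C := D) (show 2 * η - 2 < 0 by linarith)
  have hlim2 : Tendsto (fun n : ℕ => c * √(D * (n : ℝ) ^ (2 * η - 2))) atTop (nhds (c * √0)) :=
    (hlim.sqrt).const_mul c
  rw [Real.sqrt_zero, mul_zero] at hlim2
  obtain ⟨n₂, hn₂⟩ := eventually_atTop.1 ((hlim.eventually_le_const one_pos).and
    (hlim2.eventually_le_const one_pos))
  refine ⟨F * (c ^ 2 * D + D) + C₀ * D, max n₂ 1, le_max_right _ _, fun n hn t ht htT => ?_⟩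
  have hn1 : 1 ≤ n := (le_max_right _ _).trans hn
  obtain ⟨hsm1, hsm2⟩ := hn₂ n ((le_max_left _ _).trans hn)
  obtain ⟨hW, hA, hB⟩ := hest n hn1
  set e := D * (n : ℝ) ^ (2 * η - 2) with he
  have he0 : 0 ≤ e := by positivity
  set U := bubble N n with hU
  have hUH : MemH1 U := memH1_bubble hN n
  have hU0 : ∀ x, 0 ≤ U x := bubble_nonneg hN n
  have htS : t ≤ S := htT.trans (le_add_of_nonneg_right (by positivity))
  have hktS : k * t ≤ S := (mul_le_mul_of_nonneg_left htT hk0.le).trans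
    (le_add_of_nonneg_left hT)
  have hkt0 : 0 ≤ k * t := by positivity
  have hI0 : 0 ≤ ∫ x, u x * U x := integral_nonneg fun x => mul_nonneg (hu0 x).le (hU0 x)
  have hJ0 : 0 ≤ ∫ x, v x * U x := integral_nonneg fun x => mul_nonneg (hv0 x).le (hU0 x)
  obtain ⟨σ0, σ1, -, σl, σc, -⟩ := massFactor_spec ha hu.1 hUH.1 hmu hI0 (hW.trans hsm1) ht htS
  obtain ⟨τ0, τ1, -, τl, τc, -⟩ := massFactor_spec hb hv.1 hUH.1 hmv hJ0 (hW.trans hsm1) hkt0 hktS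
  have hE := hen U hUH hU0 (exists_bubble_le_mul hN n hu0 hv0 hsu hsv) (hW.trans hsm1) t ht htS
    (k * t) hkt0 hktS _ _ rfl rfl
  set σ := massFactor a₁ fun x => u x + t * U x with hσ
  set τ := massFactor b₁ fun x => v x + k * t * U x with hτ
  have hWe : √(mass U) ≤ √e := Real.sqrt_le_sqrt hW
  have σc' : (σ ^ 2)⁻¹ - 1 ≤ c * √e :=
    σc.trans (mul_le_mul (le_add_of_nonneg_right n2) hWe (Real.sqrt_nonneg _) hc0)
  have τc' : (τ ^ 2)⁻¹ - 1 ≤ c * √e :=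
    τc.trans (mul_le_mul (le_add_of_nonneg_left n1) hWe (Real.sqrt_nonneg _) hc0)
  have hhalf : ∀ r : ℝ, 0 < r → (r ^ 2)⁻¹ - 1 ≤ c * √e → 1 / 2 ≤ r ^ 2 := fun r hr h1 => by
    have h2 : (r ^ 2)⁻¹ ≤ 2 := by linarith
    have := inv_anti₀ (by positivity) h2
    rw [inv_inv] at this
    linarith
  have σh := hhalf σ σ0 σc'
  have τh := hhalf τ τ0 τc'
  have hd : ((σ ^ 2)⁻¹ - (τ ^ 2)⁻¹) ^ 2 ≤ c ^ 2 * e := by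
    have h1 : |(σ ^ 2)⁻¹ - (τ ^ 2)⁻¹| ≤ c * √e := abs_sub_le_iff.2 ⟨by linarith, by linarith⟩
    rw [← sq_abs]
    calc _ ≤ (c * √e) ^ 2 := pow_le_pow_left₀ (abs_nonneg _) h1 2
      _ = c ^ 2 * e := by rw [mul_pow, Real.sq_sqrt he0]
  have hbr := bracket_le (t := t) (T := T) (A := gradSq U) (by linarith) (by linarith) hαβ hν σ0 σ1
    τ0 τ1 ht htT hK he0 hsm1 hA hB hd
  rw [← hk, ← hF] at hbr
  set g := (σ ^ 2) ^ (α / critExp N) * (τ ^ 2) ^ (1 - α / critExp N) with hg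
  have hθ0 : 0 ≤ α / critExp N := by positivity
  have hθ1 : α / critExp N ≤ 1 := by rw [div_le_one hce]; linarith
  have hg1 : g ≤ 1 := mul_le_one₀ (Real.rpow_le_one (by positivity) (pow_le_one₀ σ0.le σ1) hθ0)
    (by positivity) (Real.rpow_le_one (by positivity) (pow_le_one₀ τ0.le τ1) (by linarith))
  have hg2 : 1 / 2 ≤ g := by
    have h1 : (1 / 2 : ℝ) = (1 / 2) ^ (α / critExp N) * (1 / 2) ^ (1 - α / critExp N) := by
      rw [← Real.rpow_add (by norm_num), add_sub_cancel, Real.rpow_one]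
    rw [h1, hg]
    exact mul_le_mul (Real.rpow_le_rpow (by norm_num) σh hθ0)
      (Real.rpow_le_rpow (by norm_num) τh (by linarith)) (by positivity) (by positivity)
  refine ⟨σ, τ, t ^ 2 * g, half_le_of_half_le_sq σ0 σh, half_le_of_half_le_sq τ0 τh, ?_,
    mul_le_of_le_one_right (by positivity) hg1, ?_⟩
  · have := mul_le_mul_of_nonneg_left hg2 (sq_nonneg t)
    linarith
  · have hW2 := mul_le_mul_of_nonneg_left hW hC₀
    have hpe : pathEnergy N p q α β μ₁ μ₂ ν a₁ b₁ u v n t = energy p q α β μ₁ μ₂ ν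
      (fun x => σ * (u x + t * U x)) (fun x => τ * (v x + k * t * U x)) := rfl
    have hCe : (F * (c ^ 2 * D + D) + C₀ * D) * (n : ℝ) ^ (2 * η - 2) =
        F * (c ^ 2 * e + e) + C₀ * e := by
      rw [he]
      ring
    rw [hpe, hCe]
    linarith

/-- On a range of `t` away from zero the perturbation lowers the energy by more than the error: for
`N = 3` through the interaction with the minimizer, for `N ≥ 4` through the `L^p`-norm of the
bubble. -/
lemma exists_gain {N : ℕ} (hN : 3 ≤ N) {p α β μ₁ ν t₀ T : ℝ}
    (hp : 2 < p) (hp' : p < 2 + 4 / (N : ℝ))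
    (hα : 1 < α) (hβ : 1 < β) (hαβ : α + β = critExp N) (hμ₁ : 0 < μ₁) (hν : 0 < ν)
    {u v : Eucl N → ℝ} (hu : MemH1 u)
    (hv : MemH1 v) (hu0 : ∀ x, 0 < u x) (hv0 : ∀ x, 0 < v x) (hud : IsRadialDecreasing u)
    (hvd : IsRadialDecreasing v) (ht₀ : 0 < t₀) :
    ∃ η, 0 ≤ η ∧ 4 - (N : ℝ) < 2 * η ∧ η < 1 ∧ ∃ c > 0, ∃ e > 2 * η - 2, ∃ n₁ : ℕ,
      ∀ n ≥ n₁, ∀ t, t₀ ≤ t → t ≤ T → ∀ σ τ : ℝ, 1 / 2 ≤ σ → 1 / 2 ≤ τ → c * (n : ℝ) ^ e ≤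
        μ₁ / p * σ ^ p * (t ^ p * ∫ x, bubble N n x ^ p) +
        ν * (σ ^ α * τ ^ β) * (interactionRemainder α β u v (bubble N n) t (√(β / α) * t) -
          t ^ α * (√(β / α) * t) ^ β * ∫ x, bubble N n x ^ critExp N) := by
  have hk0 : 0 < √(β / α) := Real.sqrt_pos.2 (by positivity)
  have hpc := lt_critExp_of_lt hN hp'
  have hU : ∀ n, 0 ≤ ∫ x, bubble N n x ^ p := fun n =>
    integral_nonneg fun x => Real.rpow_nonneg (bubble_nonneg hN n x) _
  rcases Nat.eq_or_lt_of_le hN with hN3 | hN4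
  · obtain ⟨c, hc, n₁, hn₁, hg⟩ := exists_interaction_gain hN (T := T) hα hβ hαβ hu hv hu0 hv0 hud
      hvd hk0 ht₀
    -- the error is `O(n^{-3/4})` and the gain of order `n^{-1/2}`
    refine ⟨5 / 8, by norm_num, by rw [← hN3]; norm_num, by norm_num,
      ν * ((1 / 2) ^ α * (1 / 2) ^ β) * c, by positivity, -(((N : ℝ) - 2) / 2),
      by rw [← hN3]; norm_num, n₁, fun n hn t ht htT σ τ hσ hτ => ?_⟩
    have h1 := hg n hn t ht htT
    have ht0 : 0 < t := ht₀.trans_le ht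
    have hσ0 : 0 < σ := by linarith
    have h2 : 0 ≤ μ₁ / p * σ ^ p * (t ^ p * ∫ x, bubble N n x ^ p) :=
      mul_nonneg (by positivity) (mul_nonneg (by positivity) (hU n))
    have h3 : (1 / 2 : ℝ) ^ α ≤ σ ^ α := Real.rpow_le_rpow (by norm_num) hσ (by linarith)
    have h4 : (1 / 2 : ℝ) ^ β ≤ τ ^ β := Real.rpow_le_rpow (by norm_num) hτ (by linarith)
    have h5 : ν * ((1 / 2) ^ α * (1 / 2) ^ β) * (c * (n : ℝ) ^ (-(((N : ℝ) - 2) / 2))) ≤ _ :=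
      mul_le_mul (show ν * ((1 / 2) ^ α * (1 / 2) ^ β) ≤ ν * (σ ^ α * τ ^ β) by gcongr) h1
        (by positivity) (by positivity)
    rw [← mul_assoc] at h5
    linarith
  · have hN4' : (4 : ℝ) ≤ N := by exact_mod_cast hN4
    obtain ⟨c, hc, hg⟩ := exists_le_integral_bubble_rpow hN hp.le hpc.le
    have hNp : ((N : ℝ) - 2) * (p - 2) < 8 := by
      have h1 : (N : ℝ) * (p - 2) < N * (4 / N) := mul_lt_mul_of_pos_left (by linarith)
        (by linarith)
      rw [mul_div_cancel₀ _ (by linarith)] at h1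
      nlinarith
    have hNp0 : 0 < ((N : ℝ) - 2) * (p - 2) := mul_pos (by linarith) (by linarith)
    -- the gain has the exponent `(N-2)p/2-N = (N-2)(p-2)/2-2 > -2`, and `2η-2` is the midpoint
    -- between it and `-2`
    refine ⟨((N : ℝ) - 2) * (p - 2) / 8, by positivity, by linarith, by linarith,
      μ₁ / p * (1 / 2) ^ p * (t₀ ^ p * c), by positivity, ((N : ℝ) - 2) / 2 * p - N, by linarith,
      1, fun n hn t ht htT σ τ hσ hτ => ?_⟩
    have h1 := hg n hn
    have ht0 : 0 < t := ht₀.trans_le ht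
    have hσ0 : 0 < σ := by linarith
    have hτ0 : 0 < τ := by linarith
    have h2 := integral_bubble_critExp_le_interactionRemainder hN n hα hβ hαβ hu hv hu0 hv0 hud hvd
      ht0.le (by positivity : 0 ≤ √(β / α) * t)
    have h3 := mul_nonneg (show 0 ≤ ν * (σ ^ α * τ ^ β) by positivity) (sub_nonneg.2 h2)
    have h4 : (1 / 2 : ℝ) ^ p ≤ σ ^ p := Real.rpow_le_rpow (by norm_num) hσ (by linarith)
    have h5 : t₀ ^ p ≤ t ^ p := Real.rpow_le_rpow ht₀.le ht (by linarith)
    have h6 : μ₁ / p * (1 / 2) ^ p * (t₀ ^ p * (c * (n : ℝ) ^ (((N : ℝ) - 2) / 2 * p - N))) ≤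
        μ₁ / p * σ ^ p * (t ^ p * ∫ x, bubble N n x ^ p) := by gcongr
    linarith

/-- Strictly below the threshold: near `t = 0` the bubble has little energy, and away from it the
gain exceeds the error. -/
lemma exists_pathEnergy_lt {N : ℕ} (hN : 3 ≤ N) {p q α β μ₁ μ₂ ν ρ₀ a₁ b₁ : ℝ}
    (hp : 2 < p) (hp' : p < 2 + 4 / (N : ℝ)) (hq : 2 < q) (hq' : q < 2 + 4 / (N : ℝ))
    (hα : 1 < α) (hβ : 1 < β) (hαβ : α + β = critExp N) (hμ₁ : 0 < μ₁) (hμ₂ : 0 < μ₂) (hν : 0 < ν)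
    (ha : 0 < a₁) (hb : 0 < b₁) {u v : Eucl N → ℝ}
    (h : IsLocalMinimizer N p q α β μ₁ μ₂ ν ρ₀ a₁ b₁ u v) {T : ℝ} (hT : 0 ≤ T) :
    ∃ n₁ : ℕ, ∀ n ≥ n₁, ∀ t, 0 ≤ t → t ≤ T →
      pathEnergy N p q α β μ₁ μ₂ ν a₁ b₁ u v n t < localInf N p q α β μ₁ μ₂ ν ρ₀ a₁ b₁ +
        bubbleEnergy N * (2 / ((N : ℝ) - 2) * ν ^ (-(((N : ℝ) - 2) / 2)) *
          α ^ (-(((N : ℝ) - 2) * α / 4)) * β ^ (-(((N : ℝ) - 2) * β / 4))) := by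
  have hN3 : (3 : ℝ) ≤ N := by exact_mod_cast hN
  have hK := bubbleEnergy_pos hN
  have hce := critExp_pos hN
  set ℓ := 2 / ((N : ℝ) - 2) * ν ^ (-(((N : ℝ) - 2) / 2)) *
    α ^ (-(((N : ℝ) - 2) * α / 4)) * β ^ (-(((N : ℝ) - 2) * β / 4)) with hℓ
  have hN2 : 0 < (N : ℝ) - 2 := by linarith
  have hℓ0 : 0 < ℓ := by positivity
  have hc₁ : 0 < critExp N / (2 * α) := by positivity
  set c₁ := critExp N / (2 * α) with hc₁def
  set t₀ := √(ℓ / (2 * c₁)) with ht₀def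
  have ht₀ : 0 < t₀ := Real.sqrt_pos.2 (by positivity)
  have ht₀2 : c₁ * t₀ ^ 2 = ℓ / 2 := by
    rw [ht₀def, Real.sq_sqrt (by positivity)]
    field_simp
  obtain ⟨⟨⟨hu, hv, -, -⟩, -⟩, -, hu0, hv0, hsu, hsv⟩ := id h
  obtain ⟨η, hη, hη', hη1, c, hc, e, he, n₁, hgain⟩ := exists_gain hN (T := T) hp hp' hα hβ hαβ hμ₁
    hν hu hv hu0 hv0 hsu hsv ht₀
  obtain ⟨C, n₂, hn₂, hle⟩ := exists_pathEnergy_le hN hp hp' hq hq' hα hβ hαβ hμ₁ hμ₂ hν ha hb h hT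
    hη hη' hη1
  obtain ⟨n₃, hn₃⟩ := eventually_atTop.1 ((eventually_mul_rpow_lt (C := C) hc he).and
    ((tendsto_const_mul_rpow_zero (C := C) (show 2 * η - 2 < 0 by linarith)).eventually_lt_const
      (show 0 < bubbleEnergy N * (ℓ / 2) by positivity)))
  refine ⟨max n₁ (max n₂ n₃), fun n hn t ht htT => ?_⟩
  obtain ⟨hs1, hs2⟩ := hn₃ n (((le_max_right _ _).trans (le_max_right _ _)).trans hn)
  obtain ⟨σ, τ, z, hσ, hτ, hz, hz', hH⟩ :=
    hle n (((le_max_left _ _).trans (le_max_right _ _)).trans hn) t ht htT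
  have hz0 : 0 ≤ z := le_trans (by positivity) hz
  rcases le_or_gt t₀ t with htt | htt
  · have h1 := hgain n ((le_max_left _ _).trans hn) t htt htT σ τ hσ hτ
    have h2 := mul_le_mul_of_nonneg_left (bubbleLevel_le hN (by linarith) (by linarith) hαβ hν hz0)
      hK.le
    rw [← hc₁def, ← hℓ] at h2
    linarith
  · have h1 : c₁ * z ≤ ℓ / 2 := by
      rw [← ht₀2]
      refine mul_le_mul_of_nonneg_left (hz'.trans ?_) hc₁.le
      gcongr
    have h2 : 0 ≤ ν * (β / α) ^ (β / 2) * z ^ (critExp N / 2) := by positivity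
    have h3 : bubbleEnergy N * (c₁ * z - ν * (β / α) ^ (β / 2) * z ^ (critExp N / 2)) ≤
        bubbleEnergy N * (ℓ / 2) := mul_le_mul_of_nonneg_left (by linarith) hK.le
    have hσ0 : 0 < σ := by linarith
    have hτ0 : 0 < τ := by linarith
    have h4 := integral_bubble_critExp_le_interactionRemainder hN n hα hβ hαβ hu hv hu0 hv0 hsu hsv
      ht (by positivity : 0 ≤ √(β / α) * t)
    have h5 := mul_nonneg (show 0 ≤ ν * (σ ^ α * τ ^ β) by positivity) (sub_nonneg.2 h4)
    have h6 : 0 ≤ μ₁ / p * σ ^ p * (t ^ p * ∫ x, bubble N n x ^ p) :=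
      mul_nonneg (by positivity) (mul_nonneg (by positivity)
        (integral_nonneg fun x => Real.rpow_nonneg (bubble_nonneg hN n x) _))
    linarith

lemma exists_forall_bubbleProfile_lt {c₁ c₂ q : ℝ} (hc₂ : 0 < c₂) (hq : 1 < q) (B : ℝ) :
    ∃ z₁ : ℝ, ∀ z ≥ z₁, c₁ * z - c₂ * z ^ q < B := by
  have h := (tendsto_rpow_atTop (show 0 < q - 1 by linarith)).eventually_ge_atTop
    ((c₁ + |B| + 1) / c₂)
  obtain ⟨z₁, hz₁⟩ := eventually_atTop.1 (h.and (eventually_ge_atTop 1))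
  refine ⟨z₁, fun z hz => ?_⟩
  obtain ⟨h1, h2⟩ := hz₁ z hz
  have hz0 : 0 < z := by linarith
  have e : z ^ q = z ^ (q - 1) * z := by rw [← Real.rpow_add_one hz0.ne', sub_add_cancel]
  rw [div_le_iff₀ hc₂] at h1
  have h3 := mul_le_mul_of_nonneg_right h1 hz0.le
  have h4 := mul_le_mul_of_nonneg_left h2 (abs_nonneg B)
  rw [e]
  linarith [neg_abs_le B]

/-- Far along the path the energy drops below any level. -/
lemma exists_pathEnergy_lt_level {N : ℕ} (hN : 3 ≤ N) {p q α β μ₁ μ₂ ν ρ₀ a₁ b₁ : ℝ}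
    (hp : 2 < p) (hp' : p < 2 + 4 / (N : ℝ)) (hq : 2 < q) (hq' : q < 2 + 4 / (N : ℝ))
    (hα : 1 < α) (hβ : 1 < β) (hαβ : α + β = critExp N) (hμ₁ : 0 < μ₁) (hμ₂ : 0 < μ₂) (hν : 0 < ν)
    (ha : 0 < a₁) (hb : 0 < b₁) {u v : Eucl N → ℝ}
    (h : IsLocalMinimizer N p q α β μ₁ μ₂ ν ρ₀ a₁ b₁ u v) (B : ℝ) :
    ∃ T : ℝ, 0 < T ∧ ∃ n₁ : ℕ, ∀ n ≥ n₁, pathEnergy N p q α β μ₁ μ₂ ν a₁ b₁ u v n T < B := by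
  have hN3 : (3 : ℝ) ≤ N := by exact_mod_cast hN
  have hK := bubbleEnergy_pos hN
  have hce := critExp_pos hN
  set m := localInf N p q α β μ₁ μ₂ ν ρ₀ a₁ b₁ with hm
  obtain ⟨z₁, hz₁⟩ := exists_forall_bubbleProfile_lt (c₁ := critExp N / (2 * α))
    (c₂ := ν * (β / α) ^ (β / 2)) (q := critExp N / 2) (by positivity)
    (by linarith [two_lt_critExp hN]) ((B - m - 1) / bubbleEnergy N)
  set T := √(2 * (|z₁| + 1)) with hTdef
  have hT0 : 0 < T := Real.sqrt_pos.2 (by positivity)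
  have hT2 : T ^ 2 = 2 * (|z₁| + 1) := Real.sq_sqrt (by positivity)
  obtain ⟨C, n₂, hn₂, hle⟩ := exists_pathEnergy_le hN hp hp' hq hq' hα hβ hαβ hμ₁ hμ₂ hν ha hb h
    hT0.le (η := 3 / 4) (by norm_num) (by linarith) (by norm_num)
  obtain ⟨n₃, hn₃⟩ := eventually_atTop.1 ((tendsto_const_mul_rpow_zero (C := C)
    (show 2 * (3 / 4 : ℝ) - 2 < 0 by norm_num)).eventually_lt_const one_pos)
  obtain ⟨⟨⟨hu, hv, -, -⟩, -⟩, -, hu0, hv0, hsu, hsv⟩ := id h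
  refine ⟨T, hT0, max n₂ n₃, fun n hn => ?_⟩
  have hs := hn₃ n ((le_max_right _ _).trans hn)
  obtain ⟨σ, τ, z, hσ, hτ, hz, hz', hH⟩ := hle n ((le_max_left _ _).trans hn) T hT0.le le_rfl
  have hzz : z₁ ≤ z := by
    have := le_abs_self z₁
    linarith
  have h1 := hz₁ z hzz
  rw [lt_div_iff₀' hK] at h1
  have hσ0 : 0 < σ := by linarith
  have hτ0 : 0 < τ := by linarith
  have h4 := integral_bubble_critExp_le_interactionRemainder hN n hα hβ hαβ hu hv hu0 hv0 hsu hsv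
    hT0.le (by positivity : 0 ≤ √(β / α) * T)
  have h5 := mul_nonneg (show 0 ≤ ν * (σ ^ α * τ ^ β) by positivity) (sub_nonneg.2 h4)
  have h6 : 0 ≤ μ₁ / p * σ ^ p * (T ^ p * ∫ x, bubble N n x ^ p) :=
    mul_nonneg (by positivity) (mul_nonneg (by positivity)
      (integral_nonneg fun x => Real.rpow_nonneg (bubble_nonneg hN n x) _))
  linarith

/-! ### The maximum along the path -/

lemma mass_normalizeMass {N : ℕ} {a : ℝ} (ha : 0 ≤ a) {u : Eucl N → ℝ} (hu : 0 < mass u) :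
    mass (normalizeMass a u) = a := by
  rw [normalizeMass_eq, mass_const_mul, massFactor, div_pow, Real.sq_sqrt ha, Real.sq_sqrt hu.le,
    div_mul_cancel₀ _ hu.ne']

lemma MemH1.normalizeMass {N : ℕ} {a : ℝ} {u : Eucl N → ℝ} (hu : MemH1 u) :
    MemH1 (normalizeMass a u) :=
  hu.const_mul _

lemma normalizeMass_self {N : ℕ} {a : ℝ} (ha : 0 < a) {u : Eucl N → ℝ} (hu : mass u = a) :
    normalizeMass a u = u := by
  funext x
  rw [normalizeMass_eq, massFactor, hu, div_self (Real.sqrt_pos.2 ha).ne']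
  exact one_mul _

lemma mass_le_mass_add_mul {N : ℕ} {u U : Eucl N → ℝ} (hu : MemH1 u) (hU : MemH1 U)
    (hu0 : ∀ x, 0 < u x) (hU0 : ∀ x, 0 ≤ U x) {t : ℝ} (ht : 0 ≤ t) :
    mass u ≤ mass (fun x => u x + t * U x) := by
  have hI : 0 ≤ ∫ x, u x * U x := integral_nonneg fun x => mul_nonneg (hu0 x).le (hU0 x)
  have hW := mass_nonneg U
  rw [mass_add_mul hu.1 hU.1]
  have : 0 ≤ 2 * t * (∫ x, u x * U x) := by positivity
  have : 0 ≤ t ^ 2 * mass U := by positivity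
  linarith

lemma continuousOn_massFactor {N : ℕ} {a k : ℝ} {u U : Eucl N → ℝ} (hu : MemH1 u) (hU : MemH1 U)
    (hu0 : ∀ x, 0 < u x) (hU0 : ∀ x, 0 ≤ U x) (hm : 0 < mass u) (hk : 0 ≤ k) :
    ContinuousOn (fun t => massFactor a fun x => u x + k * t * U x) (Ici 0) := by
  simp only [massFactor]
  refine ContinuousOn.div continuousOn_const (Continuous.continuousOn ?_) fun t ht => ?_
  · simp_rw [mass_add_mul hu.1 hU.1]
    fun_prop
  · have ht : 0 ≤ t := ht
    exact (Real.sqrt_pos.2 (hm.trans_le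
      (mass_le_mass_add_mul hu hU hu0 hU0 (by positivity : 0 ≤ k * t)))).ne'

lemma continuous_gradSq_add_mul {N : ℕ} {k : ℝ} {u U : Eucl N → ℝ} (hu : MemH1 u) (hU : MemH1 U) :
    Continuous fun t => gradSq fun x => u x + k * t * U x := by
  simp_rw [gradSq_add_mul hu hU]
  fun_prop

lemma gradSq_normalizeMass {N : ℕ} (a : ℝ) {u : Eucl N → ℝ} (hu : MemH1 u) :
    gradSq (normalizeMass a u) = massFactor a u ^ 2 * gradSq u :=
  gradSq_const_mul hu _

lemma massFactor_nonneg {N : ℕ} (a : ℝ) (u : Eucl N → ℝ) : 0 ≤ massFactor a u :=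
  div_nonneg (Real.sqrt_nonneg _) (Real.sqrt_nonneg _)

/-- Integrals of powers depend continuously on `t`, by domination with the values at `T`. -/
lemma continuousOn_integral_interaction {N : ℕ} (hN : 3 ≤ N) {α β k l T : ℝ} {u v U : Eucl N → ℝ}
    (hα : 0 < α) (hβ : 0 < β) (hαβ : α + β = critExp N) (hu : MemH1 u) (hv : MemH1 v)
    (hU : MemH1 U) (hu0 : ∀ x, 0 < u x) (hv0 : ∀ x, 0 < v x) (hU0 : ∀ x, 0 ≤ U x) (hk : 0 ≤ k)
    (hl : 0 ≤ l) : ContinuousOn (fun t => ∫ x, |u x + k * t * U x| ^ α * |v x + l * t * U x| ^ β)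
      (Icc 0 T) := by
  have hH : ∀ {w : Eucl N → ℝ} {c : ℝ} (t : ℝ), MemH1 w → MemH1 fun x => w x + c * t * U x :=
    fun t hw => hw.add (hU.const_mul _)
  have hmono : ∀ {w : Eucl N → ℝ} {c : ℝ}, (∀ x, 0 < w x) → 0 ≤ c → ∀ t ∈ Icc 0 T, ∀ x,
      |w x + c * t * U x| ≤ |w x + c * T * U x| := by
    intro w c hw hc t ht x
    have h1 := hw x
    have h2 := hU0 x
    have h3 : 0 ≤ t := ht.1
    have h4 : t ≤ T := ht.2
    have h5 : 0 ≤ T := h3.trans h4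
    rw [abs_of_nonneg (by positivity), abs_of_nonneg (by positivity)]
    gcongr
  refine continuousOn_of_dominated (bound := fun x => |u x + k * T * U x| ^ α *
    |v x + l * T * U x| ^ β) (fun t _ => (integrable_interaction hN (hH t hu) (hH t hv) hα hβ
      hαβ).1) (fun t ht => Eventually.of_forall fun x => ?_)
    (integrable_interaction hN (hH T hu) (hH T hv) hα hβ hαβ)
    (Eventually.of_forall fun x => Continuous.continuousOn ?_)
  · rw [Real.norm_of_nonneg (by positivity)]
    exact mul_le_mul (Real.rpow_le_rpow (abs_nonneg _) (hmono hu0 hk t ht x) hα.le)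
      (Real.rpow_le_rpow (abs_nonneg _) (hmono hv0 hl t ht x) hβ.le) (by positivity) (by positivity)
  · exact ((Continuous.abs (by fun_prop)).rpow_const fun _ => Or.inr hα.le).mul
      ((Continuous.abs (by fun_prop)).rpow_const fun _ => Or.inr hβ.le)

lemma continuousOn_integral_rpow {N : ℕ} (hN : 3 ≤ N) {p k T : ℝ} {u U : Eucl N → ℝ}
    (hp : 2 ≤ p) (hp' : p ≤ critExp N) (hu : MemH1 u)
    (hU : MemH1 U) (hu0 : ∀ x, 0 < u x) (hU0 : ∀ x, 0 ≤ U x) (hk : 0 ≤ k) :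
    ContinuousOn (fun t => ∫ x, |u x + k * t * U x| ^ p) (Icc 0 T) := by
  have hH : ∀ t : ℝ, MemH1 fun x => u x + k * t * U x := fun t => hu.add (hU.const_mul _)
  refine continuousOn_of_dominated (bound := fun x => |u x + k * T * U x| ^ p)
    (fun t _ => (integrable_rpow_of_memH1 hN (hH t) hp hp').1)
    (fun t ht => Eventually.of_forall fun x => ?_) (integrable_rpow_of_memH1 hN (hH T) hp hp')
    (Eventually.of_forall fun x => Continuous.continuousOn ?_)
  · have h1 := hu0 x
    have h2 := hU0 x
    have h3 : 0 ≤ t := ht.1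
    have h4 : t ≤ T := ht.2
    have h5 : 0 ≤ T := h3.trans h4
    rw [Real.norm_of_nonneg (by positivity), abs_of_nonneg (by positivity),
      abs_of_nonneg (by positivity)]
    gcongr
  · exact (Continuous.abs (by fun_prop)).rpow_const fun _ => Or.inr (by linarith)

lemma continuousOn_pathEnergy {N : ℕ} (hN : 3 ≤ N) {p q α β μ₁ μ₂ ν a₁ b₁ T : ℝ} (n : ℕ)
    (hp : 2 < p) (hp' : p < critExp N) (hq : 2 < q) (hq' : q < critExp N) (hα : 0 < α) (hβ : 0 < β)
    (hαβ : α + β = critExp N) {u v : Eucl N → ℝ} (hu : MemH1 u) (hv : MemH1 v)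
    (hu0 : ∀ x, 0 < u x) (hv0 : ∀ x, 0 < v x) (hmu : 0 < mass u) (hmv : 0 < mass v) :
    ContinuousOn (pathEnergy N p q α β μ₁ μ₂ ν a₁ b₁ u v n) (Icc 0 T) := by
  have hU := memH1_bubble hN n
  have hU0 := bubble_nonneg hN n
  have hk : 0 ≤ √(β / α) := Real.sqrt_nonneg _
  have hsub : Icc (0 : ℝ) T ⊆ Ici 0 := fun t ht => ht.1
  have e : pathEnergy N p q α β μ₁ μ₂ ν a₁ b₁ u v n = fun t =>
      1 / 2 * ((massFactor a₁ fun x => u x + 1 * t * bubble N n x) ^ 2 *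
          gradSq (fun x => u x + 1 * t * bubble N n x) +
        (massFactor b₁ fun x => v x + √(β / α) * t * bubble N n x) ^ 2 *
          gradSq (fun x => v x + √(β / α) * t * bubble N n x)) -
      μ₁ / p * ((massFactor a₁ fun x => u x + 1 * t * bubble N n x) ^ p *
        ∫ x, |u x + 1 * t * bubble N n x| ^ p) -
      μ₂ / q * ((massFactor b₁ fun x => v x + √(β / α) * t * bubble N n x) ^ q *
        ∫ x, |v x + √(β / α) * t * bubble N n x| ^ q) -
      ν * ((massFactor a₁ fun x => u x + 1 * t * bubble N n x) ^ α *
        (massFactor b₁ fun x => v x + √(β / α) * t * bubble N n x) ^ β *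
        ∫ x, |u x + 1 * t * bubble N n x| ^ α * |v x + √(β / α) * t * bubble N n x| ^ β) := by
    funext t
    have h1 : MemH1 fun x => u x + 1 * t * bubble N n x := hu.add (hU.const_mul _)
    have h2 : MemH1 fun x => v x + √(β / α) * t * bubble N n x := hv.add (hU.const_mul _)
    rw [pathEnergy, energy]
    simp only [one_mul] at h1 ⊢
    rw [gradSq_normalizeMass _ h1, gradSq_normalizeMass _ h2]
    simp only [normalizeMass_eq]
    rw [integral_abs_const_mul_rpow _ (massFactor_nonneg _ _),
      integral_abs_const_mul_rpow _ (massFactor_nonneg _ _),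
      integral_interaction_const_mul _ _ (massFactor_nonneg _ _) (massFactor_nonneg _ _)]
  rw [e]
  have f1 := (continuousOn_massFactor (a := a₁) hu hU hu0 hU0 hmu zero_le_one).mono hsub
  have f2 := (continuousOn_massFactor (a := b₁) hv hU hv0 hU0 hmv hk).mono hsub
  have g1 := (continuous_gradSq_add_mul (k := 1) hu hU).continuousOn (s := Icc 0 T)
  have g2 := (continuous_gradSq_add_mul (k := √(β / α)) hv hU).continuousOn (s := Icc 0 T)
  have i1 := continuousOn_integral_rpow hN (T := T) hp.le hp'.le hu hU hu0 hU0 zero_le_one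
  have i2 := continuousOn_integral_rpow hN (T := T) hq.le hq'.le hv hU hv0 hU0 hk
  have i3 := continuousOn_integral_interaction hN (T := T) hα hβ hαβ hu hv hU hu0 hv0 hU0
    zero_le_one hk
  have pw : ∀ {f : ℝ → ℝ} {r : ℝ}, ContinuousOn f (Icc 0 T) → 0 ≤ r →
      ContinuousOn (fun t => f t ^ r) (Icc 0 T) := fun hf hr => hf.rpow_const fun _ _ => Or.inr hr
  exact (((continuousOn_const.mul (((f1.pow 2).mul g1).add ((f2.pow 2).mul g2))).sub
    (continuousOn_const.mul ((pw f1 (by linarith)).mul i1))).sub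
    (continuousOn_const.mul ((pw f2 (by linarith)).mul i2))).sub
    (continuousOn_const.mul (((pw f1 hα.le).mul (pw f2 hβ.le)).mul i3))

/-- A path that ends below `2 m_ν < m_ν` has left the set `A_{ρ₀}`, hence crosses `B_{ρ₀}`, where
the energy is positive; so its maximum is attained in the interior. -/
lemma exists_isMaxOn_pathEnergy {N : ℕ} (hN : 3 ≤ N) {p q α β μ₁ μ₂ ν ρ₀ k₀ a₁ b₁ T : ℝ} (n : ℕ)
    (hp : 2 < p) (hp' : p < 2 + 4 / (N : ℝ)) (hq : 2 < q) (hq' : q < 2 + 4 / (N : ℝ))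
    (hα : 1 < α) (hβ : 1 < β) (hαβ : α + β = critExp N) (hμ₁ : 0 < μ₁) (hμ₂ : 0 < μ₂) (hν : 0 < ν)
    (ha : 0 < a₁) (hb : 0 < b₁) (hρ : 0 < ρ₀) (hk : 0 < k₀)
    (hm : localInf N p q α β μ₁ μ₂ ν ρ₀ a₁ b₁ < 0)
    (hB : ∀ w ∈ setB N a₁ b₁ ρ₀, k₀ ≤ energy p q α β μ₁ μ₂ ν w.1 w.2) {u v : Eucl N → ℝ}
    (h : IsLocalMinimizer N p q α β μ₁ μ₂ ν ρ₀ a₁ b₁ u v) (hT : 0 < T)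
    (hend : pathEnergy N p q α β μ₁ μ₂ ν a₁ b₁ u v n T <
      2 * localInf N p q α β μ₁ μ₂ ν ρ₀ a₁ b₁) :
    ∃ t ∈ Ioo 0 T, IsMaxOn (pathEnergy N p q α β μ₁ μ₂ ν a₁ b₁ u v n) (Icc 0 T) t := by
  have hmin := h.minimal hN hp hp' hq hq' hα hβ hαβ hμ₁ hμ₂ hν
  obtain ⟨⟨⟨hu, hv, hmu, hmv⟩, hgr⟩, hatt, hu0, hv0, -, -⟩ := h
  simp only at hu hv hmu hmv hgr
  have hU := memH1_bubble hN n
  have hU0 := bubble_nonneg hN n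
  have hk' : 0 ≤ √(β / α) := Real.sqrt_nonneg _
  have hmu0 : 0 < mass u := by rwa [hmu]
  have hmv0 : 0 < mass v := by rwa [hmv]
  set H := pathEnergy N p q α β μ₁ μ₂ ν a₁ b₁ u v n with hH
  set Φ : ℝ → Eucl N → ℝ := fun t => normalizeMass a₁ fun x => u x + 1 * t * bubble N n x with hΦ
  set Ψ : ℝ → Eucl N → ℝ := fun t => normalizeMass b₁ fun x => v x + √(β / α) * t * bubble N n x
    with hΨ
  have hHe : ∀ t, H t = energy p q α β μ₁ μ₂ ν (Φ t) (Ψ t) := fun t => by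
    simp only [hH, hΦ, hΨ, pathEnergy, one_mul]
  have hcont : ContinuousOn H (Icc 0 T) := continuousOn_pathEnergy hN n hp (lt_critExp_of_lt hN hp')
    hq (lt_critExp_of_lt hN hq') (by linarith) (by linarith) hαβ hu hv hu0 hv0 hmu0 hmv0
  have htorus : ∀ t, 0 ≤ t → (Φ t, Ψ t) ∈ torus N a₁ b₁ := fun t ht =>
    ⟨(hu.add (hU.const_mul (1 * t))).normalizeMass,
      (hv.add (hU.const_mul (√(β / α) * t))).normalizeMass,
      mass_normalizeMass ha.le (hmu0.trans_le (mass_le_mass_add_mul hu hU hu0 hU0 (by positivity))),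
      mass_normalizeMass hb.le (hmv0.trans_le (mass_le_mass_add_mul hv hU hv0 hU0 (by positivity)))⟩
  have hΦ0 : Φ 0 = u := by
    simp only [hΦ, mul_zero, zero_mul, add_zero]
    exact normalizeMass_self ha hmu
  have hΨ0 : Ψ 0 = v := by
    simp only [hΨ, mul_zero, zero_mul, add_zero]
    exact normalizeMass_self hb hmv
  have hH0 : H 0 < 0 := by
    rw [hHe, hΦ0, hΨ0, hatt]
    exact hm
  have hHT : H T < 0 := by linarith
  have hsub : Icc (0 : ℝ) T ⊆ Ici 0 := fun t ht => ht.1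
  set Γ : ℝ → ℝ := fun t => gradSq (Φ t) + gradSq (Ψ t) with hΓ
  have hΓc : ContinuousOn Γ (Icc 0 T) := by
    have e : Γ = fun t => (massFactor a₁ fun x => u x + 1 * t * bubble N n x) ^ 2 *
          gradSq (fun x => u x + 1 * t * bubble N n x) +
        (massFactor b₁ fun x => v x + √(β / α) * t * bubble N n x) ^ 2 *
          gradSq (fun x => v x + √(β / α) * t * bubble N n x) := by
      funext t
      simp only [hΓ, hΦ, hΨ]
      rw [gradSq_normalizeMass _ (hu.add (hU.const_mul _)),
        gradSq_normalizeMass _ (hv.add (hU.const_mul _))]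
    rw [e]
    have f1 := (continuousOn_massFactor (a := a₁) hu hU hu0 hU0 hmu0 zero_le_one).mono hsub
    have f2 := (continuousOn_massFactor (a := b₁) hv hU hv0 hU0 hmv0 hk').mono hsub
    exact ((f1.pow 2).mul (continuous_gradSq_add_mul hu hU).continuousOn).add
      ((f2.pow 2).mul (continuous_gradSq_add_mul hv hU).continuousOn)
  have hΓ0 : Γ 0 ≤ ρ₀ := by
    simp only [hΓ]
    rw [hΦ0, hΨ0]
    exact hgr.le
  have hΓT : ρ₀ ≤ Γ T := by
    by_contra hlt
    have := hmin (Φ T, Ψ T) ⟨htorus T hT.le, not_le.1 hlt⟩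
    simp only at this
    rw [← hHe, hatt] at this
    linarith
  obtain ⟨t₁, ht₁, hΓ₁⟩ := intermediate_value_Icc hT.le hΓc ⟨hΓ0, hΓT⟩
  have hH1 : k₀ ≤ H t₁ := by
    rw [hHe]
    refine hB (Φ t₁, Ψ t₁) ⟨htorus t₁ ht₁.1, hΓ₁.ge, ?_⟩
    exact hΓ₁.le.trans (by linarith)
  obtain ⟨t, ht, hmax⟩ := isCompact_Icc.exists_isMaxOn (nonempty_Icc.2 hT.le) hcont
  have hHt : 0 < H t := hk.trans_le (hH1.trans (hmax ht₁))
  refine ⟨t, ⟨lt_of_le_of_ne ht.1 ?_, lt_of_le_of_ne ht.2 ?_⟩, hmax⟩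
  · rintro rfl
    linarith
  · rintro rfl
    linarith

end NLSSystem

end

theorem mainTheorem7 (N : ℕ) (hN : 3 ≤ N) (p q α β μ₁ μ₂ a b : ℝ)
    (hp : 2 < p) (hp' : p < 2 + 4 / (N : ℝ)) (hq : 2 < q) (hq' : q < 2 + 4 / (N : ℝ))
    (hα : 1 < α) (hβ : 1 < β) (hαβ : α + β = NLSSystem.critExp N)
    (hμ₁ : 0 < μ₁) (hμ₂ : 0 < μ₂) (ha : 0 < a) (hb : 0 < b) :
    (∃ ν₀ k₀ ρ₀ : ℝ, NLSSystem.IsLocalMinConstants N p q α β μ₁ μ₂ a b ν₀ k₀ ρ₀) ∧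
    ∀ ν₀ k₀ ρ₀ : ℝ, NLSSystem.IsLocalMinConstants N p q α β μ₁ μ₂ a b ν₀ k₀ ρ₀ →
      ∀ ν ∈ Set.Ioo 0 ν₀, ∀ a₁ ∈ Set.Ioc 0 a, ∀ b₁ ∈ Set.Ioc 0 b,
      ∀ u₀ v₀ : NLSSystem.Eucl N → ℝ,
        NLSSystem.IsLocalMinimizer N p q α β μ₁ μ₂ ν ρ₀ a₁ b₁ u₀ v₀ →
        (∃ T : ℝ, 0 < T ∧ ∃ nT : ℕ, ∀ n ≥ nT,
          NLSSystem.pathEnergy N p q α β μ₁ μ₂ ν a₁ b₁ u₀ v₀ n T <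
            2 * NLSSystem.localInf N p q α β μ₁ μ₂ ν ρ₀ a₁ b₁) ∧
        ∀ T : ℝ, 0 < T → ∀ nT : ℕ,
          (∀ n ≥ nT, NLSSystem.pathEnergy N p q α β μ₁ μ₂ ν a₁ b₁ u₀ v₀ n T <
            2 * NLSSystem.localInf N p q α β μ₁ μ₂ ν ρ₀ a₁ b₁) →
          (∀ n ≥ nT, ∃ t ∈ Set.Ioo 0 T,
            IsMaxOn (NLSSystem.pathEnergy N p q α β μ₁ μ₂ ν a₁ b₁ u₀ v₀ n) (Set.Icc 0 T) t) ∧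
          ∃ n₀ ≥ nT, ∀ n ≥ n₀, ∀ t ∈ Set.Icc 0 T,
            IsMaxOn (NLSSystem.pathEnergy N p q α β μ₁ μ₂ ν a₁ b₁ u₀ v₀ n) (Set.Icc 0 T) t →
            NLSSystem.pathEnergy N p q α β μ₁ μ₂ ν a₁ b₁ u₀ v₀ n t <
              NLSSystem.localInf N p q α β μ₁ μ₂ ν ρ₀ a₁ b₁ +
                2 / ((N : ℝ) - 2) * ν ^ (-(((N : ℝ) - 2) / 2)) *
                  α ^ (-(((N : ℝ) - 2) * α / 4)) * β ^ (-(((N : ℝ) - 2) * β / 4)) *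
                  NLSSystem.sobolevConst N ^ ((N : ℝ) / 2) := by
  refine ⟨NLSSystem.exists_isLocalMinConstants hN hp hp' hq hq' hα hβ hαβ hμ₁ hμ₂ ha hb,
    fun ν₀ k₀ ρ₀ hconst ν hν a₁ ha₁ b₁ hb₁ u₀ v₀ hmin => ?_⟩
  obtain ⟨-, hk₀, hρ₀, hgeom⟩ := hconst
  obtain ⟨hm, hB⟩ := hgeom a₁ ⟨ha₁.1.le, ha₁.2⟩ b₁ ⟨hb₁.1.le, hb₁.2⟩
    (fun h => ha₁.1.ne' (congrArg Prod.fst h)) ν hν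
  refine ⟨NLSSystem.exists_pathEnergy_lt_level hN hp hp' hq hq' hα hβ hαβ hμ₁ hμ₂ hν.1 ha₁.1 hb₁.1
    hmin _, fun T hT nT hend => ⟨fun n hn => NLSSystem.exists_isMaxOn_pathEnergy hN n hp hp' hq hq'
    hα hβ hαβ hμ₁ hμ₂ hν.1 ha₁.1 hb₁.1 hρ₀ hk₀ hm hB hmin hT (hend n hn), ?_⟩⟩
  obtain ⟨n₁, hn₁⟩ := NLSSystem.exists_pathEnergy_lt hN hp hp' hq hq' hα hβ hαβ hμ₁ hμ₂ hν.1 ha₁.1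
    hb₁.1 hmin hT.le
  refine ⟨max nT n₁, le_max_left _ _, fun n hn t ht _ => ?_⟩
  refine (hn₁ n ((le_max_right _ _).trans hn) t ht.1 ht.2).trans_le ?_
  -- the level obtained has the energy of the standard bubble in place of `S^{N/2}`
  have hK := NLSSystem.bubbleEnergy_le_sobolevConst_rpow hN
  have hN3 : (3 : ℝ) ≤ N := by exact_mod_cast hN
  have hN2 : 0 < (N : ℝ) - 2 := by linarith
  have hν0 : 0 < ν := hν.1
  have hα0 : 0 < α := by linarith
  have hβ0 : 0 < β := by linarith
  have hnn : 0 ≤ 2 / ((N : ℝ) - 2) * ν ^ (-(((N : ℝ) - 2) / 2)) *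
      α ^ (-(((N : ℝ) - 2) * α / 4)) * β ^ (-(((N : ℝ) - 2) * β / 4)) := by positivity
  have := mul_le_mul_of_nonneg_right hK hnn
  linarith
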